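/- Let $P\subset\mathbb R^n$ be a simple polytope of dimension $n$ with $m$ facets, let $K_P$ be the simplicial complex dual to $\partial P$ (its vertices are the facets of $P$, and a set of facets is a simplex iff these facets have a common point), and let $$Z=Z(P)=\bigcup_{\sigma\in K_P}\{z\in (D^2)^m : |z_F|=1 \text{ for every facet } F\notin\sigma\}$$ be the corresponding moment-angle manifold, of dimension $m+n$, where $D^2\subset\mathbb C$ is the closed unit disc. Let $D^{m+n}\subset Z$ be an embedded closed disc, the image of the closed unit ball under an open embedding $\mathbb R^{m+n}\to Z$, and put $X=\partial[(Z-\operatorname{int}D^{m+n})\times D^2]$. Cohomology is singular cohomology with integer coefficients and the cup product, and $H^*(Z)\otimes H^*(S^1)$ carries the product $(a\otimes b)(a'\otimes b')=(-1)^{|b||a'|}aa'\otimes bb'$. Let $[Z]\in H^{m+n}(Z)$ and $[S^1]\in H^1(S^1)$ be fundamental classes, i.e. generators of these infinite cyclic groups. (1) There is an isomorphism of graded abelian groups $$H^*(X)\;\cong\; H^*(Z)\otimes H^*(S^1)\,/\,\{1\otimes[S^1],\,[Z]\otimes 1\},$$ where the right-hand side is the quotient by the subgroup spanned by the two classes.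 It is an isomorphism of rings in the following sense. Let $R\subset H^*(Z)\otimes H^*(S^1)$ be the subring generated by the classes $a\otimes 1$ with $a\in H^*(Z)$ and $a\otimes[S^1]$ with $a\in H^{i}(Z)$, $i>0$ (the classes with no $1\otimes[S^1]$ component). Then there is a ring isomorphism $H^*(X)\cong R/([Z]\otimes 1)$, where $([Z]\otimes 1)$ is the two-sided ideal of $R$ generated by $[Z]\otimes1$, and its composite with the map $R/([Z]\otimes 1)\to H^*(Z)\otimes H^*(S^1)/\{1\otimes[S^1],[Z]\otimes1\}$ induced by the inclusion of $R$ is the isomorphism above. (2) $X$ arises from $Z\times S^1$ by an $(m+n,1)$-type surgery: it is homeomorphic to $$(Z\times S^1-\operatorname{int}D^{m+n}\times S^1)\cup S^{m+n-1}\times D^2,$$ glued along $\partial D^{m+n}\times S^1\cong S^{m+n-1}\times S^1$ by the identity. -/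

import Mathlib

universe u

namespace SingularCohomology

open CategoryTheory Opposite

section Cochains

open Simplicial

variable (S : SSet.{u})

/-- Integral `k`-cochains of a simplicial set. -/
abbrev Cochain (k : ℕ) : Type u := S _⦋k⦌ → ℤ

/-- The coboundary `(δf)(σ) = ∑ᵢ (-1)ⁱ f(∂ᵢσ)`. -/
def coboundary (k : ℕ) : Cochain S k →+ Cochain S (k + 1) where
  toFun f σ := ∑ i : Fin (k + 2), (-1 : ℤ) ^ (i : ℕ) * f (S.δ i σ)
  map_zero' := by ext σ; simp
  map_add' f g := by ext σ; simp [mul_add, Finset.sum_add_distrib]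

/-- The face of an `n`-simplex spanned by the `l + 1` consecutive vertices `j, …, j + l`. -/
def consecutiveFace {n : ℕ} (j l : ℕ) (h : j + l ≤ n) (σ : S _⦋n⦌) : S _⦋l⦌ :=
  S.map (SimplexCategory.subinterval j l h).op σ

/-- The cup product of cochains (Alexander–Whitney formula):
`(f ⌣ g)(σ) = f(front i-face of σ) * g(back j-face of σ)` for an `n`-simplex `σ`, `n = i + j`. -/
def cup {i j n : ℕ} (h : i + j = n) (f : Cochain S i) (g : Cochain S j) : Cochain S n :=
  fun σ => f (consecutiveFace S 0 i (by omega) σ) * g (consecutiveFace S i j (by omega) σ)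

variable {S}

theorem coboundary_apply {k : ℕ} (f : Cochain S k) (σ : S _⦋k + 1⦌) :
    coboundary S k f σ = ∑ i : Fin (k + 2), (-1 : ℤ) ^ (i : ℕ) * f (S.δ i σ) := rfl

theorem coboundary_coboundary {k : ℕ} (f : Cochain S k) :
    coboundary S (k + 1) (coboundary S k f) = 0 := by
  ext σ
  simp only [coboundary_apply, Finset.mul_sum, Pi.zero_apply]
  rw [← Finset.sum_product']
  let P := Fin (k + 3) × Fin (k + 2)
  let T : Finset P := Finset.univ.filter fun ij => (ij.1 : ℕ) ≤ (ij.2 : ℕ)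
  rw [Finset.univ_product_univ, ← Finset.sum_compl_add_sum T, ← eq_neg_iff_add_eq_zero,
    ← Finset.sum_neg_distrib]
  symm
  let φ : ∀ ij : P, ij ∈ T → P := fun ij hij =>
    (ij.2.succ, Fin.castLT ij.1 (lt_of_le_of_lt (Finset.mem_filter.mp hij).right (Fin.is_lt ij.2)))
  apply Finset.sum_bij φ
  · intro ij hij
    simp_rw [T, φ, Finset.compl_filter, Finset.mem_filter_univ, Fin.val_succ,
      Fin.val_castLT] at hij ⊢
    lia
  · rintro ⟨i, j⟩ hij ⟨i', j'⟩ hij' h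
    have h1 := congrArg (fun x : Fin (k + 3) × Fin (k + 2) => (x.1 : ℕ)) h
    have h2 := congrArg (fun x : Fin (k + 3) × Fin (k + 2) => (x.2 : ℕ)) h
    simp only [φ, Fin.val_succ, Fin.val_castLT] at h1 h2
    exact Prod.ext (Fin.ext h2) (Fin.ext (Nat.succ.inj h1))
  · rintro ⟨i', j'⟩ hij'
    simp_rw [T, Finset.compl_filter, Finset.mem_filter_univ, not_le] at hij'
    refine ⟨(Fin.castSucc j', i'.pred ?_), ?_, ?_⟩
    · rintro rfl
      simp at hij'
    · simp only [T, Finset.mem_filter_univ, Fin.val_castSucc, Fin.val_pred]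
      lia
    · simp [φ]
  · rintro ⟨i, j⟩ hij
    simp only [T, Finset.mem_filter_univ] at hij
    have := SSet.δ_comp_δ''_apply (S := S) (i := i) (j := j) hij σ
    simp only [φ, Fin.val_succ, Fin.val_castLT]
    rw [← this]
    ring

/-- The `l`-th face map for a natural number `l`. -/
def natFace (n l : ℕ) : ⦋n⦌ ⟶ ⦋n + 1⦌ :=
  SimplexCategory.mkHom
    { toFun := fun x => ⟨if (x : ℕ) < l then x else x + 1, by split_ifs <;> omega⟩
      monotone' := fun x y hxy => by
        have : (x : ℕ) ≤ y := hxy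
        simp only [Fin.mk_le_mk]
        split_ifs <;> omega }

theorem natFace_eq {n : ℕ} (i : Fin (n + 2)) : natFace n i = SimplexCategory.δ i := by
  ext x
  change (if (x : ℕ) < i then (x : ℕ) else x + 1) = ((i.succAbove x : Fin (n + 2)) : ℕ)
  simp only [Fin.succAbove, Fin.lt_def, Fin.val_castSucc]
  split_ifs <;> rfl

theorem coboundary_eq {k : ℕ} (f : Cochain S k) (σ : S _⦋k + 1⦌) :
    coboundary S k f σ =
      ∑ l ∈ Finset.range (k + 2), (-1 : ℤ) ^ l * f (S.map (natFace k l).op σ) := by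
  rw [coboundary_apply, ← Fin.sum_univ_eq_sum_range
    (fun l => (-1 : ℤ) ^ l * f (S.map (natFace k l).op σ))]
  refine Finset.sum_congr rfl fun i _ => ?_
  rw [natFace_eq]
  rfl

theorem map_map {a b c : ℕ} (p : ⦋a⦌ ⟶ ⦋b⦌) (q : ⦋b⦌ ⟶ ⦋c⦌) (σ : S _⦋c⦌) :
    S.map p.op (S.map q.op σ) = S.map (p ≫ q).op σ := by
  simp

theorem coboundary_cup {i j n : ℕ} (h : i + j = n) (f : Cochain S i) (g : Cochain S j) :
    coboundary S n (cup S h f g) =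
      cup S (show (i + 1) + j = n + 1 by omega) (coboundary S i f) g +
        (-1 : ℤ) ^ i • cup S (show i + (j + 1) = n + 1 by omega) f (coboundary S j g) := by
  subst h
  ext σ
  simp only [Pi.add_apply, Pi.smul_apply, smul_eq_mul, cup, coboundary_eq, consecutiveFace,
    map_map]
  have e1 : i + j + 2 = (i + 1) + (j + 1) := by omega
  rw [e1, Finset.sum_range_add, Finset.sum_range_succ _ (i + 1), Finset.sum_range_succ' _ (j + 1)]
  rw [add_mul, Finset.sum_mul, mul_add, mul_add, Finset.mul_sum, Finset.mul_sum]
  have key {a b : ℕ} (p q : ⦋a⦌ ⟶ ⦋b⦌) (hpq : ∀ x, (p.toOrderHom x : ℕ) = q.toOrderHom x) :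
      p = q := by
    ext x; exact hpq x
  have A : ∑ x ∈ Finset.range (i + 1), (-1 : ℤ) ^ x *
        (f (S.map (SimplexCategory.subinterval 0 i (by omega) ≫ natFace (i + j) x).op σ) *
          g (S.map (SimplexCategory.subinterval i j (by omega) ≫ natFace (i + j) x).op σ)) =
      ∑ x ∈ Finset.range (i + 1), (-1 : ℤ) ^ x *
        f (S.map (natFace i x ≫ SimplexCategory.subinterval 0 (i + 1) (by omega)).op σ) *
          g (S.map (SimplexCategory.subinterval (i + 1) j (by omega)).op σ) := by
    refine Finset.sum_congr rfl fun x hx => ?_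
    rw [Finset.mem_range] at hx
    rw [mul_assoc]
    congr 3
    · congr 4
      apply key
      intro y
      change (if (y : ℕ) + i < x then (y : ℕ) + i else y + i + 1) = y + (i + 1)
      split_ifs <;> omega
  have B : ∑ x ∈ Finset.range (j + 1), (-1 : ℤ) ^ (i + 1 + x) *
        (f (S.map (SimplexCategory.subinterval 0 i (by omega) ≫ natFace (i + j) (i + 1 + x)).op σ) *
          g (S.map (SimplexCategory.subinterval i j (by omega) ≫
            natFace (i + j) (i + 1 + x)).op σ)) =
      ∑ x ∈ Finset.range (j + 1), (-1 : ℤ) ^ i *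
        (f (S.map (SimplexCategory.subinterval 0 i (by omega)).op σ) * ((-1 : ℤ) ^ (x + 1) *
          g (S.map (natFace j (x + 1) ≫
            SimplexCategory.subinterval i (j + 1) (by omega)).op σ))) := by
    refine Finset.sum_congr rfl fun x hx => ?_
    rw [Finset.mem_range] at hx
    have c1 : SimplexCategory.subinterval 0 i (by omega) ≫ natFace (i + j) (i + 1 + x) =
        SimplexCategory.subinterval 0 i (by omega) := by
      apply key
      intro y
      change (if (y : ℕ) + 0 < i + 1 + x then (y : ℕ) + 0 else y + 0 + 1) = y + 0
      have : (y : ℕ) < i + 1 := y.2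
      split_ifs <;> omega
    have c2 : SimplexCategory.subinterval i j (by omega) ≫ natFace (i + j) (i + 1 + x) =
        natFace j (x + 1) ≫ SimplexCategory.subinterval i (j + 1) (by omega) := by
      apply key
      intro y
      change (if (y : ℕ) + i < i + 1 + x then (y : ℕ) + i else y + i + 1) =
        (if (y : ℕ) < x + 1 then (y : ℕ) else y + 1) + i
      split_ifs <;> omega
    rw [c1, c2]
    ring
  have C1 : natFace i (i + 1) ≫ SimplexCategory.subinterval 0 (i + 1) (by omega) =
      SimplexCategory.subinterval (n := i + j + 1) 0 i (by omega) := by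
    apply key
    intro y
    change (if (y : ℕ) < i + 1 then (y : ℕ) else y + 1) + 0 = y + 0
    have : (y : ℕ) < i + 1 := y.2
    split_ifs; omega
  have C2 : natFace j 0 ≫ SimplexCategory.subinterval i (j + 1) (by omega) =
      SimplexCategory.subinterval (n := i + j + 1) (i + 1) j (by omega) := by
    apply key
    intro y
    change (if (y : ℕ) < 0 then (y : ℕ) else y + 1) + i = y + (i + 1)
    split_ifs <;> omega
  rw [A, B, C1, C2]
  ring

theorem cup_add {i j n : ℕ} (h : i + j = n) (f : Cochain S i) (g g' : Cochain S j) :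
    cup S h f (g + g') = cup S h f g + cup S h f g' := by
  ext σ; simp [cup, mul_add]

theorem add_cup {i j n : ℕ} (h : i + j = n) (f f' : Cochain S i) (g : Cochain S j) :
    cup S h (f + f') g = cup S h f g + cup S h f' g := by
  ext σ; simp [cup, add_mul]

theorem cup_zero {i j n : ℕ} (h : i + j = n) (f : Cochain S i) :
    cup S h f (0 : Cochain S j) = 0 := by
  ext σ; simp [cup]

theorem zero_cup {i j n : ℕ} (h : i + j = n) (g : Cochain S j) :
    cup S h (0 : Cochain S i) g = 0 := by
  ext σ; simp [cup]

theorem cup_assoc {i j k p q n : ℕ} (hp : i + j = p) (hq : j + k = q) (h : p + k = n)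
    (h' : i + q = n) (f : Cochain S i) (g : Cochain S j) (e : Cochain S k) :
    cup S h (cup S hp f g) e = cup S h' f (cup S hq g e) := by
  subst hp hq h
  ext σ
  simp only [cup, consecutiveFace, map_map, mul_assoc]
  congr 3
  congr 4
  ext y
  change (y : ℕ) + (i + j) = y + j + i
  omega

variable (S) in
/-- The unit cochain, with constant value `1`. -/
def unit : Cochain S 0 := fun _ => 1

theorem unit_cup {i n : ℕ} (h : 0 + i = n) (f : Cochain S i) (hn : i = n) :
    cup S h (unit S) f = hn ▸ f := by
  subst hn
  ext σ
  have : SimplexCategory.subinterval 0 i (by omega) = 𝟙 ⦋i⦌ := by ext y; rfl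
  simp [cup, unit, consecutiveFace, this]

theorem cup_unit {i n : ℕ} (h : i + 0 = n) (f : Cochain S i) (hn : i = n) :
    cup S h f (unit S) = hn ▸ f := by
  subst hn
  ext σ
  have : SimplexCategory.subinterval 0 i (by omega) = 𝟙 ⦋i⦌ := by ext y; rfl
  simp [cup, unit, consecutiveFace, this]

theorem coboundary_unit : coboundary S 0 (unit S) = 0 := by
  ext σ
  simp [coboundary_apply, unit, Fin.sum_univ_two]

end Cochains

section Cohomology

variable (S : SSet.{u})

/-- The group of `n`-cocycles. -/
def cocycles (n : ℕ) : AddSubgroup (Cochain S n) := (coboundary S n).ker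

/-- The group of `n`-coboundaries. -/
def coboundaries : (n : ℕ) → AddSubgroup (Cochain S n)
  | 0 => ⊥
  | n + 1 => (coboundary S n).range

/-- The `n`-th integral cohomology group of a simplicial set: cocycles modulo coboundaries. -/
def CohomologyGroup (n : ℕ) : Type u :=
  cocycles S n ⧸ (coboundaries S n).addSubgroupOf (cocycles S n)

noncomputable instance (n : ℕ) : AddCommGroup (CohomologyGroup S n) :=
  inferInstanceAs (AddCommGroup (cocycles S n ⧸ (coboundaries S n).addSubgroupOf (cocycles S n)))

/-- The cohomology class of a cocycle. -/
def cohomologyClass (n : ℕ) : cocycles S n →+ CohomologyGroup S n :=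
  QuotientAddGroup.mk' _

variable {S}

theorem cohomologyClass_surjective (n : ℕ) : Function.Surjective (cohomologyClass S n) :=
  QuotientAddGroup.mk'_surjective _

theorem cohomologyClass_eq_zero {n : ℕ} (f : cocycles S n) :
    cohomologyClass S n f = 0 ↔ (f : Cochain S n) ∈ coboundaries S n := by
  refine (QuotientAddGroup.eq_zero_iff f).trans ?_
  rw [AddSubgroup.mem_addSubgroupOf]

theorem cup_mem_cocycles {i j n : ℕ} (h : i + j = n) {f : Cochain S i} {g : Cochain S j}
    (hf : f ∈ cocycles S i) (hg : g ∈ cocycles S j) : cup S h f g ∈ cocycles S n := by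
  rw [cocycles, AddMonoidHom.mem_ker] at *
  rw [coboundary_cup, hf, hg, zero_cup, cup_zero, smul_zero, add_zero]

theorem cup_mem_coboundaries_left {i j n : ℕ} (h : i + j = n) {f : Cochain S i} {g : Cochain S j}
    (hf : f ∈ coboundaries S i) (hg : g ∈ cocycles S j) : cup S h f g ∈ coboundaries S n := by
  rw [cocycles, AddMonoidHom.mem_ker] at hg
  cases i with
  | zero =>
    obtain rfl : f = 0 := hf
    rw [zero_cup]
    exact zero_mem _
  | succ i =>
    obtain ⟨e, rfl⟩ := hf
    obtain ⟨n, rfl⟩ : ∃ k, n = k + 1 := ⟨i + j, by omega⟩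
    refine ⟨cup S (show i + j = n by omega) e g, ?_⟩
    rw [coboundary_cup, hg, cup_zero, smul_zero, add_zero]

theorem cup_mem_coboundaries_right {i j n : ℕ} (h : i + j = n) {f : Cochain S i} {g : Cochain S j}
    (hf : f ∈ cocycles S i) (hg : g ∈ coboundaries S j) : cup S h f g ∈ coboundaries S n := by
  rw [cocycles, AddMonoidHom.mem_ker] at hf
  cases j with
  | zero =>
    obtain rfl : g = 0 := hg
    rw [cup_zero]
    exact zero_mem _
  | succ j =>
    obtain ⟨e, rfl⟩ := hg
    obtain ⟨n, rfl⟩ : ∃ k, n = k + 1 := ⟨i + j, by omega⟩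
    refine ⟨(-1 : ℤ) ^ i • cup S (show i + j = n by omega) f e, ?_⟩
    rw [map_zsmul, coboundary_cup, hf, zero_cup, zero_add, smul_smul, ← mul_pow]
    simp

/-- The cup product of cocycles, as a biadditive map. -/
def cupCocycles {i j n : ℕ} (h : i + j = n) : cocycles S i →+ cocycles S j →+ cocycles S n :=
  AddMonoidHom.mk' (fun f => AddMonoidHom.mk'
      (fun g => ⟨cup S h f g, cup_mem_cocycles h f.2 g.2⟩)
      fun _ _ => Subtype.ext (cup_add h _ _ _))
    fun _ _ => AddMonoidHom.ext fun _ => Subtype.ext (add_cup h _ _ _)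

/-- The cup product of cohomology classes, induced by the cup product of cocycles. -/
noncomputable def cupProduct {i j n : ℕ} (h : i + j = n) :
    CohomologyGroup S i →+ CohomologyGroup S j →+ CohomologyGroup S n :=
  QuotientAddGroup.lift _
    (AddMonoidHom.mk' (fun f => QuotientAddGroup.lift _
        ((cohomologyClass S n).comp (cupCocycles h f))
        (fun g hg => (cohomologyClass_eq_zero _).2 (cup_mem_coboundaries_right h f.2 hg)))
      (fun f f' => by
        refine QuotientAddGroup.addMonoidHom_ext _ (AddMonoidHom.ext fun g => ?_)
        change cohomologyClass S n (cupCocycles h (f + f') g) =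
          cohomologyClass S n (cupCocycles h f g) + cohomologyClass S n (cupCocycles h f' g)
        rw [map_add, AddMonoidHom.add_apply, map_add]))
    (fun f hf => by
      refine QuotientAddGroup.addMonoidHom_ext _ (AddMonoidHom.ext fun g => ?_)
      exact (cohomologyClass_eq_zero _).2 (cup_mem_coboundaries_left h hf g.2))

theorem cupProduct_class {i j n : ℕ} (h : i + j = n) (f : cocycles S i) (g : cocycles S j) :
    cupProduct h (cohomologyClass S i f) (cohomologyClass S j g) =
      cohomologyClass S n (cupCocycles h f g) := rfl

variable (S) in
/-- The unit of the cohomology ring, the class of the unit cochain. -/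
noncomputable def cohomologyOne : CohomologyGroup S 0 := cohomologyClass S 0 ⟨unit S, coboundary_unit⟩

theorem cupProduct_assoc {i j k p q n : ℕ} (hp : i + j = p) (hq : j + k = q) (h : p + k = n)
    (h' : i + q = n) (a : CohomologyGroup S i) (b : CohomologyGroup S j)
    (c : CohomologyGroup S k) :
    cupProduct h (cupProduct hp a b) c = cupProduct h' a (cupProduct hq b c) := by
  obtain ⟨f, rfl⟩ := cohomologyClass_surjective _ a
  obtain ⟨g, rfl⟩ := cohomologyClass_surjective _ b
  obtain ⟨e, rfl⟩ := cohomologyClass_surjective _ c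
  simp only [cupProduct_class]
  congr 1
  exact Subtype.ext (cup_assoc hp hq h h' _ _ _)

theorem cohomologyOne_cupProduct {i : ℕ} (h : 0 + i = i) (a : CohomologyGroup S i) :
    cupProduct h (cohomologyOne S) a = a := by
  obtain ⟨f, rfl⟩ := cohomologyClass_surjective _ a
  rw [cohomologyOne, cupProduct_class]
  congr 1
  exact Subtype.ext (unit_cup h _ rfl)

theorem cupProduct_cohomologyOne {i : ℕ} (h : i + 0 = i) (a : CohomologyGroup S i) :
    cupProduct h a (cohomologyOne S) = a := by
  obtain ⟨f, rfl⟩ := cohomologyClass_surjective _ a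
  rw [cohomologyOne, cupProduct_class]
  congr 1
  exact Subtype.ext (cup_unit h _ rfl)

theorem cupProduct_target {i j n n' : ℕ} (h : i + j = n) (h' : i + j = n')
    (a : CohomologyGroup S i) (b : CohomologyGroup S j) :
    (⟨n, cupProduct h a b⟩ : GradedMonoid (CohomologyGroup S)) = ⟨n', cupProduct h' a b⟩ := by
  subst h h'
  rfl

noncomputable instance : GradedMonoid.GMul (CohomologyGroup S) where
  mul a b := cupProduct rfl a b

noncomputable instance : GradedMonoid.GOne (CohomologyGroup S) where
  one := cohomologyOne S

noncomputable instance : GradedMonoid.GMonoid (CohomologyGroup S) where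
  one_mul := by
    rintro ⟨i, a⟩
    refine (cupProduct_target rfl (zero_add i) (cohomologyOne S) a).trans ?_
    rw [cohomologyOne_cupProduct]
  mul_one := by
    rintro ⟨i, a⟩
    refine (cupProduct_target rfl (add_zero i) a (cohomologyOne S)).trans ?_
    rw [cupProduct_cohomologyOne]
  mul_assoc := by
    rintro ⟨i, a⟩ ⟨j, b⟩ ⟨k, c⟩
    refine Eq.trans ?_ (cupProduct_target (add_assoc i j k).symm rfl a (cupProduct rfl b c))
    rw [← cupProduct_assoc rfl rfl rfl]
    rfl

/-- The cup product makes the cohomology groups into a graded ring. -/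
noncomputable instance : DirectSum.GRing (CohomologyGroup S) where
  mul_zero a := map_zero _
  zero_mul b := by
    change cupProduct rfl 0 b = 0
    rw [map_zero, AddMonoidHom.zero_apply]
  mul_add a b c := map_add _ _ _
  add_mul a b c := by
    change cupProduct rfl (a + b) c = cupProduct rfl a c + cupProduct rfl b c
    rw [map_add, AddMonoidHom.add_apply]
  natCast m := m • cohomologyOne S
  natCast_zero := zero_nsmul _
  natCast_succ m := succ_nsmul _ _
  intCast m := m • cohomologyOne S
  intCast_ofNat m := natCast_zsmul _ _
  intCast_negSucc_ofNat m := negSucc_zsmul _ _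

end Cohomology

section Spaces

variable (X : Type u) [TopologicalSpace X]

/-- The `n`-th singular cohomology group `Hⁿ(X; ℤ)`. -/
abbrev H (n : ℕ) : Type u := CohomologyGroup (TopCat.toSSet.obj (TopCat.of X)) n

/-- The singular cohomology ring `H^*(X; ℤ) = ⨁ₙ Hⁿ(X; ℤ)` with the cup product. -/
abbrev CohomologyRing : Type u := DirectSum ℕ (H X)

/-- The subgroup of classes of degree `n` in `H^*(X; ℤ)`. -/
noncomputable def degreePart (n : ℕ) : Submodule ℤ (CohomologyRing X) :=
  AddSubgroup.toIntSubmodule (DirectSum.of (H X) n).range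

variable {X}

theorem of_mem_degreePart {n : ℕ} (a : H X n) : DirectSum.of (H X) n a ∈ degreePart X n :=
  ⟨a, rfl⟩

/-- The grading of the cohomology ring by degree. -/
noncomputable instance : GradedAlgebra (degreePart X) where
  one_mem := ⟨cohomologyOne _, rfl⟩
  mul_mem := by
    rintro i j _ _ ⟨a, rfl⟩ ⟨b, rfl⟩
    rw [DirectSum.of_mul_of]
    exact of_mem_degreePart _
  decompose' := DirectSum.toAddMonoid fun n =>
    (DirectSum.of (fun n => degreePart X n) n).comp
      (AddMonoidHom.mk' (fun a => ⟨DirectSum.of (H X) n a, of_mem_degreePart a⟩)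
        fun a b => Subtype.ext (map_add _ _ _))
  left_inv x := by
    induction x using DirectSum.induction_on with
    | zero => simp
    | of n a => simp
    | add x y hx hy => rw [map_add, map_add, hx, hy]
  right_inv x := by
    induction x using DirectSum.induction_on with
    | zero => simp
    | of n a =>
      obtain ⟨_, ⟨b, rfl⟩⟩ := a
      simp
    | add x y hx hy => rw [map_add, map_add, hx, hy]

end Spaces
end SingularCohomology

open SingularCohomology TensorProduct

/-- A class `c ∈ Hᵈ(X; ℤ)` is a fundamental class if `Hᵈ(X; ℤ)` is infinite cyclic with
generator `c`. For a closed connected orientable `d`-manifold these are exactly the two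
(cohomological) fundamental classes, one for each orientation. -/
def IsFundamentalClass {X : Type*} [TopologicalSpace X] {d : ℕ} (c : H X d) : Prop :=
  Function.Bijective fun k : ℤ => k • c

section Algebra

variable (Z : Type) [TopologicalSpace Z]

/-- The ring `H^*(Z) ⊗ H^*(S¹)`, with the multiplication
`(a ⊗ b)(x ⊗ y) = (-1)^(|b||x|) (a x) ⊗ (b y)`. -/
abbrev TensorRing : Type := (degreePart Z) ᵍ⊗[ℤ] (degreePart Circle)

/-- The homogeneous elements of total degree `k` in `H^*(Z) ⊗ H^*(S¹)`. -/
noncomputable def tensorDegreePart (k : ℕ) : AddSubgroup (TensorRing Z) :=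
  AddSubgroup.closure {t | ∃ i j : ℕ, i + j = k ∧ ∃ a ∈ degreePart Z i, ∃ b ∈ degreePart Circle j,
    t = a ᵍ⊗ₜ[ℤ] b}

variable {Z} {d : ℕ} (ζ : H Z d) (e : H Circle 1)

/-- The class `1 ⊗ [S¹]`. -/
noncomputable def oneTensorCircle : TensorRing Z := 1 ᵍ⊗ₜ[ℤ] (DirectSum.of (H Circle) 1 e)

/-- The class `[Z] ⊗ 1`. -/
noncomputable def classTensorOne : TensorRing Z := (DirectSum.of (H Z) d ζ) ᵍ⊗ₜ[ℤ] 1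

/-- The quotient group of `H^*(Z) ⊗ H^*(S¹)` by the subgroup spanned by the two classes
`1 ⊗ [S¹]` and `[Z] ⊗ 1`. -/
abbrev TensorModClasses : Type :=
  TensorRing Z ⧸ AddSubgroup.closure {oneTensorCircle e, classTensorOne ζ}

variable (Z) in
/-- The subring of `H^*(Z) ⊗ H^*(S¹)` generated by the classes `a ⊗ 1`, `a` arbitrary, and
`a ⊗ [S¹]`, `a` homogeneous of positive degree: all classes without a `1 ⊗ [S¹]` component. -/
noncomputable def omitSubring : Subring (TensorRing Z) :=
  Subring.closure ({t | ∃ a : CohomologyRing Z, t = a ᵍ⊗ₜ[ℤ] 1} ∪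
    {t | ∃ i : ℕ, 0 < i ∧ ∃ a ∈ degreePart Z i, t = a ᵍ⊗ₜ[ℤ] (DirectSum.of (H Circle) 1 e)})

/-- The class `[Z] ⊗ 1` as an element of the subring without `1 ⊗ [S¹]`. -/
noncomputable def classInSubring : omitSubring Z e :=
  ⟨classTensorOne ζ, Subring.subset_closure (Or.inl ⟨_, rfl⟩)⟩

/-- The ideal generated by `[Z] ⊗ 1` in the subring without `1 ⊗ [S¹]`. -/
noncomputable def classIdeal : Ideal (omitSubring Z e) :=
  (TwoSidedIdeal.span {classInSubring ζ e}).asIdeal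

instance : (classIdeal ζ e).IsTwoSided :=
  inferInstanceAs (TwoSidedIdeal.span {classInSubring ζ e}).asIdeal.IsTwoSided

/-- `H^*(Z) ⊗ H^*(S¹)` modulo `1 ⊗ [S¹]` and `[Z] ⊗ 1`, as a ring: the class `1 ⊗ [S¹]` is
omitted, and then the ideal generated by `[Z] ⊗ 1` is divided out. -/
abbrev ReducedTensorRing : Type := omitSubring Z e ⧸ classIdeal ζ e

end Algebra

section Polytopes

variable {n : ℕ}

/-- `F` is a facet of the full-dimensional polytope `P ⊆ ℝⁿ`: a nonempty face of dimension
`n - 1`. -/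
def IsFacet (P F : Set (EuclideanSpace ℝ (Fin n))) : Prop :=
  IsExposed ℝ P F ∧ F.Nonempty ∧ Module.finrank ℝ (vectorSpan ℝ F) + 1 = n

/-- `P ⊆ ℝⁿ` is a simple polytope of dimension `n`: the convex hull of finitely many points, with
nonempty interior, such that every vertex lies on exactly `n` facets. -/
structure IsSimplePolytope (P : Set (EuclideanSpace ℝ (Fin n))) : Prop where
  exists_finite : ∃ V : Set (EuclideanSpace ℝ (Fin n)), V.Finite ∧ P = convexHull ℝ V
  interior_nonempty : (interior P).Nonempty
  simple : ∀ v ∈ P.extremePoints ℝ, {F | IsFacet P F ∧ v ∈ F}.ncard = n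

/-- The type of facets of `P`. -/
abbrev Facet (P : Set (EuclideanSpace ℝ (Fin n))) : Type := {F // IsFacet P F}

/-- The simplicial complex `K_P` dual to the boundary of `P`: its vertices are the facets of `P`,
and a set of facets is a simplex (possibly empty) iff the facets have a common point in `P`. -/
def dualComplex (P : Set (EuclideanSpace ℝ (Fin n))) : Set (Set (Facet P)) :=
  {σ | ∃ x ∈ P, ∀ F ∈ σ, x ∈ F.1}

/-- The moment-angle manifold `Z(P) = ⋃_{σ ∈ K_P} {z : |z_F| = 1 for F ∉ σ}` inside the product of one unit
disc `D² ⊆ ℂ` for each facet of `P`. -/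
def momentAngle (P : Set (EuclideanSpace ℝ (Fin n))) : Set (Facet P → ℂ) :=
  ⋃ σ ∈ dualComplex P, {z | (∀ F, ‖z F‖ ≤ 1) ∧ ∀ F ∉ σ, ‖z F‖ = 1}

end Polytopes

section Surgery

open Metric

variable {d : ℕ}

/-- `∂[(Z - int Dᵈ) × D²]`, where `Dᵈ` is the image of the closed unit ball under an open
embedding `φ : ℝᵈ → Z` into a closed `d`-manifold. The manifold `(Z - int Dᵈ) × D²` is a closed
domain in the boundaryless manifold `Z × ℂ`, and its boundary is its topological frontier. -/
def thickeningBoundary {Z : Type} [TopologicalSpace Z] (φ : EuclideanSpace ℝ (Fin d) → Z) :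
    Set (Z × ℂ) :=
  frontier ((φ '' ball 0 1)ᶜ ×ˢ closedBall (0 : ℂ) 1)

variable {M : Type} (ψ : EuclideanSpace ℝ (Fin d) × Circle → M)

/-- The gluing relation for surgery along `ψ : Dᵈ × S¹ → M`: the point `ψ (x, w)` of
`M - ψ(int Dᵈ × S¹)` is glued to `(x, w) ∈ S^{d-1} × D²`, for `x ∈ S^{d-1}` and `w ∈ S¹ = ∂D²`. -/
inductive SurgeryRel :
    {p : M // p ∉ ψ '' (ball 0 1 ×ˢ Set.univ)} ⊕
      (sphere (0 : EuclideanSpace ℝ (Fin d)) 1 × closedBall (0 : ℂ) 1) →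
    {p : M // p ∉ ψ '' (ball 0 1 ×ˢ Set.univ)} ⊕
      (sphere (0 : EuclideanSpace ℝ (Fin d)) 1 × closedBall (0 : ℂ) 1) → Prop
  | glue (x : sphere (0 : EuclideanSpace ℝ (Fin d)) 1) (w : Circle) (w' : closedBall (0 : ℂ) 1)
      (hw : (w' : ℂ) = w) (h : ψ (x, w) ∉ ψ '' (ball 0 1 ×ˢ Set.univ)) :
      SurgeryRel (Sum.inl ⟨ψ (x, w), h⟩) (Sum.inr (x, w'))

/-- The result `(M - ψ(int Dᵈ × S¹)) ∪ S^{d-1} × D²` of the `(d, 1)`-type surgery on `M` along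
`ψ : Dᵈ × S¹ → M`. -/
def Surgery : Type := Quot (SurgeryRel ψ)

instance [TopologicalSpace M] : TopologicalSpace (Surgery ψ) :=
  inferInstanceAs (TopologicalSpace (Quot (SurgeryRel ψ)))

end Surgery

/-!
Write `X` for the boundary of the thickening and `d = m + n`, and let `B` be the image of an open
ball in the chart, slightly larger than the disc. The open set `V = (Z × ℂˣ) ∪ (B × ℂ)` of `Z × ℂ`
(`tracePlus`) contains `X`. If `c` denotes the center of the disc, then `V - {c} × ℂ` (`traceOff`)
retracts by a radial deformation onto `X`, which is a level set of an explicit height function.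

The cohomology of `V` is a subring of `H^*(Z × ℂˣ) = H^*(Z) ⊗ H^*(S¹)`, namely the subring of the
classes without `1 ⊗ e` component. Indeed `V` is the union of `Z × ℂˣ` and the contractible set
`B × ℂ`, whose intersection has the cohomology of a circle, so restriction to `Z × ℂˣ` is injective
(`pull_tracePlus_injective`); a class `b × e` extends when `b` has positive degree, since `b`
vanishes on the disc (`exists_res_tracePlus_eq`), and `1 × e` does not extend, since the circle
bounds in `{c} × ℂ` (`eq_zero_of_res_tracePlus`). Removing the fibre `{c} × ℂ` kills exactly the
multiples of the top class: the Mayer–Vietoris sequence of `V` as a union of `V - {c} × ℂ` and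
`B × ℂ` compares with that of `Z` as a union of `Z - c` and `B`, in which the connecting
homomorphism maps a generator of `H^{d-1}(B - c)` to a generator of `H^d(Z)`
(`isReduction_tracePlus`). That the subring modulo the multiples of `ζ ⊗ 1` is also the quotient
of `H^*(Z) ⊗ H^*(S¹)` by the two classes is algebra (`IsReduction.exists_ringEquiv`).

This rests on one property of `Z`: the restriction `H^d(Z) → H^d(Z - c)` is zero
(`IsSimplePolytope.pull_complIncl_eq_zero`), which replaces orientability and duality. If `c` has
all coordinates of norm one, then `H^d(Z - c)` itself vanishes (`pull_complIncl_torus_eq_zero`).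
The reason is that the polyhedral products in question are retracts of complements of coordinate
subspace arrangements, whose cohomology vanishes above the expected dimension by induction
(`arrangement_eq_zero`). A point in the domain of a Euclidean chart can be moved to a point of the
torus: the points of `Z` with nonzero coordinates form an open set homeomorphic to `ℝⁿ × T^m`, by
polar coordinates and the fact that the normal fan of a simple polytope is complete and simplicial
(`IsSimpleNormals.polarHomeomorph`), and in such a chart the position of the point does not matter
(`pull_complIncl_eq_zero`).

The tools of singular cohomology that are needed, homotopy invariance, the Mayer–Vietoris sequence
and the Künneth theorem for a product with a circle, are derived from simplicial homotopies and from
the theorem of small simplices (`exists_coboundary_eq_of_small`).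

The surgery description holds because the frontier of `(Z - int D) × D²` is the union of
`(Z - int D) × S¹` and `∂D × D²` (`nonempty_homeomorph_surgery`). For `n = 0` the manifold is a
point, and `X` and both quotient rings are trivial (`exists_isReduction_of_subsingleton`).
-/

namespace SingularCohomology

open CategoryTheory Opposite Simplicial

/-! ### Functoriality of the cohomology of simplicial sets -/

section Functoriality

variable {S T R : SSet.{u}}

/-- The map on cochains induced by a simplicial map. -/
def cochainMap (φ : S ⟶ T) (k : ℕ) : Cochain T k →+ Cochain S k where
  toFun f σ := f (φ.app (op ⦋k⦌) σ)
  map_zero' := rfl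
  map_add' _ _ := rfl

theorem cochainMap_apply (φ : S ⟶ T) (k : ℕ) (f : Cochain T k) (σ : S _⦋k⦌) :
    cochainMap φ k f σ = f (φ.app (op ⦋k⦌) σ) := rfl

theorem app_map (φ : S ⟶ T) {a b : ℕ} (p : ⦋a⦌ ⟶ ⦋b⦌) (σ : S _⦋b⦌) :
    φ.app (op ⦋a⦌) (S.map p.op σ) = T.map p.op (φ.app (op ⦋b⦌) σ) :=
  ConcreteCategory.congr_hom (φ.naturality p.op) σ

theorem coboundary_cochainMap (φ : S ⟶ T) (k : ℕ) (f : Cochain T k) :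
    coboundary S k (cochainMap φ k f) = cochainMap φ (k + 1) (coboundary T k f) := by
  ext σ
  rw [cochainMap_apply, coboundary_eq, coboundary_eq]
  refine Finset.sum_congr rfl fun i _ => ?_
  rw [cochainMap_apply, app_map]

theorem cochainMap_cup (φ : S ⟶ T) {i j n : ℕ} (h : i + j = n) (f : Cochain T i)
    (g : Cochain T j) :
    cochainMap φ n (cup T h f g) = cup S h (cochainMap φ i f) (cochainMap φ j g) := by
  ext σ
  simp only [cochainMap_apply, cup, consecutiveFace, app_map]

theorem cochainMap_mem_cocycles (φ : S ⟶ T) {k : ℕ} {f : Cochain T k} (hf : f ∈ cocycles T k) :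
    cochainMap φ k f ∈ cocycles S k := by
  rw [cocycles, AddMonoidHom.mem_ker] at *
  rw [coboundary_cochainMap, hf, map_zero]

theorem cochainMap_mem_coboundaries (φ : S ⟶ T) {k : ℕ} {f : Cochain T k}
    (hf : f ∈ coboundaries T k) : cochainMap φ k f ∈ coboundaries S k := by
  cases k with
  | zero =>
    obtain rfl : f = 0 := hf
    rw [map_zero]
    exact zero_mem _
  | succ k =>
    obtain ⟨g, rfl⟩ := hf
    exact ⟨cochainMap φ k g, coboundary_cochainMap _ _ _⟩

/-- The map on cocycles induced by a simplicial map. -/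
def cocycleMap (φ : S ⟶ T) (k : ℕ) : cocycles T k →+ cocycles S k :=
  AddMonoidHom.mk' (fun f => ⟨cochainMap φ k f, cochainMap_mem_cocycles φ f.2⟩)
    fun _ _ => Subtype.ext (map_add _ _ _)

/-- The map on cohomology induced by a simplicial map. -/
noncomputable def cohomologyMap (φ : S ⟶ T) (k : ℕ) : CohomologyGroup T k →+ CohomologyGroup S k :=
  QuotientAddGroup.lift _ ((cohomologyClass S k).comp (cocycleMap φ k))
    (fun _ hf => (cohomologyClass_eq_zero _).2 (cochainMap_mem_coboundaries φ hf))

theorem cohomologyMap_class (φ : S ⟶ T) (k : ℕ) (f : cocycles T k) :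
    cohomologyMap φ k (cohomologyClass T k f) = cohomologyClass S k (cocycleMap φ k f) := rfl

theorem cohomologyMap_id (k : ℕ) (a : CohomologyGroup S k) : cohomologyMap (𝟙 S) k a = a := by
  obtain ⟨f, rfl⟩ := cohomologyClass_surjective _ a
  rw [cohomologyMap_class]
  rfl

theorem cohomologyMap_comp (φ : S ⟶ T) (ψ : T ⟶ R) (k : ℕ) (a : CohomologyGroup R k) :
    cohomologyMap (φ ≫ ψ) k a = cohomologyMap φ k (cohomologyMap ψ k a) := by
  obtain ⟨f, rfl⟩ := cohomologyClass_surjective _ a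
  simp only [cohomologyMap_class]
  rfl

theorem cohomologyMap_cupProduct (φ : S ⟶ T) {i j n : ℕ} (h : i + j = n)
    (a : CohomologyGroup T i) (b : CohomologyGroup T j) :
    cohomologyMap φ n (cupProduct h a b) =
      cupProduct h (cohomologyMap φ i a) (cohomologyMap φ j b) := by
  obtain ⟨f, rfl⟩ := cohomologyClass_surjective _ a
  obtain ⟨g, rfl⟩ := cohomologyClass_surjective _ b
  simp only [cohomologyMap_class, cupProduct_class]
  congr 1
  exact Subtype.ext (cochainMap_cup φ h _ _)

theorem cohomologyClass_eq_iff_sub_mem {k : ℕ} (f g : cocycles S k) :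
    cohomologyClass S k f = cohomologyClass S k g ↔ (f - g : Cochain S k) ∈ coboundaries S k := by
  rw [← sub_eq_zero, ← map_sub, cohomologyClass_eq_zero]
  rfl

end Functoriality

/-! ### Simplicial homotopy invariance -/

section Homotopy

variable {S T : SSet.{u}}

/-- The simplicial free abelian group on a simplicial set. -/
noncomputable abbrev freeChains (S : SSet.{u}) : SimplicialObject AddCommGrpCat.{u} :=
  ((SimplicialObject.whiskering _ _).obj AddCommGrpCat.free).obj S

/-- The boundary operator of the complex of integral chains of a simplicial set. -/
noncomputable def freeBoundary (S : SSet.{u}) (k : ℕ) :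
    FreeAbelianGroup (S _⦋k + 1⦌) →+ FreeAbelianGroup (S _⦋k⦌) :=
  (((AlgebraicTopology.alternatingFaceMapComplex _).obj (freeChains S)).d (k + 1) k).hom

/-- Taking the underlying homomorphism is additive. -/
def homAdd {A B : AddCommGrpCat.{u}} : (A ⟶ B) →+ (A →+ B) where
  toFun f := f.hom
  map_zero' := rfl
  map_add' _ _ := rfl

theorem freeBoundary_of (k : ℕ) (σ : S _⦋k + 1⦌) :
    freeBoundary S k (FreeAbelianGroup.of σ) =
    ∑ i : Fin (k + 2), (-1 : ℤ) ^ (i : ℕ) • FreeAbelianGroup.of (S.δ i σ) := by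
  have : freeBoundary S k = ∑ i : Fin (k + 2), (-1 : ℤ) ^ (i : ℕ) • homAdd ((freeChains S).δ i) := by
    simp only [← map_zsmul, ← map_sum]
    rw [freeBoundary, AlgebraicTopology.alternatingFaceMapComplex_obj_d]
    rfl
  refine (DFunLike.congr_fun this _).trans ((AddMonoidHom.finsetSum_apply _ _ _).trans ?_)
  rfl

/-- Simplicially homotopic maps agree on cohomology: on a cocycle, the two cochain maps differ by a
coboundary, since a chain homotopy dualizes. -/
theorem cochainMap_sub_mem_coboundaries {φ ψ : S ⟶ T} (H : SimplicialObject.Homotopy φ ψ) {k : ℕ}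
    {f : Cochain T k} (hf : f ∈ cocycles T k) :
    cochainMap φ k f - cochainMap ψ k f ∈ coboundaries S k := by
  let h := (H.whiskerRight AddCommGrpCat.free).toChainHomotopy
  let L : FreeAbelianGroup (T _⦋k⦌) →+ ℤ := FreeAbelianGroup.lift f
  have hL (x : FreeAbelianGroup (T _⦋k + 1⦌)) : L (freeBoundary T k x) = 0 := by
    induction x using FreeAbelianGroup.induction_on with
    | zero => rw [map_zero, map_zero]
    | of τ =>
      rw [freeBoundary_of]
      have := congrFun (show coboundary T k f = 0 from hf) τ
      rw [coboundary_apply] at this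
      simpa [L] using this
    | neg τ hτ => rw [map_neg, map_neg, hτ, neg_zero]
    | add x y hx hy => rw [map_add, map_add, hx, hy, add_zero]
  have hLf (σ : S _⦋k⦌) : cochainMap φ k f σ = L ((((AlgebraicTopology.alternatingFaceMapComplex _).map
      (((SimplicialObject.whiskering _ _).obj AddCommGrpCat.free).map φ)).f k).hom
      (FreeAbelianGroup.of σ)) := (FreeAbelianGroup.lift_apply_of f _).symm
  have hLg (σ : S _⦋k⦌) : cochainMap ψ k f σ = L ((((AlgebraicTopology.alternatingFaceMapComplex _).map
      (((SimplicialObject.whiskering _ _).obj AddCommGrpCat.free).map ψ)).f k).hom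
      (FreeAbelianGroup.of σ)) := (FreeAbelianGroup.lift_apply_of f _).symm
  cases k with
  | zero =>
    change cochainMap φ 0 f - cochainMap ψ 0 f = 0
    ext σ
    have := hL ((h.hom 0 1).hom (FreeAbelianGroup.of σ))
    rw [Pi.sub_apply, hLf, hLg, h.comm 0]
    rw [prevD_eq (j' := 1) (w := by simp), dNext_eq_zero _ _ (by simp), zero_add]
    refine sub_eq_zero.2 ((map_add L _ _).trans ?_)
    exact (congrArg (· + _) this).trans (zero_add _)
  | succ k =>
    refine ⟨fun τ => L ((h.hom k (k + 1)).hom (FreeAbelianGroup.of τ)), ?_⟩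
    ext σ
    rw [Pi.sub_apply, hLf, hLg, h.comm (k + 1)]
    rw [dNext_eq (i' := k) (w := by simp), prevD_eq (j' := k + 2) (w := by simp)]
    have := hL ((h.hom (k + 1) (k + 2)).hom (FreeAbelianGroup.of σ))
    refine Eq.symm ((congrArg (· - _) ((map_add L _ _).trans (congrArg (· + _)
      ((map_add L _ _).trans (congrArg (_ + ·) this))))).trans ?_)
    refine (add_sub_cancel_right _ _).trans ((add_zero _).trans ?_)
    refine (congrArg (fun x => L ((h.hom k (k + 1)).hom x)) (freeBoundary_of k σ)).trans ?_
    rw [coboundary_apply]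
    refine (map_sum (L.comp (h.hom k (k + 1)).hom) _ _).trans (Finset.sum_congr rfl fun i _ => ?_)
    exact (map_zsmul (L.comp (h.hom k (k + 1)).hom) _ _).trans (smul_eq_mul _ _)

theorem cohomologyMap_eq_of_homotopy {φ ψ : S ⟶ T} (H : SimplicialObject.Homotopy φ ψ) (k : ℕ) :
    cohomologyMap φ k = cohomologyMap ψ k := by
  ext a
  obtain ⟨f, rfl⟩ := cohomologyClass_surjective _ a
  rw [cohomologyMap_class, cohomologyMap_class, cohomologyClass_eq_iff_sub_mem]
  exact cochainMap_sub_mem_coboundaries H f.2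

end Homotopy

/-! ### Functoriality and homotopy invariance of singular cohomology -/

section Spaces

variable {X Y W : Type} [TopologicalSpace X] [TopologicalSpace Y] [TopologicalSpace W]

/-- The map of singular simplicial sets induced by a continuous map. -/
noncomputable abbrev singMap (f : C(X, Y)) :
    TopCat.toSSet.obj (TopCat.of X) ⟶ TopCat.toSSet.obj (TopCat.of Y) :=
  TopCat.toSSet.map (TopCat.ofHom f)

/-- The map `f^* : Hᵏ(Y) → Hᵏ(X)` induced by a continuous map `f : X → Y`. -/
noncomputable def pull (f : C(X, Y)) (k : ℕ) : H Y k →+ H X k := cohomologyMap (singMap f) k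

theorem singMap_comp (g : C(Y, W)) (f : C(X, Y)) : singMap (g.comp f) = singMap f ≫ singMap g := by
  rw [singMap, TopCat.ofHom_comp, Functor.map_comp]

@[simp]
theorem pull_id (k : ℕ) (a : H X k) : pull (ContinuousMap.id X) k a = a := by
  have : singMap (ContinuousMap.id X) = 𝟙 _ := by
    rw [singMap, TopCat.ofHom_id, CategoryTheory.Functor.map_id]
  rw [pull, this, cohomologyMap_id]

theorem pull_comp (g : C(Y, W)) (f : C(X, Y)) (k : ℕ) (a : H W k) :
    pull (g.comp f) k a = pull f k (pull g k a) := by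
  rw [pull, singMap_comp, cohomologyMap_comp]
  rfl

theorem pull_cupProduct (f : C(X, Y)) {i j n : ℕ} (h : i + j = n) (a : H Y i) (b : H Y j) :
    pull f n (cupProduct h a b) = cupProduct h (pull f i a) (pull f j b) :=
  cohomologyMap_cupProduct _ _ _ _

@[simp]
theorem pull_one (f : C(X, Y)) : pull f 0 (cohomologyOne _) = cohomologyOne _ := rfl

/-- Homotopic maps induce the same map on cohomology. -/
theorem pull_eq_of_homotopic {f g : C(X, Y)} (h : f.Homotopic g) (k : ℕ) : pull f k = pull g k := by
  obtain ⟨F⟩ := h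
  let F' : TopCat.Homotopy (TopCat.ofHom f) (TopCat.ofHom g) := F
  exact cohomologyMap_eq_of_homotopy F'.toSSet.toSimplicialObjectHomotopy k

theorem pull_bijective_of_homotopyInverse {f : C(X, Y)} {g : C(Y, X)}
    (h₁ : (g.comp f).Homotopic (ContinuousMap.id X)) (h₂ : (f.comp g).Homotopic (ContinuousMap.id Y))
    (k : ℕ) : Function.Bijective (pull f k) := by
  refine Function.bijective_iff_has_inverse.2 ⟨pull g k, fun a => ?_, fun a => ?_⟩
  · rw [← pull_comp, pull_eq_of_homotopic h₂, pull_id]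
  · rw [← pull_comp, pull_eq_of_homotopic h₁, pull_id]

theorem pull_homeomorph_bijective (f : X ≃ₜ Y) (k : ℕ) :
    Function.Bijective (pull (f : C(X, Y)) k) :=
  pull_bijective_of_homotopyInverse (g := (f.symm : C(Y, X)))
    (by rw [show (f.symm : C(Y, X)).comp (f : C(X, Y)) = ContinuousMap.id X by ext; simp])
    (by rw [show (f : C(X, Y)).comp (f.symm : C(Y, X)) = ContinuousMap.id Y by ext; simp]) k

/-- The ring homomorphism `f^* : H^*(Y) → H^*(X)`. -/
noncomputable def pullRing (f : C(X, Y)) : CohomologyRing Y →+* CohomologyRing X :=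
  DirectSum.toSemiring (fun k => (DirectSum.of (H X) k).comp (pull f k)) rfl (by
    intro i j a b
    simp only [AddMonoidHom.comp_apply]
    rw [DirectSum.of_mul_of]
    congr 1
    exact pull_cupProduct f rfl a b)

@[simp]
theorem pullRing_of (f : C(X, Y)) (k : ℕ) (a : H Y k) :
    pullRing f (DirectSum.of (H Y) k a) = DirectSum.of (H X) k (pull f k a) :=
  DirectSum.toSemiring_of _ _ _ _ _

theorem pullRing_apply (f : C(X, Y)) (a : CohomologyRing Y) (k : ℕ) :
    pullRing f a k = pull f k (a k) := by
  induction a using DirectSum.induction_on with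
  | zero => simp
  | of i a =>
    rw [pullRing_of]
    by_cases h : i = k
    · subst h
      rw [DirectSum.of_eq_same, DirectSum.of_eq_same]
    · rw [DirectSum.of_eq_of_ne _ _ _ (Ne.symm h), DirectSum.of_eq_of_ne _ _ _ (Ne.symm h), map_zero]
  | add x y hx hy => rw [map_add, DirectSum.add_apply, hx, hy, DirectSum.add_apply, map_add]

theorem pullRing_comp (g : C(Y, W)) (f : C(X, Y)) (a : CohomologyRing W) :
    pullRing (g.comp f) a = pullRing f (pullRing g a) := by
  refine DFinsupp.ext fun k => ?_
  rw [pullRing_apply, pullRing_apply, pullRing_apply, pull_comp]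

end Spaces

end SingularCohomology

namespace SingularCohomology

/-! ### Affine chains and barycentric subdivision -/

section AffineChains

/-- The standard topological simplex of dimension `n`. -/
abbrev Simplex (n : ℕ) : Type := stdSimplex ℝ (Fin (n + 1))

/-- The affine map between standard simplices with prescribed images of the vertices. -/
def affMap {k n : ℕ} (v : Fin (k + 1) → Simplex n) : C(Simplex k, Simplex n) where
  toFun x := ⟨fun j => ∑ i, x i * v i j, fun j => Finset.sum_nonneg fun i _ =>
    mul_nonneg (stdSimplex.zero_le x i) (stdSimplex.zero_le (v i) j), by
      rw [Finset.sum_comm]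
      simp [← Finset.mul_sum]⟩
  continuous_toFun := by
    refine Continuous.subtype_mk (continuous_pi fun j => continuous_finsetSum _ fun i _ => ?_) _
    exact ((continuous_apply i).comp continuous_subtype_val).mul continuous_const

theorem affMap_apply {k n : ℕ} (v : Fin (k + 1) → Simplex n) (x : Simplex k) (j : Fin (n + 1)) :
    affMap v x j = ∑ i, x i * v i j := rfl

@[simp]
theorem affMap_vertex {k n : ℕ} (v : Fin (k + 1) → Simplex n) (i : Fin (k + 1)) :
    affMap v (stdSimplex.vertex i) = v i := by
  ext j
  rw [affMap_apply]
  simp [Pi.single_apply]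

theorem affMap_affMap {k m n : ℕ} (v : Fin (m + 1) → Simplex n) (w : Fin (k + 1) → Simplex m)
    (x : Simplex k) : affMap v (affMap w x) = affMap (fun i => affMap v (w i)) x := by
  ext j
  simp only [affMap_apply, Finset.sum_mul, Finset.mul_sum]
  rw [Finset.sum_comm]
  simp only [mul_assoc]

theorem affMap_vertices {n : ℕ} :
    affMap (stdSimplex.vertex : Fin (n + 1) → Simplex n) = ContinuousMap.id _ := by
  ext x j
  change affMap _ x j = x j
  rw [affMap_apply]
  simp [Pi.single_apply]

/-- Integral chains of affine `k`-simplices in the standard `n`-simplex, an affine simplex being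
given by the list of its vertices. -/
abbrev AffChain (n k : ℕ) : Type := (Fin (k + 1) → Simplex n) →₀ ℤ

/-- The chain consisting of one affine simplex. -/
noncomputable abbrev affSingle {n k : ℕ} (v : Fin (k + 1) → Simplex n) : AffChain n k :=
  Finsupp.single v 1

/-- The chain consisting of the standard simplex itself. -/
noncomputable abbrev fundChain (n : ℕ) : AffChain n n := affSingle stdSimplex.vertex

/-- Push forward of affine chains along the affine map with vertices `v`. -/
noncomputable def affPush {m n : ℕ} (v : Fin (m + 1) → Simplex n) (k : ℕ) :
    AffChain m k →ₗ[ℤ] AffChain n k :=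
  Finsupp.lmapDomain ℤ ℤ fun w i => affMap v (w i)

/-- The boundary of affine chains. -/
noncomputable def affBd (n k : ℕ) : AffChain n (k + 1) →ₗ[ℤ] AffChain n k :=
  Finsupp.linearCombination ℤ fun v => ∑ i : Fin (k + 2), (-1 : ℤ) ^ (i : ℕ) •
    affSingle (v ∘ i.succAbove)

/-- The cone with apex `b` on an affine chain. -/
noncomputable def affCone {n : ℕ} (b : Simplex n) (k : ℕ) :
    AffChain n k →ₗ[ℤ] AffChain n (k + 1) :=
  Finsupp.lmapDomain ℤ ℤ fun v => Fin.cons b v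

/-- The natural operator on affine chains whose value on the standard `k`-simplex is `s`. -/
noncomputable def affNat {k l : ℕ} (s : AffChain k l) (n : ℕ) : AffChain n k →ₗ[ℤ] AffChain n l :=
  Finsupp.linearCombination ℤ fun v => affPush v l s

variable {n k l m : ℕ}

@[simp]
theorem affPush_single (v : Fin (m + 1) → Simplex n) (w : Fin (k + 1) → Simplex m) :
    affPush v k (affSingle w) = affSingle fun i => affMap v (w i) := by
  simp [affPush, Finsupp.mapDomain_single]

theorem affBd_single (v : Fin (k + 2) → Simplex n) :
    affBd n k (affSingle v) = ∑ i : Fin (k + 2), (-1 : ℤ) ^ (i : ℕ) •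
      affSingle (v ∘ i.succAbove) := by
  rw [affBd, Finsupp.linearCombination_single, one_smul]

@[simp]
theorem affCone_single (b : Simplex n) (v : Fin (k + 1) → Simplex n) :
    affCone b k (affSingle v) = affSingle (Fin.cons b v) := by
  simp [affCone, Finsupp.mapDomain_single]

@[simp]
theorem affNat_single (s : AffChain k l) (v : Fin (k + 1) → Simplex n) :
    affNat s n (affSingle v) = affPush v l s := by
  rw [affNat, Finsupp.linearCombination_single, one_smul]

/-- Linear maps on affine chains are determined by their values on affine simplices. -/
theorem affChain_hom_ext {M : Type*} [AddCommGroup M] [Module ℤ M] {f g : AffChain n k →ₗ[ℤ] M}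
    (h : ∀ v, f (affSingle v) = g (affSingle v)) : f = g :=
  Finsupp.lhom_ext' fun v => LinearMap.ext_ring (h v)

theorem affPush_affPush (v : Fin (m + 1) → Simplex n) (w : Fin (l + 1) → Simplex m)
    (c : AffChain l k) : affPush v k (affPush w k c) = affPush (fun i => affMap v (w i)) k c := by
  rw [← LinearMap.comp_apply]
  congr 1
  exact affChain_hom_ext fun u => by simp [affMap_affMap]

theorem affBd_affPush (v : Fin (m + 1) → Simplex n) (c : AffChain m (k + 1)) :
    affBd n k (affPush v (k + 1) c) = affPush v k (affBd m k c) := by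
  rw [← LinearMap.comp_apply, ← LinearMap.comp_apply]
  congr 1
  refine affChain_hom_ext fun u => ?_
  simp only [LinearMap.comp_apply, affPush_single, affBd_single, map_sum, map_zsmul]
  rfl

theorem affPush_affNat (s : AffChain k l) (v : Fin (m + 1) → Simplex n) (c : AffChain m k) :
    affPush v l (affNat s m c) = affNat s n (affPush v k c) := by
  rw [← LinearMap.comp_apply, ← LinearMap.comp_apply]
  congr 1
  refine affChain_hom_ext fun u => ?_
  simp only [LinearMap.comp_apply, affPush_single, affNat_single, affPush_affPush]

theorem affBd_affCone (b : Simplex n) (c : AffChain n (k + 1)) :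
    affBd n (k + 1) (affCone b (k + 1) c) = c - affCone b k (affBd n k c) := by
  have : affBd n (k + 1) ∘ₗ affCone b (k + 1) = LinearMap.id - affCone b k ∘ₗ affBd n k := by
    refine affChain_hom_ext fun u => ?_
    simp only [LinearMap.comp_apply, LinearMap.sub_apply, LinearMap.id_apply, affCone_single,
      affBd_single, map_sum, map_zsmul]
    rw [Fin.sum_univ_succ, sub_eq_add_neg, ← Finset.sum_neg_distrib]
    congr 1
    · simp only [Fin.val_zero, pow_zero, one_smul]
      congr 1
    · refine Finset.sum_congr rfl fun i _ => ?_
      rw [Fin.val_succ, pow_succ, mul_neg_one, neg_smul]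
      congr 3
      ext j : 1
      refine Fin.cases ?_ (fun j => ?_) j
      · simp
      · simp
  exact DFunLike.congr_fun this c

/-- The augmentation of affine `0`-chains. -/
noncomputable def affAug (n : ℕ) : AffChain n 0 →ₗ[ℤ] ℤ := Finsupp.linearCombination ℤ fun _ => 1

@[simp]
theorem affAug_single (v : Fin 1 → Simplex n) : affAug n (affSingle v) = 1 := by
  rw [affAug, Finsupp.linearCombination_single, one_smul]

theorem affAug_affBd (c : AffChain n 1) : affAug n (affBd n 0 c) = 0 := by
  have : affAug n ∘ₗ affBd n 0 = 0 := affChain_hom_ext fun u => by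
    rw [LinearMap.comp_apply, affBd_single, map_sum]
    simp only [map_zsmul, affAug_single]
    simp [Fin.sum_univ_two]
  exact DFunLike.congr_fun this c

theorem affBd_affCone_zero (b : Simplex n) (c : AffChain n 0) :
    affBd n 0 (affCone b 0 c) = c - affAug n c • affSingle fun _ => b := by
  have : affBd n 0 ∘ₗ affCone b 0 =
      LinearMap.id - (affAug n).smulRight (affSingle fun _ => b) := by
    refine affChain_hom_ext fun u => ?_
    simp only [LinearMap.comp_apply, LinearMap.sub_apply, LinearMap.id_apply, affCone_single,
      affBd_single, LinearMap.smulRight_apply, affAug_single, one_smul]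
    rw [Fin.sum_univ_two]
    simp only [Fin.val_zero, pow_zero, one_smul, Fin.val_one, pow_one, neg_smul, ← sub_eq_add_neg]
    congr 2
    ext j : 1
    fin_cases j
    rfl
  exact DFunLike.congr_fun this c

theorem affBd_affBd (c : AffChain n (k + 2)) : affBd n k (affBd n (k + 1) c) = 0 := by
  have : affBd n k ∘ₗ affBd n (k + 1) = 0 := by
    clear c
    refine affChain_hom_ext fun u => ?_
    have hu : affSingle u = affCone (u 0) (k + 1) (affSingle (Fin.tail u)) := by
      rw [affCone_single, Fin.cons_self_tail]
    -- every affine simplex is a cone on its last face, which gives an induction on the dimension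
    induction k with
    | zero =>
      rw [LinearMap.comp_apply, hu, affBd_affCone, map_sub, affBd_affCone_zero, affAug_affBd]
      simp
    | succ k ih =>
      rw [LinearMap.comp_apply, hu, affBd_affCone, map_sub, affBd_affCone]
      have := ih (Fin.tail u) (by rw [affCone_single]; exact congrArg _ (Fin.cons_self_tail _).symm)
      rw [LinearMap.comp_apply] at this
      rw [this]
      simp
  exact DFunLike.congr_fun this c

/-- The barycentric subdivision of the standard simplex: the cone from the barycenter on the
subdivision of the boundary. -/
noncomputable def subdiv : (n : ℕ) → AffChain n n
  | 0 => fundChain 0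
  | n + 1 => affCone stdSimplex.barycenter n (affNat (subdiv n) (n + 1) (affBd (n + 1) n
      (fundChain (n + 1))))

/-- The chain homotopy between the identity and barycentric subdivision, evaluated on the standard
simplex; it is again defined by coning from the barycenter. -/
noncomputable def subdivHomotopy : (n : ℕ) → AffChain n (n + 1)
  | 0 => 0
  | n + 1 => affCone stdSimplex.barycenter (n + 1) (fundChain (n + 1) - subdiv (n + 1) -
      affNat (subdivHomotopy n) (n + 1) (affBd (n + 1) n (fundChain (n + 1))))

theorem affSingle_eq_affPush (v : Fin (k + 1) → Simplex n) :
    affSingle v = affPush v k (fundChain k) := by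
  simp

theorem affNat_fundChain_left (c : AffChain n k) : affNat (fundChain k) n c = c := by
  have : affNat (fundChain k) n = LinearMap.id := affChain_hom_ext fun v => by simp
  rw [this, LinearMap.id_apply]

theorem affNat_sub (s t : AffChain k l) (c : AffChain n k) :
    affNat (s - t) n c = affNat s n c - affNat t n c := by
  have : affNat (s - t) n = affNat s n - affNat t n := affChain_hom_ext fun v => by
    simp only [affNat_single, map_sub, LinearMap.sub_apply]
  rw [this, LinearMap.sub_apply]

theorem affBd_affNat (s : AffChain k (l + 1)) (c : AffChain n k) :
    affBd n l (affNat s n c) = affNat (affBd k l s) n c := by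
  have : affBd n l ∘ₗ affNat s n = affNat (affBd k l s) n := affChain_hom_ext fun v => by
    rw [LinearMap.comp_apply, affNat_single, affBd_affPush, affNat_single]
  exact DFunLike.congr_fun this c

theorem affNat_affBd (s : AffChain k l) (c : AffChain n (k + 1)) :
    affNat s n (affBd n k c) =
      affNat (affNat s (k + 1) (affBd (k + 1) k (fundChain (k + 1)))) n c := by
  have : affNat s n ∘ₗ affBd n k =
      affNat (affNat s (k + 1) (affBd (k + 1) k (fundChain (k + 1)))) n :=
    affChain_hom_ext fun v => by
      rw [LinearMap.comp_apply, affNat_single, affPush_affNat, ← affBd_affPush,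
        ← affSingle_eq_affPush]
  exact DFunLike.congr_fun this c

theorem affBd_subdiv (k : ℕ) : affBd (k + 1) k (subdiv (k + 1)) =
    affNat (subdiv k) (k + 1) (affBd (k + 1) k (fundChain (k + 1))) := by
  induction k with
  | zero =>
    change affBd 1 0 (affCone _ 0 (affNat (fundChain 0) 1 (affBd 1 0 (fundChain 1)))) =
      affNat (fundChain 0) 1 (affBd 1 0 (fundChain 1))
    rw [affBd_affCone_zero, affNat_fundChain_left, affAug_affBd, zero_smul, sub_zero]
  | succ k ih =>
    rw [subdiv, affBd_affCone, affBd_affNat, ih, ← affNat_affBd, affBd_affBd, map_zero, map_zero,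
      sub_zero]

/-- Subdivision is a chain map. -/
theorem affBd_affNat_subdiv (c : AffChain n (k + 1)) :
    affBd n k (affNat (subdiv (k + 1)) n c) = affNat (subdiv k) n (affBd n k c) := by
  rw [affBd_affNat, affBd_subdiv, ← affNat_affBd]

theorem affBd_subdivHomotopy (k : ℕ) : affBd (k + 1) (k + 1) (subdivHomotopy (k + 1)) =
    fundChain (k + 1) - subdiv (k + 1) -
      affNat (subdivHomotopy k) (k + 1) (affBd (k + 1) k (fundChain (k + 1))) := by
  have key : affBd (k + 1) k (fundChain (k + 1) - subdiv (k + 1) -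
      affNat (subdivHomotopy k) (k + 1) (affBd (k + 1) k (fundChain (k + 1)))) = 0 := by
    rw [map_sub, map_sub, affBd_affNat, affBd_subdiv, sub_eq_zero]
    cases k with
    | zero =>
      simp only [subdivHomotopy, subdiv, map_zero]
      rw [affNat_fundChain_left, sub_self]
      have : affNat (0 : AffChain 0 0) 1 = 0 := affChain_hom_ext fun v => by
        rw [affNat_single, map_zero, LinearMap.zero_apply]
      rw [this, LinearMap.zero_apply]
    | succ k =>
      rw [affBd_subdivHomotopy k, affNat_sub, affNat_sub, affNat_fundChain_left, ← affNat_affBd,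
        affBd_affBd, map_zero, sub_zero]
  rw [subdivHomotopy, affBd_affCone, key, map_zero, sub_zero]

/-- `subdivHomotopy` is a chain homotopy between the identity and subdivision. -/
theorem affBd_affNat_subdivHomotopy (c : AffChain n (k + 1)) :
    affBd n (k + 1) (affNat (subdivHomotopy (k + 1)) n c) =
      c - affNat (subdiv (k + 1)) n c - affNat (subdivHomotopy k) n (affBd n k c) := by
  rw [affBd_affNat, affBd_subdivHomotopy, affNat_sub, affNat_sub, affNat_fundChain_left,
    ← affNat_affBd]

end AffineChains

end SingularCohomology

namespace SingularCohomology

/-! ### The mesh of iterated subdivisions -/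

section Mesh

variable {n k l m : ℕ}

theorem affPush_mem_supported {P : Set (Fin (k + 1) → Simplex m)} {Q : Set (Fin (k + 1) → Simplex n)}
    (v : Fin (m + 1) → Simplex n) (h : ∀ w ∈ P, (fun i => affMap v (w i)) ∈ Q) {c : AffChain m k}
    (hc : c ∈ Finsupp.supported ℤ ℤ P) : affPush v k c ∈ Finsupp.supported ℤ ℤ Q := by
  classical
  rw [Finsupp.mem_supported] at *
  intro x hx
  obtain ⟨w, hw, rfl⟩ := Finset.mem_image.1 (Finsupp.mapDomain_support hx)
  exact h w (hc hw)

theorem affCone_mem_supported {P : Set (Fin (k + 1) → Simplex n)} {Q : Set (Fin (k + 2) → Simplex n)}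
    (b : Simplex n) (h : ∀ w ∈ P, (Fin.cons b w : Fin (k + 2) → Simplex n) ∈ Q) {c : AffChain n k}
    (hc : c ∈ Finsupp.supported ℤ ℤ P) : affCone b k c ∈ Finsupp.supported ℤ ℤ Q := by
  classical
  rw [Finsupp.mem_supported] at *
  intro x hx
  obtain ⟨w, hw, rfl⟩ := Finset.mem_image.1 (Finsupp.mapDomain_support hx)
  exact h w (hc hw)

theorem affNat_mem_supported {P : Set (Fin (k + 1) → Simplex n)} {Q : Set (Fin (l + 1) → Simplex n)}
    (s : AffChain k l) (h : ∀ w ∈ P, affPush w l s ∈ Finsupp.supported ℤ ℤ Q) {c : AffChain n k}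
    (hc : c ∈ Finsupp.supported ℤ ℤ P) : affNat s n c ∈ Finsupp.supported ℤ ℤ Q := by
  rw [Finsupp.mem_supported] at hc
  rw [affNat, Finsupp.linearCombination_apply]
  exact Submodule.sum_mem _ fun w hw => Submodule.smul_mem _ _ (h w (hc hw))

theorem affBd_fundChain_mem_supported (k : ℕ) : affBd (k + 1) k (fundChain (k + 1)) ∈
    Finsupp.supported ℤ ℤ (Set.range fun i : Fin (k + 2) =>
      (stdSimplex.vertex ∘ i.succAbove : Fin (k + 1) → Simplex (k + 1))) := by
  rw [affBd_single]
  exact Submodule.sum_mem _ fun i _ => Submodule.smul_mem _ _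
    (Finsupp.single_mem_supported ℤ _ ⟨i, rfl⟩)

theorem abs_sum_sub_le_of_barycenter (N : ℕ) (a : Fin (N + 1) → ℝ) (D : ℝ)
    (h : ∀ i j, |a i - a j| ≤ D) (x : Simplex N) :
    |∑ i, (N + 1 : ℝ)⁻¹ * a i - ∑ i, x i * a i| ≤ N / (N + 1) * D := by
  have hN : (0 : ℝ) < N + 1 := by positivity
  have vertexBound (j : Fin (N + 1)) : |∑ i, (N + 1 : ℝ)⁻¹ * a i - a j| ≤ N / (N + 1) * D := by
    have e : ∑ i, (N + 1 : ℝ)⁻¹ * a i - a j = (N + 1 : ℝ)⁻¹ * ∑ i, (a i - a j) := by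
      rw [Finset.sum_sub_distrib, ← Finset.mul_sum]
      simp only [Finset.sum_const, Finset.card_univ, Fintype.card_fin, nsmul_eq_mul]
      push_cast
      field_simp
    have h2 : |∑ i, (a i - a j)| ≤ N * D := by
      rw [← Finset.add_sum_erase _ _ (Finset.mem_univ j), sub_self, zero_add]
      refine (Finset.abs_sum_le_sum_abs _ _).trans ((Finset.sum_le_sum fun i _ => h i j).trans ?_)
      simp [Finset.card_erase_of_mem]
    rw [e, abs_mul, abs_of_pos (inv_pos.2 hN), div_mul_eq_mul_div, inv_mul_eq_div]
    gcongr
  have e : ∑ i, (N + 1 : ℝ)⁻¹ * a i - ∑ i, x i * a i =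
      ∑ j, x j * (∑ i, (N + 1 : ℝ)⁻¹ * a i - a j) := by
    simp only [mul_sub, Finset.sum_sub_distrib, ← Finset.sum_mul, stdSimplex.sum_eq_one, one_mul]
  rw [e]
  refine (Finset.abs_sum_le_sum_abs _ _).trans ?_
  calc ∑ j, |x j * (∑ i, (N + 1 : ℝ)⁻¹ * a i - a j)| ≤ ∑ j, x j * (N / (N + 1) * D) := by
        refine Finset.sum_le_sum fun j _ => ?_
        rw [abs_mul, abs_of_nonneg (stdSimplex.zero_le x j)]
        exact mul_le_mul_of_nonneg_left (vertexBound j) (stdSimplex.zero_le x j)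
    _ = _ := by rw [← Finset.sum_mul, stdSimplex.sum_eq_one, one_mul]

theorem dist_simplex_le_iff {x y : Simplex n} {r : ℝ} (hr : 0 ≤ r) :
    dist x y ≤ r ↔ ∀ t, |x t - y t| ≤ r := by
  rw [Subtype.dist_eq, dist_pi_le_iff hr]
  rfl

/-- A simplex of diameter `D` lies in the ball of radius `N / (N + 1) * D` around its barycenter. -/
theorem dist_affMap_barycenter_le {N : ℕ} (v : Fin (N + 1) → Simplex n) {D : ℝ} (hD : 0 ≤ D)
    (h : ∀ i j, dist (v i) (v j) ≤ D) (x : Simplex N) :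
    dist (affMap v stdSimplex.barycenter) (affMap v x) ≤ N / (N + 1) * D := by
  rw [dist_simplex_le_iff (by positivity)]
  intro t
  have := abs_sum_sub_le_of_barycenter N (fun i => v i t) D
    (fun i j => (dist_simplex_le_iff hD).1 (h i j) t) x
  have hb : ∀ i : Fin (N + 1), (stdSimplex.barycenter : Simplex N) i = (N + 1 : ℝ)⁻¹ := by
    intro i
    refine (stdSimplex.barycenter_apply i).trans ?_
    rw [Fintype.card_fin]
    push_cast
    rfl
  simpa only [affMap_apply, hb] using this

/-- Barycentric subdivision of an affine `k`-simplex of diameter `D` consists of simplices of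
diameter at most `k / (k + 1) * D`. -/
theorem subdiv_mem_supported (k : ℕ) : subdiv k ∈ Finsupp.supported ℤ ℤ
    {w | ∀ (n : ℕ) (v : Fin (k + 1) → Simplex n) (D : ℝ), 0 ≤ D → (∀ i j, dist (v i) (v j) ≤ D) →
      ∀ i j, dist (affMap v (w i)) (affMap v (w j)) ≤ k / (k + 1) * D} := by
  induction k with
  | zero =>
    refine Finsupp.single_mem_supported ℤ _ ?_
    intro n v D _ h i j
    obtain rfl : i = j := Subsingleton.elim (α := Fin 1) i j
    rw [dist_self]
    simp
  | succ k ih =>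
    refine affCone_mem_supported _ ?_ (affNat_mem_supported _ (Q := {u | ∀ (n : ℕ)
      (v : Fin (k + 1 + 1) → Simplex n) (D : ℝ), 0 ≤ D → (∀ i j, dist (v i) (v j) ≤ D) →
      ∀ i j, dist (affMap v (u i)) (affMap v (u j)) ≤ k / (k + 1) * D}) ?_
      (affBd_fundChain_mem_supported k))
    · intro w hw n v D hD h i j
      have bound := dist_affMap_barycenter_le v hD h
      have mono : (k : ℝ) / (k + 1) * D ≤ ((k + 1 : ℕ) : ℝ) / ((k + 1 : ℕ) + 1) * D := by
        refine mul_le_mul_of_nonneg_right ?_ hD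
        rw [div_le_div_iff₀ (by positivity) (by positivity)]
        push_cast
        nlinarith
      refine Fin.cases ?_ (fun i => ?_) i <;> refine Fin.cases ?_ (fun j => ?_) j
      · rw [dist_self]
        positivity
      · exact bound _
      · rw [dist_comm]
        exact bound _
      · exact (hw n v D hD h i j).trans mono
    · rintro _ ⟨i, rfl⟩
      refine affPush_mem_supported _ ?_ ih
      intro w hw n v D hD h a b
      simp only [affMap_affMap]
      exact hw n _ D hD (fun _ _ => by simpa using h _ _) a b

/-- Iterated barycentric subdivision of the standard simplex has arbitrarily small mesh. -/
theorem iterate_subdiv_mem_supported (n N : ℕ) :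
    (affNat (subdiv n) n)^[N] (fundChain n) ∈ Finsupp.supported ℤ ℤ
      {v | ∀ i j, dist (v i) (v j) ≤ ((n : ℝ) / (n + 1)) ^ N} := by
  induction N with
  | zero =>
    refine Finsupp.single_mem_supported ℤ _ fun i j => ?_
    rw [pow_zero]
    exact (Metric.dist_le_diam_of_mem (bounded_stdSimplex _) (stdSimplex.vertex i).2
      (stdSimplex.vertex j).2).trans diam_stdSimplex_le
  | succ N ih =>
    rw [Function.iterate_succ_apply']
    refine affNat_mem_supported _ (fun v hv => ?_) ih
    refine affPush_mem_supported _ (fun w hw i j => ?_) (subdiv_mem_supported n)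
    rw [pow_succ']
    exact hw n v _ (by positivity) hv i j

end Mesh

/-! ### The theorem of small simplices -/

section SmallSimplices

open CategoryTheory Opposite Simplicial

variable {X Y : Type} [TopologicalSpace X] [TopologicalSpace Y]

/-- Singular simplices as continuous maps from the standard simplex. -/
noncomputable def simplexEquiv (X : Type) [TopologicalSpace X] (n : ℕ) :
    (TopCat.toSSet.obj (TopCat.of X)) _⦋n⦌ ≃ C(Simplex n, X) :=
  TopCat.toSSetObjEquiv _ _

theorem simplexEquiv_face {n : ℕ} (i : Fin (n + 2))
    (σ : (TopCat.toSSet.obj (TopCat.of X)) _⦋n + 1⦌) :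
    simplexEquiv X n ((TopCat.toSSet.obj (TopCat.of X)).δ i σ) =
      (simplexEquiv X (n + 1) σ).comp (affMap (stdSimplex.vertex ∘ i.succAbove)) := by
  have : ∀ x : Simplex n, stdSimplex.map (i.succAbove) x =
      affMap (stdSimplex.vertex ∘ i.succAbove) x := by
    intro x
    ext j
    rw [affMap_apply, stdSimplex.map_coe, FunOnFinite.linearMap_apply_apply]
    simp [Pi.single_apply, Finset.sum_filter, eq_comm]
  ext x
  rw [ContinuousMap.comp_apply, ← this]
  rfl

theorem simplexEquiv_singMap (f : C(X, Y)) {n : ℕ}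
    (σ : (TopCat.toSSet.obj (TopCat.of X)) _⦋n⦌) :
    simplexEquiv Y n ((singMap f).app (op ⦋n⦌) σ) = f.comp (simplexEquiv X n σ) := rfl

/-- Evaluation of a cochain on the image of an affine chain under a singular simplex. -/
noncomputable def evalAff {n : ℕ} (σ : C(Simplex n, X)) {k : ℕ}
    (f : Cochain (TopCat.toSSet.obj (TopCat.of X)) k) : AffChain n k →ₗ[ℤ] ℤ :=
  Finsupp.linearCombination ℤ fun v => f ((simplexEquiv X k).symm (σ.comp (affMap v)))

theorem evalAff_single {n : ℕ} (σ : C(Simplex n, X)) {k : ℕ}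
    (f : Cochain (TopCat.toSSet.obj (TopCat.of X)) k) (v : Fin (k + 1) → Simplex n) :
    evalAff σ f (affSingle v) = f ((simplexEquiv X k).symm (σ.comp (affMap v))) := by
  rw [evalAff, Finsupp.linearCombination_single, one_smul]

theorem evalAff_fundChain {n : ℕ} (f : Cochain (TopCat.toSSet.obj (TopCat.of X)) n)
    (σ : (TopCat.toSSet.obj (TopCat.of X)) _⦋n⦌) :
    evalAff (simplexEquiv X n σ) f (fundChain n) = f σ := by
  rw [evalAff_single, affMap_vertices, ContinuousMap.comp_id, Equiv.symm_apply_apply]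

theorem evalAff_affPush {n m : ℕ} (σ : C(Simplex n, X)) (v : Fin (m + 1) → Simplex n) {k : ℕ}
    (f : Cochain (TopCat.toSSet.obj (TopCat.of X)) k) (c : AffChain m k) :
    evalAff σ f (affPush v k c) = evalAff (σ.comp (affMap v)) f c := by
  rw [← LinearMap.comp_apply]
  congr 1
  refine affChain_hom_ext fun w => ?_
  rw [LinearMap.comp_apply, affPush_single, evalAff_single, evalAff_single]
  congr 2
  ext x
  simp [affMap_affMap]

theorem evalAff_affBd {n : ℕ} (σ : C(Simplex n, X)) {k : ℕ}
    (f : Cochain (TopCat.toSSet.obj (TopCat.of X)) k) (c : AffChain n (k + 1)) :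
    evalAff σ f (affBd n k c) = evalAff σ (coboundary _ k f) c := by
  rw [← LinearMap.comp_apply]
  congr 1
  refine affChain_hom_ext fun v => ?_
  rw [LinearMap.comp_apply, affBd_single, evalAff_single, coboundary_apply, map_sum]
  refine Finset.sum_congr rfl fun i _ => ?_
  rw [map_zsmul, evalAff_single, smul_eq_mul]
  congr 2
  rw [Equiv.symm_apply_eq, simplexEquiv_face, Equiv.apply_symm_apply]
  ext x
  simp only [ContinuousMap.comp_apply, affMap_affMap, Function.comp_apply, affMap_vertex]
  rfl

theorem evalAff_eq_zero {n : ℕ} (σ : C(Simplex n, X)) {k : ℕ}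
    (f : Cochain (TopCat.toSSet.obj (TopCat.of X)) k) {P : Set (Fin (k + 1) → Simplex n)}
    (h : ∀ v ∈ P, f ((simplexEquiv X k).symm (σ.comp (affMap v))) = 0) {c : AffChain n k}
    (hc : c ∈ Finsupp.supported ℤ ℤ P) : evalAff σ f c = 0 := by
  rw [Finsupp.mem_supported] at hc
  rw [evalAff, Finsupp.linearCombination_apply]
  exact Finset.sum_eq_zero fun v hv => by simp only [h v (hc hv), smul_zero]

/-- A singular simplex is small with respect to `U` and `V` if its image is contained in one of
these two sets. -/
def IsSmall (U V : Set X) {n : ℕ} (σ : C(Simplex n, X)) : Prop :=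
  (∀ x, σ x ∈ U) ∨ ∀ x, σ x ∈ V

theorem IsSmall.comp {U V : Set X} {n k : ℕ} {σ : C(Simplex n, X)} (h : IsSmall U V σ)
    (g : C(Simplex k, Simplex n)) : IsSmall U V (σ.comp g) :=
  h.imp (fun h x => h (g x)) fun h x => h (g x)

theorem exists_forall_iterate_small {U V : Set X} (hU : IsOpen U) (hV : IsOpen V)
    (hUV : U ∪ V = Set.univ) {n : ℕ} (σ : C(Simplex n, X)) :
    ∃ N₀, ∀ N ≥ N₀, (affNat (subdiv n) n)^[N] (fundChain n) ∈ Finsupp.supported ℤ ℤ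
      {v | IsSmall U V (σ.comp (affMap v))} := by
  obtain ⟨δ, hδ, hL⟩ := lebesgue_number_lemma_of_metric (s := (Set.univ : Set (Simplex n)))
    (c := fun b : Bool => σ ⁻¹' (if b then U else V)) isCompact_univ
    (fun b => by
      cases b
      · exact hV.preimage σ.continuous
      · exact hU.preimage σ.continuous)
    (fun x _ => by
      have : σ x ∈ U ∪ V := hUV ▸ Set.mem_univ _
      rcases this with h | h
      · exact Set.mem_iUnion.2 ⟨true, h⟩
      · exact Set.mem_iUnion.2 ⟨false, h⟩)
  have hr : (n : ℝ) / (n + 1) < 1 := by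
    rw [div_lt_one (by positivity)]
    linarith
  obtain ⟨N₀, hN₀⟩ := exists_pow_lt_of_lt_one hδ hr
  refine ⟨N₀, fun N hN => Finsupp.supported_mono ?_ (iterate_subdiv_mem_supported n N)⟩
  intro v hv
  have hmesh : ∀ i j, dist (v i) (v j) < δ := fun i j => (hv i j).trans_lt
    ((pow_le_pow_of_le_one (by positivity) hr.le hN).trans_lt hN₀)
  obtain ⟨b, hb⟩ := hL (v 0) (Set.mem_univ _)
  -- the affine simplex stays in the ball around its first vertex
  have hball : ∀ x, affMap v x ∈ Metric.ball (v 0) δ := by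
    intro x
    have hconv : Convex ℝ (Metric.ball (v 0 : Fin (n + 1) → ℝ) δ) := convex_ball _ _
    have : (affMap v x : Fin (n + 1) → ℝ) = ∑ i, x i • (v i : Fin (n + 1) → ℝ) := by
      ext j
      rw [Finset.sum_apply]
      rfl
    have hmem : (affMap v x : Fin (n + 1) → ℝ) ∈ Metric.ball (v 0 : Fin (n + 1) → ℝ) δ := by
      rw [this]
      exact hconv.sum_mem (fun i _ => stdSimplex.zero_le x i) (stdSimplex.sum_eq_one x)
        fun i _ => hmesh i 0
    exact hmem
  cases b
  · exact Or.inr fun x => hb (hball x)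
  · exact Or.inl fun x => hb (hball x)

/-- **Theorem of small simplices**, in cochain form: a cocycle vanishing on the simplices which are
small with respect to an open cover is the coboundary of a cochain with the same property. The
primitive is the sum of `f` over the homotopies of all iterated subdivisions; this sum is finite
on each simplex, since the iterated subdivisions of that simplex eventually become small. -/
theorem exists_coboundary_eq_of_small {U V : Set X} (hU : IsOpen U) (hV : IsOpen V)
    (hUV : U ∪ V = Set.univ) {n : ℕ} (f : Cochain (TopCat.toSSet.obj (TopCat.of X)) (n + 1))
    (hf : coboundary _ (n + 1) f = 0)
    (hsmall : ∀ σ, IsSmall U V (simplexEquiv X _ σ) → f σ = 0) :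
    ∃ g, coboundary _ n g = f ∧ ∀ σ, IsSmall U V (simplexEquiv X _ σ) → g σ = 0 := by
  have small_zero : ∀ {m : ℕ} (σ : C(Simplex m, X)) (c : AffChain m n),
      c ∈ Finsupp.supported ℤ ℤ {v | IsSmall U V (σ.comp (affMap v))} →
      evalAff σ f (affNat (subdivHomotopy n) m c) = 0 := by
    intro m σ c hc
    refine evalAff_eq_zero σ f (P := {v | IsSmall U V (σ.comp (affMap v))})
      (fun v hv => hsmall _ (by rw [Equiv.apply_symm_apply]; exact hv))
      (affNat_mem_supported _ (fun w hw => ?_) hc)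
    refine affPush_mem_supported (P := Set.univ) _ (fun u _ => ?_) (by simp)
    have : affMap (fun i => affMap w (u i)) = (affMap w).comp (affMap u) := by
      ext x
      simp [affMap_affMap]
    change IsSmall U V (σ.comp (affMap fun i => affMap w (u i)))
    rw [this, ← ContinuousMap.comp_assoc]
    exact IsSmall.comp hw _
  -- `N₀ m σ` subdivisions suffice to make the singular simplex `σ` small
  choose N₀ hN₀ using fun (m : ℕ) (σ : C(Simplex m, X)) => exists_forall_iterate_small hU hV hUV σ
  let term (σ : C(Simplex n, X)) (N : ℕ) : ℤ :=
    evalAff σ f (affNat (subdivHomotopy n) n ((affNat (subdiv n) n)^[N] (fundChain n)))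
  let g : Cochain (TopCat.toSSet.obj (TopCat.of X)) n := fun σ =>
    ∑ N ∈ Finset.range (N₀ n (simplexEquiv X n σ)), term (simplexEquiv X n σ) N
  have g_eq (σ : C(Simplex n, X)) (M : ℕ) (hM : N₀ n σ ≤ M) :
      g ((simplexEquiv X n).symm σ) = ∑ N ∈ Finset.range M, term σ N := by
    change ∑ N ∈ Finset.range (N₀ n (simplexEquiv X n _)), term (simplexEquiv X n _) N = _
    rw [Equiv.apply_symm_apply]
    refine Finset.sum_subset (Finset.range_mono hM) fun N _ hN => ?_
    exact small_zero σ _ (hN₀ n σ N (by simpa using hN))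
  refine ⟨g, ?_, fun σ hσ => Finset.sum_eq_zero fun N _ => small_zero _ _ ?_⟩
  · ext σ'
    obtain ⟨σ, rfl⟩ := (simplexEquiv X (n + 1)).symm.surjective σ'
    let face (i : Fin (n + 2)) : Fin (n + 1) → Simplex (n + 1) := stdSimplex.vertex ∘ i.succAbove
    let M := N₀ (n + 1) σ + ∑ i, N₀ n (σ.comp (affMap (face i)))
    have hM (i : Fin (n + 2)) : N₀ n (σ.comp (affMap (face i))) ≤ M :=
      (Finset.single_le_sum (f := fun i => N₀ n (σ.comp (affMap (face i))))
        (fun _ _ => Nat.zero_le _) (Finset.mem_univ i)).trans (Nat.le_add_left _ _)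
    have natural (N : ℕ) (v : Fin (n + 1) → Simplex (n + 1)) (c : AffChain n n) :
        affPush v n ((affNat (subdiv n) n)^[N] c) =
          (affNat (subdiv n) (n + 1))^[N] (affPush v n c) := by
      induction N with
      | zero => rfl
      | succ N ih => rw [Function.iterate_succ_apply', Function.iterate_succ_apply',
          affPush_affNat, ih]
    have chainMap (N : ℕ) (c : AffChain (n + 1) (n + 1)) :
        affBd (n + 1) n ((affNat (subdiv (n + 1)) (n + 1))^[N] c) =
          (affNat (subdiv n) (n + 1))^[N] (affBd (n + 1) n c) := by
      induction N with
      | zero => rfl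
      | succ N ih => rw [Function.iterate_succ_apply', Function.iterate_succ_apply',
          affBd_affNat_subdiv, ih]
    let c (N : ℕ) := (affNat (subdiv (n + 1)) (n + 1))^[N] (fundChain (n + 1))
    -- the chain homotopy formula makes the sum over `N` telescope
    have step (N : ℕ) : ∑ i : Fin (n + 2), (-1 : ℤ) ^ (i : ℕ) * term (σ.comp (affMap (face i))) N =
        evalAff σ f (c N) - evalAff σ f (c (N + 1)) := by
      have e : ∑ i : Fin (n + 2), (-1 : ℤ) ^ (i : ℕ) * term (σ.comp (affMap (face i))) N =
          evalAff σ f (affNat (subdivHomotopy n) (n + 1) (affBd (n + 1) n (c N))) := by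
        rw [chainMap, affBd_single]
        have : (affNat (subdiv n) (n + 1))^[N] = ⇑((affNat (subdiv n) (n + 1)) ^ N) :=
          (Module.End.coe_pow _ _).symm
        rw [this, map_sum, map_sum, map_sum]
        refine Finset.sum_congr rfl fun i _ => ?_
        rw [map_zsmul, map_zsmul, map_zsmul, smul_eq_mul, ← this]
        congr 1
        change evalAff (σ.comp (affMap (face i))) f _ = _
        rw [← evalAff_affPush, affPush_affNat, natural, affPush_single]
        congr 5
        ext1 j
        exact affMap_vertex _ _
      have h := congrArg (evalAff σ f) (affBd_affNat_subdivHomotopy (c N))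
      rw [evalAff_affBd, hf, map_sub, map_sub] at h
      have h0 : evalAff σ (0 : Cochain (TopCat.toSSet.obj (TopCat.of X)) (n + 2))
          (affNat (subdivHomotopy (n + 1)) (n + 1) (c N)) = 0 :=
        evalAff_eq_zero (P := Set.univ) _ _ (fun _ _ => rfl) (by simp)
      rw [h0] at h
      rw [e, show c (N + 1) = affNat (subdiv (n + 1)) (n + 1) (c N) from
        Function.iterate_succ_apply' _ _ _]
      linarith
    have h0 : evalAff σ f (c M) = 0 :=
      evalAff_eq_zero σ f (fun v hv => hsmall _ (by rw [Equiv.apply_symm_apply]; exact hv))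
        (hN₀ (n + 1) σ M (Nat.le_add_right _ _))
    calc coboundary _ n g ((simplexEquiv X (n + 1)).symm σ)
        = ∑ i : Fin (n + 2), (-1 : ℤ) ^ (i : ℕ) *
            ∑ N ∈ Finset.range M, term (σ.comp (affMap (face i))) N := by
          rw [coboundary_apply]
          refine Finset.sum_congr rfl fun i _ => ?_
          rw [← g_eq _ M (hM i)]
          congr 2
          rw [Equiv.eq_symm_apply, simplexEquiv_face, Equiv.apply_symm_apply]
      _ = ∑ N ∈ Finset.range M, (evalAff σ f (c N) - evalAff σ f (c (N + 1))) := by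
          simp only [Finset.mul_sum]
          rw [Finset.sum_comm]
          exact Finset.sum_congr rfl fun N _ => step N
      _ = f ((simplexEquiv X (n + 1)).symm σ) := by
          rw [Finset.sum_range_sub', h0, sub_zero]
          have := evalAff_fundChain f ((simplexEquiv X (n + 1)).symm σ)
          rwa [Equiv.apply_symm_apply] at this
  · refine Finsupp.supported_mono (s := Set.univ) (fun v _ => hσ.comp _) (by simp)

end SmallSimplices

end SingularCohomology

namespace SingularCohomology

/-! ### The Mayer–Vietoris sequence -/

section MayerVietoris

open CategoryTheory Opposite Simplicial

variable {T T' : Type} [TopologicalSpace T] [TopologicalSpace T']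

/-- The inclusion of a subspace in a larger one. -/
def incl {S S' : Set T} (h : S ⊆ S') : C(S, S') := ⟨Set.inclusion h, continuous_inclusion h⟩

/-- Restriction of cohomology classes to a subspace. -/
noncomputable abbrev res {S S' : Set T} (h : S ⊆ S') (k : ℕ) : H S' k →+ H S k := pull (incl h) k

theorem res_res {S S' S'' : Set T} (h : S ⊆ S') (h' : S' ⊆ S'') (k : ℕ) (a : H S'' k) :
    res h k (res h' k a) = res (h.trans h') k a := by
  rw [res, res, ← pull_comp]
  rfl

/-- Cochains of a subspace. -/
abbrev SubCochain (S : Set T) (k : ℕ) : Type := Cochain (TopCat.toSSet.obj (TopCat.of S)) k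

/-- Restriction of cochains to a subspace. -/
noncomputable abbrev resCochain {S S' : Set T} (h : S ⊆ S') (k : ℕ) :
    SubCochain S' k →+ SubCochain S k := cochainMap (singMap (incl h)) k

theorem resCochain_resCochain {S S' S'' : Set T} (h : S ⊆ S') (h' : S' ⊆ S'') (k : ℕ)
    (a : SubCochain S'' k) :
    resCochain h k (resCochain h' k a) = resCochain (h.trans h') k a := rfl

theorem singMap_incl_injective {S S' : Set T} (h : S ⊆ S') (k : ℕ) :
    Function.Injective ((singMap (incl h)).app (op ⦋k⦌)) := by
  intro σ τ e
  apply (simplexEquiv _ k).injective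
  have := congrArg (simplexEquiv _ k) e
  rw [simplexEquiv_singMap, simplexEquiv_singMap] at this
  ext x
  exact congrArg (Subtype.val : S' → T) (DFunLike.congr_fun this x)

theorem exists_singMap_incl_eq {S S' : Set T} (h : S ⊆ S') {k : ℕ}
    (σ : (TopCat.toSSet.obj (TopCat.of S')) _⦋k⦌)
    (hσ : ∀ x, (simplexEquiv S' k σ x : T) ∈ S) :
    ∃ τ, (singMap (incl h)).app (op ⦋k⦌) τ = σ := by
  refine ⟨(simplexEquiv S k).symm ⟨fun x => ⟨simplexEquiv S' k σ x, hσ x⟩, by fun_prop⟩, ?_⟩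
  apply (simplexEquiv S' k).injective
  rw [simplexEquiv_singMap, Equiv.apply_symm_apply]
  rfl

theorem exists_resCochain_eq {S S' : Set T} (h : S ⊆ S') (k : ℕ) (f : SubCochain S k) :
    ∃ F : SubCochain S' k, resCochain h k F = f :=
  ⟨Function.extend ((singMap (incl h)).app (op ⦋k⦌)) f 0, by
    ext σ
    exact (singMap_incl_injective h k).extend_apply f 0 σ⟩

/-- `X` is the union of its open subsets `A` and `B`, which intersect in `C`. All spaces are subsets
of an ambient space. -/
structure IsOpenUnion (X A B C : Set T) : Prop where
  union_eq : A ∪ B = X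
  inter_eq : A ∩ B = C
  isOpen_left : ∃ O, IsOpen O ∧ X ∩ O = A
  isOpen_right : ∃ O, IsOpen O ∧ X ∩ O = B

variable {X A B C : Set T}

namespace IsOpenUnion

theorem left_subset (h : IsOpenUnion X A B C) : A ⊆ X := h.union_eq ▸ Set.subset_union_left
theorem right_subset (h : IsOpenUnion X A B C) : B ⊆ X := h.union_eq ▸ Set.subset_union_right
theorem inter_subset_left (h : IsOpenUnion X A B C) : C ⊆ A := h.inter_eq ▸ Set.inter_subset_left
theorem inter_subset_right (h : IsOpenUnion X A B C) : C ⊆ B := h.inter_eq ▸ Set.inter_subset_right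

/-- Cochains on `A` and `B` that agree on `C` extend to `X`; on simplices contained in neither part
the extension is zero. -/
theorem exists_glue (h : IsOpenUnion X A B C) (k : ℕ) (f : SubCochain A k) (g : SubCochain B k)
    (hfg : resCochain h.inter_subset_left k f = resCochain h.inter_subset_right k g) :
    ∃ c : SubCochain X k, resCochain h.left_subset k c = f ∧ resCochain h.right_subset k c = g := by
  refine ⟨Function.extend ((singMap (incl h.left_subset)).app (op ⦋k⦌)) f
    (Function.extend ((singMap (incl h.right_subset)).app (op ⦋k⦌)) g 0), ?_, ?_⟩
  · ext σ
    exact (singMap_incl_injective h.left_subset k).extend_apply f _ σ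
  · ext σ
    rw [cochainMap_apply]
    by_cases hσ : ∃ τ, (singMap (incl h.left_subset)).app (op ⦋k⦌) τ =
        (singMap (incl h.right_subset)).app (op ⦋k⦌) σ
    · obtain ⟨τ, hτ⟩ := hσ
      have hmem : ∀ x, (simplexEquiv B k σ x : T) ∈ C := by
        intro x
        rw [← h.inter_eq]
        refine ⟨?_, (simplexEquiv B k σ x).2⟩
        have := congrArg (fun ρ => (simplexEquiv X k ρ x : T)) hτ
        simp only [simplexEquiv_singMap] at this
        change (simplexEquiv A k τ x : T) = simplexEquiv B k σ x at this
        rw [← this]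
        exact (simplexEquiv A k τ x).2
      obtain ⟨ρ, hρ⟩ := exists_singMap_incl_eq h.inter_subset_right σ hmem
      rw [← hτ, (singMap_incl_injective h.left_subset k).extend_apply]
      have : τ = (singMap (incl h.inter_subset_left)).app (op ⦋k⦌) ρ := by
        apply singMap_incl_injective h.left_subset k
        rw [hτ, ← hρ]
        rfl
      rw [this, ← hρ]
      exact congrFun hfg ρ
    · rw [Function.extend_apply' _ _ _ hσ, (singMap_incl_injective h.right_subset k).extend_apply]

/-- The theorem of small simplices for an open union. -/
theorem exists_coboundary_eq (h : IsOpenUnion X A B C) {k : ℕ} (a : SubCochain X (k + 1))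
    (ha : coboundary _ _ a = 0) (hA : resCochain h.left_subset (k + 1) a = 0)
    (hB : resCochain h.right_subset (k + 1) a = 0) :
    ∃ c : SubCochain X k, coboundary _ k c = a ∧ resCochain h.left_subset k c = 0 ∧
      resCochain h.right_subset k c = 0 := by
  obtain ⟨O, hO, hOA⟩ := h.isOpen_left
  obtain ⟨O', hO', hOB⟩ := h.isOpen_right
  have memA (x : X) : x ∈ ((↑) ⁻¹' O : Set X) ↔ (x : T) ∈ A := by
    rw [← hOA]
    exact ⟨fun hx => ⟨x.2, hx⟩, fun hx => hx.2⟩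
  have memB (x : X) : x ∈ ((↑) ⁻¹' O' : Set X) ↔ (x : T) ∈ B := by
    rw [← hOB]
    exact ⟨fun hx => ⟨x.2, hx⟩, fun hx => hx.2⟩
  obtain ⟨c, hc, hsmall⟩ := exists_coboundary_eq_of_small (X := X) (U := (↑) ⁻¹' O)
    (V := (↑) ⁻¹' O') (hO.preimage continuous_subtype_val) (hO'.preimage continuous_subtype_val)
    (by
      ext x
      simp only [Set.mem_union, memA, memB, Set.mem_univ, iff_true]
      exact h.union_eq.ge x.2) a ha (fun σ hσ => by
      rcases hσ with hσ | hσ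
      · obtain ⟨τ, rfl⟩ := exists_singMap_incl_eq h.left_subset σ fun x => (memA _).1 (hσ x)
        exact congrFun hA τ
      · obtain ⟨τ, rfl⟩ := exists_singMap_incl_eq h.right_subset σ fun x => (memB _).1 (hσ x)
        exact congrFun hB τ)
  refine ⟨c, hc, ?_, ?_⟩
  · ext τ
    exact hsmall _ (Or.inl fun x => (memA _).2 (simplexEquiv A k τ x).2)
  · ext τ
    exact hsmall _ (Or.inr fun x => (memB _).2 (simplexEquiv B k τ x).2)

/-- The connecting relation of the Mayer–Vietoris sequence: `α ∈ Hᵏ⁺¹(X)` is the image of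
`β ∈ Hᵏ(C)` under the connecting homomorphism. A representing cocycle of `β` is written as the
difference of cochains `f` on `A` and `g` on `B`, and `α` is represented by the cocycle that
restricts to `δf` and to `δg`. -/
def Connecting (h : IsOpenUnion X A B C) (k : ℕ) (β : H C k) (α : H X (k + 1)) : Prop :=
  ∃ (f : SubCochain A k) (g : SubCochain B k) (b : cocycles _ k) (a : cocycles _ (k + 1)),
    cohomologyClass _ k b = β ∧ cohomologyClass _ (k + 1) a = α ∧
    resCochain h.inter_subset_left k f - resCochain h.inter_subset_right k g = b ∧
    resCochain h.left_subset (k + 1) a = coboundary _ k f ∧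
    resCochain h.right_subset (k + 1) a = coboundary _ k g

/-- Classes on `A` and `B` that agree on `C` come from a class on `X`. -/
theorem exists_res_eq (h : IsOpenUnion X A B C) (k : ℕ) (u : H A k) (v : H B k)
    (huv : res h.inter_subset_left k u = res h.inter_subset_right k v) :
    ∃ α : H X k, res h.left_subset k α = u ∧ res h.right_subset k α = v := by
  obtain ⟨u₀, rfl⟩ := cohomologyClass_surjective _ u
  obtain ⟨v₀, rfl⟩ := cohomologyClass_surjective _ v
  obtain ⟨u, hu⟩ := u₀
  obtain ⟨v, hv⟩ := v₀
  rw [res, res, pull, pull, cohomologyMap_class, cohomologyMap_class,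
    cohomologyClass_eq_iff_sub_mem] at huv
  change resCochain h.inter_subset_left k u - resCochain h.inter_subset_right k v ∈ _ at huv
  -- the representative on `A` is corrected so that the two cocycles agree on `C`
  obtain ⟨u', hu', huu', e⟩ : ∃ u' : SubCochain A k, ∃ _ : u' ∈ cocycles _ k,
      u - u' ∈ coboundaries _ k ∧
      resCochain h.inter_subset_left k u' = resCochain h.inter_subset_right k v := by
    cases k with
    | zero =>
      refine ⟨u, hu, ?_, sub_eq_zero.1 huv⟩
      rw [sub_self]
      exact zero_mem _
    | succ k =>
      obtain ⟨e, he⟩ := huv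
      obtain ⟨E, rfl⟩ := exists_resCochain_eq h.inter_subset_left k e
      rw [coboundary_cochainMap] at he
      refine ⟨u - coboundary _ k E, ?_, ?_, ?_⟩
      · exact sub_mem hu (coboundary_coboundary E)
      · rw [sub_sub_cancel]
        exact ⟨E, rfl⟩
      · rw [map_sub, he]
        abel
  obtain ⟨c, hcA, hcB⟩ := h.exists_glue k u' v e
  obtain ⟨d, hd, hdA, hdB⟩ := h.exists_coboundary_eq (coboundary _ k c) (coboundary_coboundary c)
    (by rw [← coboundary_cochainMap, hcA]; exact hu')
    (by rw [← coboundary_cochainMap, hcB]; exact hv)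
  have hcd : c - d ∈ cocycles _ k := by
    change coboundary _ k (c - d) = 0
    rw [map_sub, hd, sub_self]
  refine ⟨cohomologyClass _ k ⟨c - d, hcd⟩, ?_, ?_⟩
  · rw [res, pull, cohomologyMap_class, cohomologyClass_eq_iff_sub_mem]
    change resCochain h.left_subset k (c - d) - u ∈ _
    rw [map_sub, hcA, hdA, sub_zero, ← neg_sub]
    exact neg_mem huu'
  · rw [res, pull, cohomologyMap_class, cohomologyClass_eq_iff_sub_mem]
    change resCochain h.right_subset k (c - d) - v ∈ _
    rw [map_sub, hcB, hdB, sub_zero, sub_self]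
    exact zero_mem _

theorem exists_connecting (h : IsOpenUnion X A B C) (k : ℕ) (β : H C k) :
    ∃ α, h.Connecting k β α := by
  obtain ⟨b, rfl⟩ := cohomologyClass_surjective _ β
  obtain ⟨f, hf⟩ := exists_resCochain_eq h.inter_subset_left k (b : SubCochain C k)
  obtain ⟨c, hcA, hcB⟩ := h.exists_glue (k + 1) (coboundary _ k f) 0 (by
    rw [← coboundary_cochainMap, hf, map_zero]
    exact b.2)
  obtain ⟨d, hd, hdA, hdB⟩ := h.exists_coboundary_eq (coboundary _ _ c) (coboundary_coboundary c)
    (by rw [← coboundary_cochainMap, hcA, coboundary_coboundary])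
    (by rw [← coboundary_cochainMap, hcB, map_zero])
  have hcd : c - d ∈ cocycles _ (k + 1) := by
    change coboundary _ _ (c - d) = 0
    rw [map_sub, hd, sub_self]
  refine ⟨_, f, 0, b, ⟨c - d, hcd⟩, rfl, rfl, ?_, ?_, ?_⟩
  · rw [map_zero, sub_zero, hf]
  · rw [map_sub, hcA, hdA, sub_zero]
  · rw [map_sub, hcB, hdB, sub_zero, map_zero]

/-- Exactness at `Hᵏ⁺¹(X)`: a class vanishing on `A` and on `B` is in the image of the connecting
homomorphism. -/
theorem exists_connecting_of_res_eq_zero (h : IsOpenUnion X A B C) (k : ℕ) (α : H X (k + 1))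
    (hA : res h.left_subset (k + 1) α = 0) (hB : res h.right_subset (k + 1) α = 0) :
    ∃ β, h.Connecting k β α := by
  obtain ⟨a, rfl⟩ := cohomologyClass_surjective _ α
  rw [res, pull, cohomologyMap_class, cohomologyClass_eq_zero] at hA hB
  obtain ⟨f, hf⟩ := hA
  obtain ⟨g, hg⟩ := hB
  have hfg : resCochain h.inter_subset_left k f - resCochain h.inter_subset_right k g ∈
      cocycles _ k := by
    change coboundary _ _ _ = 0
    rw [map_sub, coboundary_cochainMap, coboundary_cochainMap, hf, hg, sub_eq_zero]
    rfl
  exact ⟨_, f, g, ⟨_, hfg⟩, a, rfl, rfl, rfl, hf.symm, hg.symm⟩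

theorem Connecting.res_left {h : IsOpenUnion X A B C} {k : ℕ} {β : H C k} {α : H X (k + 1)}
    (hc : h.Connecting k β α) : res h.left_subset (k + 1) α = 0 := by
  obtain ⟨f, g, b, a, rfl, rfl, -, hA, -⟩ := hc
  rw [res, pull, cohomologyMap_class, cohomologyClass_eq_zero]
  exact ⟨f, hA.symm⟩

theorem Connecting.add {h : IsOpenUnion X A B C} {k : ℕ} {β β' : H C k} {α α' : H X (k + 1)}
    (hc : h.Connecting k β α) (hc' : h.Connecting k β' α') : h.Connecting k (β + β') (α + α') := by
  obtain ⟨f, g, b, a, rfl, rfl, hb, hA, hB⟩ := hc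
  obtain ⟨f', g', b', a', rfl, rfl, hb', hA', hB'⟩ := hc'
  refine ⟨f + f', g + g', b + b', a + a', map_add _ _ _, map_add _ _ _, ?_, ?_, ?_⟩
  · rw [map_add, map_add, AddSubgroup.coe_add, ← hb, ← hb']
    abel
  · rw [AddSubgroup.coe_add, map_add, hA, hA', map_add]
  · rw [AddSubgroup.coe_add, map_add, hB, hB', map_add]

theorem Connecting.neg {h : IsOpenUnion X A B C} {k : ℕ} {β : H C k} {α : H X (k + 1)}
    (hc : h.Connecting k β α) : h.Connecting k (-β) (-α) := by
  obtain ⟨f, g, b, a, rfl, rfl, hb, hA, hB⟩ := hc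
  refine ⟨-f, -g, -b, -a, map_neg _ _, map_neg _ _, ?_, ?_, ?_⟩
  · rw [map_neg, map_neg, AddSubgroup.coe_neg, ← hb]
    abel
  · rw [AddSubgroup.coe_neg, map_neg, hA, map_neg]
  · rw [AddSubgroup.coe_neg, map_neg, hB, map_neg]

theorem Connecting.sub {h : IsOpenUnion X A B C} {k : ℕ} {β β' : H C k} {α α' : H X (k + 1)}
    (hc : h.Connecting k β α) (hc' : h.Connecting k β' α') : h.Connecting k (β - β') (α - α') := by
  rw [sub_eq_add_neg, sub_eq_add_neg]
  exact hc.add hc'.neg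

/-- Exactness at `Hᵏ(C)`: the kernel of the connecting homomorphism consists of the differences of
classes coming from `A` and from `B`. -/
theorem connecting_zero_iff (h : IsOpenUnion X A B C) (k : ℕ) (β : H C k) :
    h.Connecting k β 0 ↔
      ∃ u v, β = res h.inter_subset_left k u - res h.inter_subset_right k v := by
  constructor
  · rintro ⟨f, g, b, a, rfl, ha, hb, hA, hB⟩
    rw [cohomologyClass_eq_zero] at ha
    obtain ⟨c, hc⟩ := ha
    have hf : f - resCochain h.left_subset k c ∈ cocycles _ k := by
      change coboundary _ _ _ = 0
      rw [map_sub, coboundary_cochainMap, hc, hA, sub_self]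
    have hg : g - resCochain h.right_subset k c ∈ cocycles _ k := by
      change coboundary _ _ _ = 0
      rw [map_sub, coboundary_cochainMap, hc, hB, sub_self]
    refine ⟨cohomologyClass _ k ⟨_, hf⟩, cohomologyClass _ k ⟨_, hg⟩, ?_⟩
    rw [res, res, pull, pull, cohomologyMap_class, cohomologyMap_class, ← map_sub]
    congr 1
    apply Subtype.ext
    change (b : SubCochain C k) = resCochain h.inter_subset_left k (f - _) -
      resCochain h.inter_subset_right k (g - _)
    rw [map_sub, map_sub, ← hb, resCochain_resCochain, resCochain_resCochain]
    abel
  · rintro ⟨u, v, rfl⟩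
    obtain ⟨u, rfl⟩ := cohomologyClass_surjective _ u
    obtain ⟨v, rfl⟩ := cohomologyClass_surjective _ v
    refine ⟨u, v, cocycleMap _ k u - cocycleMap _ k v, 0, ?_, map_zero _, rfl, ?_, ?_⟩
    · rw [map_sub]
      rfl
    · exact (map_zero _).trans u.2.symm
    · exact (map_zero _).trans v.2.symm

/-- The connecting relation is single valued. -/
theorem Connecting.eq_zero {h : IsOpenUnion X A B C} {k : ℕ} {α : H X (k + 1)}
    (hc : h.Connecting k 0 α) : α = 0 := by
  obtain ⟨f, g, b, a, hb0, rfl, hb, hA, hB⟩ := hc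
  rw [cohomologyClass_eq_zero] at hb0
  obtain ⟨f', hf', e⟩ : ∃ f' : SubCochain A k, coboundary _ k f' = coboundary _ k f ∧
      resCochain h.inter_subset_left k f' = resCochain h.inter_subset_right k g := by
    cases k with
    | zero =>
      refine ⟨f, rfl, sub_eq_zero.1 (hb.trans hb0)⟩
    | succ k =>
      obtain ⟨e, he⟩ := hb0
      obtain ⟨E, rfl⟩ := exists_resCochain_eq h.inter_subset_left k e
      rw [coboundary_cochainMap, ← hb] at he
      refine ⟨f - coboundary _ k E, ?_, ?_⟩
      · rw [map_sub, coboundary_coboundary, sub_zero]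
      · rw [map_sub, he]
        abel
  obtain ⟨c, hcA, hcB⟩ := h.exists_glue k f' g e
  obtain ⟨d, hd, -, -⟩ := h.exists_coboundary_eq ((a : SubCochain X (k + 1)) - coboundary _ k c)
    (by
      rw [map_sub, coboundary_coboundary, sub_zero]
      exact a.2)
    (by rw [map_sub, hA, ← coboundary_cochainMap, hcA, hf', sub_self])
    (by rw [map_sub, hB, ← coboundary_cochainMap, hcB, sub_self])
  rw [cohomologyClass_eq_zero]
  refine ⟨c + d, ?_⟩
  rw [map_add, hd]
  abel

theorem Connecting.unique {h : IsOpenUnion X A B C} {k : ℕ} {β : H C k} {α α' : H X (k + 1)}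
    (hc : h.Connecting k β α) (hc' : h.Connecting k β α') : α = α' := by
  have := hc.sub hc'
  rw [sub_self] at this
  exact sub_eq_zero.1 this.eq_zero

theorem Connecting.zsmul {h : IsOpenUnion X A B C} {k : ℕ} {β : H C k} {α : H X (k + 1)}
    (hc : h.Connecting k β α) (m : ℤ) : h.Connecting k (m • β) (m • α) := by
  obtain ⟨f, g, b, a, rfl, rfl, hb, hA, hB⟩ := hc
  refine ⟨m • f, m • g, m • b, m • a, map_zsmul _ _ _, map_zsmul _ _ _, ?_, ?_, ?_⟩
  · rw [map_zsmul, map_zsmul, AddSubgroup.coe_zsmul, ← hb, smul_sub]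
  · rw [AddSubgroup.coe_zsmul, map_zsmul, hA, map_zsmul]
  · rw [AddSubgroup.coe_zsmul, map_zsmul, hB, map_zsmul]

/-- The connecting relation is natural. -/
theorem Connecting.pull {h : IsOpenUnion X A B C} {X' A' B' C' : Set T'}
    {h' : IsOpenUnion X' A' B' C'} {k : ℕ} {β : H C k} {α : H X (k + 1)}
    (hc : h.Connecting k β α) (p : C(X', X)) (pA : C(A', A)) (pB : C(B', B)) (pC : C(C', C))
    (hA : p.comp (incl h'.left_subset) = (incl h.left_subset).comp pA)
    (hB : p.comp (incl h'.right_subset) = (incl h.right_subset).comp pB)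
    (hCA : pA.comp (incl h'.inter_subset_left) = (incl h.inter_subset_left).comp pC)
    (hCB : pB.comp (incl h'.inter_subset_right) = (incl h.inter_subset_right).comp pC) :
    h'.Connecting k (pull pC k β) (pull p (k + 1) α) := by
  obtain ⟨f, g, b, a, rfl, rfl, hb, hfA, hgB⟩ := hc
  have comm {Y₁ Y₂ Y₃ Y₄ : Type} [TopologicalSpace Y₁] [TopologicalSpace Y₂] [TopologicalSpace Y₃]
      [TopologicalSpace Y₄] {i : C(Y₁, Y₂)} {j : C(Y₂, Y₄)} {i' : C(Y₁, Y₃)} {j' : C(Y₃, Y₄)}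
      (e : j.comp i = j'.comp i') (l : ℕ) (c : Cochain (TopCat.toSSet.obj (TopCat.of Y₄)) l) :
      cochainMap (singMap i) l (cochainMap (singMap j) l c) =
        cochainMap (singMap i') l (cochainMap (singMap j') l c) := by
    change cochainMap (singMap i ≫ singMap j) l c = cochainMap (singMap i' ≫ singMap j') l c
    rw [← singMap_comp, ← singMap_comp, e]
  refine ⟨cochainMap (singMap pA) k f, cochainMap (singMap pB) k g, cocycleMap (singMap pC) k b,
    cocycleMap (singMap p) (k + 1) a, rfl, rfl, ?_, ?_, ?_⟩
  · change _ = cochainMap (singMap pC) k b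
    rw [comm hCA, comm hCB, ← map_sub, hb]
  · change resCochain _ _ (cochainMap (singMap p) (k + 1) a) = _
    rw [comm hA, hfA, coboundary_cochainMap]
  · change resCochain _ _ (cochainMap (singMap p) (k + 1) a) = _
    rw [comm hB, hgB, coboundary_cochainMap]

/-- The connecting relation is compatible, up to sign, with the product by a class of `X`. -/
theorem Connecting.cupProduct {h : IsOpenUnion X A B C} {k : ℕ} {β : H C k} {α : H X (k + 1)}
    (hc : h.Connecting k β α) {i n : ℕ} (hn : i + k = n) (x : H X i) :
    h.Connecting n
      (cupProduct hn (res (h.inter_subset_left.trans h.left_subset) i x) β)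
      ((-1 : ℤ) ^ i • SingularCohomology.cupProduct (show i + (k + 1) = n + 1 by omega) x α) := by
  obtain ⟨f, g, b, a, rfl, rfl, hb, hA, hB⟩ := hc
  obtain ⟨x, rfl⟩ := cohomologyClass_surjective _ x
  have hx : coboundary _ i (x : SubCochain X i) = 0 := x.2
  refine ⟨cup _ hn (resCochain h.left_subset i x) f, cup _ hn (resCochain h.right_subset i x) g,
    cupCocycles hn (cocycleMap _ i x) b,
    (-1 : ℤ) ^ i • cupCocycles (show i + (k + 1) = n + 1 by omega) x a, rfl, ?_, ?_, ?_, ?_⟩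
  · rw [map_zsmul]
    rfl
  · change _ = cup _ hn (resCochain (h.inter_subset_left.trans h.left_subset) i x) b
    rw [cochainMap_cup, cochainMap_cup, ← hb, sub_eq_add_neg, sub_eq_add_neg, cup_add]
    congr 1
    ext σ
    simp only [Pi.neg_apply, cup, mul_neg]
    rfl
  · change resCochain h.left_subset (n + 1) ((-1 : ℤ) ^ i • cup _ (show i + (k + 1) = n + 1 by omega) _ _) = _
    rw [map_zsmul, cochainMap_cup, hA, coboundary_cup, coboundary_cochainMap, hx, map_zero,
      zero_cup, zero_add]
  · change resCochain h.right_subset (n + 1) ((-1 : ℤ) ^ i • cup _ (show i + (k + 1) = n + 1 by omega) _ _) = _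
    rw [map_zsmul, cochainMap_cup, hB, coboundary_cup, coboundary_cochainMap, hx, map_zero,
      zero_cup, zero_add]

/-- A class of degree `0` vanishing on `A` and on `B` vanishes. -/
theorem eq_zero_of_res_eq_zero (h : IsOpenUnion X A B C) (α : H X 0)
    (hA : res h.left_subset 0 α = 0) (hB : res h.right_subset 0 α = 0) : α = 0 := by
  obtain ⟨a, rfl⟩ := cohomologyClass_surjective _ α
  rw [res, SingularCohomology.pull, cohomologyMap_class, cohomologyClass_eq_zero] at hA hB
  rw [cohomologyClass_eq_zero]
  change (a : SubCochain X 0) = 0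
  ext σ
  have hσ : (simplexEquiv X 0 σ default : T) ∈ A ∪ B := by
    rw [h.union_eq]
    exact (simplexEquiv X 0 σ default).2
  rcases hσ with hσ | hσ
  · obtain ⟨τ, rfl⟩ := exists_singMap_incl_eq h.left_subset σ fun x => by
      rwa [Subsingleton.elim (α := stdSimplex ℝ (Fin 1)) x default]
    exact congrFun hA τ
  · obtain ⟨τ, rfl⟩ := exists_singMap_incl_eq h.right_subset σ fun x => by
      rwa [Subsingleton.elim (α := stdSimplex ℝ (Fin 1)) x default]
    exact congrFun hB τ

end IsOpenUnion

end MayerVietoris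

end SingularCohomology

namespace SingularCohomology

/-! ### Graded commutativity for classes of degree one -/

section DegreeOne

open CategoryTheory Opposite Simplicial

variable {S : SSet.{u}}

/-- A class of degree one commutes in the graded sense with every class. If `x` is a cocycle of
degree one and `f` a cocycle, the cochain `σ ↦ f(σ) x(edge from the first to the last vertex of σ)`
has coboundary `(-1)ⁱ f ⌣ x - x ⌣ f`. -/
theorem cupProduct_comm_of_degree_one {i n : ℕ} (h : 1 + i = n) (h' : i + 1 = n)
    (x : CohomologyGroup S 1) (a : CohomologyGroup S i) :
    cupProduct h x a = (-1 : ℤ) ^ i • cupProduct h' a x := by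
  obtain ⟨x, rfl⟩ := cohomologyClass_surjective _ x
  obtain ⟨f, rfl⟩ := cohomologyClass_surjective _ a
  subst h'
  rw [cupProduct_class, cupProduct_class, ← map_zsmul, eq_comm, cohomologyClass_eq_iff_sub_mem]
  obtain ⟨x, hx⟩ := x
  obtain ⟨f, hf⟩ := f
  let edge (n a b : ℕ) (hab : a ≤ b) (hb : b ≤ n) : ⦋1⦌ ⟶ ⦋n⦌ :=
    SimplexCategory.mkHom
      { toFun := fun t => if t = 0 then ⟨a, by omega⟩ else ⟨b, by omega⟩
        monotone' := by
          intro s t hst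
          fin_cases s <;> fin_cases t
          · exact le_rfl
          · exact hab
          · exact absurd hst (by decide)
          · exact le_rfl }
  have key {a b : ℕ} {p q : ⦋a⦌ ⟶ ⦋b⦌} (hpq : ∀ y, (p.toOrderHom y : ℕ) = q.toOrderHom y) :
      p = q := by
    ext y
    exact hpq y
  have triangle {n : ℕ} (σ : S _⦋n⦌) (a b c : ℕ) (hab : a ≤ b) (hbc : b ≤ c) (hc : c ≤ n) :
      x (S.map (edge n a c (by omega) hc).op σ) =
        x (S.map (edge n a b hab (by omega)).op σ) + x (S.map (edge n b c hbc hc).op σ) := by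
    let t : ⦋2⦌ ⟶ ⦋n⦌ := SimplexCategory.mkHom
      { toFun := fun t => if t = 0 then ⟨a, by omega⟩ else if t = 1 then ⟨b, by omega⟩ else
          ⟨c, by omega⟩
        monotone' := by
          intro s t hst
          fin_cases s <;> fin_cases t <;> first
            | exact absurd hst (by decide)
            | simp [Fin.le_def]
          all_goals omega }
    have := congrFun (show coboundary S 1 x = 0 from hx) (S.map t.op σ)
    rw [coboundary_eq] at this
    simp only [Finset.sum_range_succ, Finset.sum_range_zero, map_map] at this
    have e0 : natFace 1 0 ≫ t = edge n b c hbc hc := by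
      apply key
      intro y
      fin_cases y <;> rfl
    have e1 : natFace 1 1 ≫ t = edge n a c (by omega) hc := by
      apply key
      intro y
      fin_cases y <;> rfl
    have e2 : natFace 1 2 ≫ t = edge n a b hab (by omega) := by
      apply key
      intro y
      fin_cases y <;> rfl
    rw [e0, e1, e2] at this
    simp at this
    linarith
  have coe : (((-1 : ℤ) ^ i • cupCocycles (rfl : i + 1 = i + 1) ⟨f, hf⟩ ⟨x, hx⟩ :
      cocycles S (i + 1)) : Cochain S (i + 1)) = (-1 : ℤ) ^ i • cup S rfl f x := rfl
  refine ⟨fun σ => f σ * x (S.map (edge i 0 i (by omega) le_rfl).op σ), ?_⟩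
  rw [coe]
  change _ = _ - cup S h x f
  ext σ
  rw [coboundary_eq]
  simp only [Pi.sub_apply, Pi.smul_apply, smul_eq_mul, cup, consecutiveFace]
  have hfσ := congrFun (show coboundary S i f = 0 from hf) σ
  rw [coboundary_eq] at hfσ
  -- the edge of the `l`-th face differs from that of `σ` only for the first and the last face
  have hedge : ∀ l ∈ Finset.range (i + 2), (-1 : ℤ) ^ l * (f (S.map (natFace i l).op σ) *
      x (S.map (edge i 0 i (by omega) le_rfl).op (S.map (natFace i l).op σ))) =
      ((-1 : ℤ) ^ l * f (S.map (natFace i l).op σ)) *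
        x (S.map (edge (i + 1) 0 (i + 1) (by omega) le_rfl).op σ) -
      (if l = 0 then f (S.map (natFace i 0).op σ) *
        x (S.map (edge (i + 1) 0 1 (by omega) (by omega)).op σ) else 0) -
      (if l = i + 1 then (-1 : ℤ) ^ (i + 1) * (f (S.map (natFace i (i + 1)).op σ) *
        x (S.map (edge (i + 1) i (i + 1) (by omega) le_rfl).op σ)) else 0) := by
    intro l hl
    rw [Finset.mem_range] at hl
    rw [map_map]
    have e : edge i 0 i (by omega) le_rfl ≫ natFace i l =
        edge (i + 1) (if l = 0 then 1 else 0) (if l = i + 1 then i else i + 1)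
          (by split_ifs <;> omega) (by split_ifs <;> omega) := by
      apply key
      intro y
      fin_cases y
      · change (if 0 < l then 0 else 0 + 1) = (if l = 0 then 1 else 0)
        split_ifs <;> omega
      · change (if i < l then i else i + 1) = (if l = i + 1 then i else i + 1)
        split_ifs <;> omega
    rw [e]
    have T1 := triangle σ 0 1 (i + 1) (by omega) (by omega) le_rfl
    have T2 := triangle σ 0 i (i + 1) (by omega) (by omega) le_rfl
    by_cases h0 : l = 0
    · subst h0
      by_cases h1 : 0 = i + 1
      · omega
      · simp only [h1, if_true, if_false]
        rw [T1]
        ring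
    · by_cases h1 : l = i + 1
      · subst h1
        simp only [h0, if_true, if_false]
        rw [T2]
        ring
      · simp only [h0, h1, if_false]
        ring
  rw [Finset.sum_congr rfl hedge, Finset.sum_sub_distrib, Finset.sum_sub_distrib, ← Finset.sum_mul,
    hfσ]
  simp only [Finset.sum_ite_eq', Finset.mem_range]
  rw [if_pos (by omega), if_pos (by omega)]
  have s1 : SimplexCategory.subinterval 0 i (by omega) = natFace i (i + 1) := by
    apply key
    intro y
    change (y : ℕ) + 0 = if (y : ℕ) < i + 1 then (y : ℕ) else y + 1
    have : (y : ℕ) < i + 1 := y.2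
    split_ifs; omega
  have s2 : SimplexCategory.subinterval (n := i + 1) i 1 (by omega) =
      edge (i + 1) i (i + 1) (by omega) le_rfl := by
    apply key
    intro y
    fin_cases y
    · change 0 + i = i
      omega
    · change 1 + i = i + 1
      omega
  have s3 : SimplexCategory.subinterval (n := i + 1) 0 1 (by omega) =
      edge (i + 1) 0 1 (by omega) (by omega) := by
    apply key
    intro y
    fin_cases y <;> rfl
  have s4 : SimplexCategory.subinterval 1 i (by omega) = natFace i 0 := by
    apply key
    intro y
    change (y : ℕ) + 1 = if (y : ℕ) < 0 then (y : ℕ) else y + 1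
    simp
  rw [s1, s2, s3, s4, pow_succ, Pi.zero_apply]
  ring

end DegreeOne

/-! ### Points, path components and contractible spaces -/

section Points

open CategoryTheory Opposite Simplicial

variable {X Y : Type} [TopologicalSpace X] [TopologicalSpace Y]

theorem eq_zero_of_isEmpty [IsEmpty X] {k : ℕ} (a : H X k) : a = 0 := by
  obtain ⟨f, rfl⟩ := cohomologyClass_surjective _ a
  have : f = 0 := by
    apply Subtype.ext
    ext σ
    exact isEmptyElim (simplexEquiv X k σ (stdSimplex.vertex 0))
  rw [this, map_zero]

/-- The value of a cochain of degree `0` at a point. -/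
noncomputable def atPoint (f : Cochain (TopCat.toSSet.obj (TopCat.of X)) 0) (x : X) : ℤ :=
  f ((simplexEquiv X 0).symm (ContinuousMap.const _ x))

theorem eq_atPoint (f : Cochain (TopCat.toSSet.obj (TopCat.of X)) 0)
    (σ : (TopCat.toSSet.obj (TopCat.of X)) _⦋0⦌) : f σ = atPoint f (simplexEquiv X 0 σ default) := by
  rw [atPoint]
  congr 1
  rw [Equiv.eq_symm_apply]
  ext x
  rw [Subsingleton.elim (α := stdSimplex ℝ (Fin 1)) x default]
  rfl

theorem atPoint_eq_of_path {f : Cochain (TopCat.toSSet.obj (TopCat.of X)) 0}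
    (hf : f ∈ cocycles _ 0) {x y : X} (p : Path x y) : atPoint f x = atPoint f y := by
  let σ : C(Simplex 1, X) := (p : C(unitInterval, X)).comp
    (stdSimplexHomeomorphUnitInterval : C(stdSimplex ℝ (Fin 2), unitInterval))
  have h := congrFun (show coboundary _ 0 f = 0 from hf) ((simplexEquiv X 1).symm σ)
  rw [coboundary_apply, Fin.sum_univ_two, eq_atPoint f, eq_atPoint f] at h
  have h0 : simplexEquiv X 0 ((TopCat.toSSet.obj (TopCat.of X)).δ 0
      ((simplexEquiv X 1).symm σ)) default = y := by
    rw [simplexEquiv_face, Equiv.apply_symm_apply]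
    have : affMap (stdSimplex.vertex ∘ (0 : Fin 2).succAbove) default =
        (stdSimplex.vertex 1 : Simplex 1) := by
      have e : (default : Simplex 0) = stdSimplex.vertex 0 :=
        Subsingleton.elim (α := stdSimplex ℝ (Fin 1)) _ _
      rw [e, affMap_vertex]
      rfl
    rw [ContinuousMap.comp_apply, this]
    exact p.target
  have h1 : simplexEquiv X 0 ((TopCat.toSSet.obj (TopCat.of X)).δ 1
      ((simplexEquiv X 1).symm σ)) default = x := by
    rw [simplexEquiv_face, Equiv.apply_symm_apply]
    have : affMap (stdSimplex.vertex ∘ (1 : Fin 2).succAbove) default =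
        (stdSimplex.vertex 0 : Simplex 1) := by
      have e : (default : Simplex 0) = stdSimplex.vertex 0 :=
        Subsingleton.elim (α := stdSimplex ℝ (Fin 1)) _ _
      rw [e, affMap_vertex]
      rfl
    rw [ContinuousMap.comp_apply, this]
    exact p.source
  rw [h0, h1] at h
  simp at h
  linarith

/-- In degree `0` the cohomology of a path connected space is generated by the unit class. -/
theorem exists_eq_zsmul_one [PathConnectedSpace X] (a : H X 0) :
    ∃ m : ℤ, a = m • cohomologyOne _ := by
  obtain ⟨f, rfl⟩ := cohomologyClass_surjective _ a
  obtain ⟨x₀⟩ : Nonempty X := inferInstance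
  refine ⟨atPoint (f : Cochain _ 0) x₀, ?_⟩
  rw [cohomologyOne, ← map_zsmul]
  congr 1
  apply Subtype.ext
  ext σ
  refine (eq_atPoint _ σ).trans ?_
  rw [atPoint_eq_of_path f.2 (PathConnectedSpace.joined x₀ _).some.symm]
  exact (mul_one _).symm

theorem zsmul_one_eq_zero [Nonempty X] {m : ℤ}
    (h : m • cohomologyOne (TopCat.toSSet.obj (TopCat.of X)) = 0) : m = 0 := by
  rw [cohomologyOne, ← map_zsmul, cohomologyClass_eq_zero] at h
  obtain ⟨x⟩ := ‹Nonempty X›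
  have := congrFun (show _ = (0 : Cochain _ 0) from h)
    ((simplexEquiv X 0).symm (ContinuousMap.const _ x))
  exact (mul_one m).symm.trans this

/-- The cohomology of a point vanishes in positive degrees. -/
theorem eq_zero_of_unit {k : ℕ} (a : H Unit (k + 1)) : a = 0 := by
  obtain ⟨f, rfl⟩ := cohomologyClass_surjective _ a
  rw [cohomologyClass_eq_zero]
  have hconst {l : ℕ} (σ τ : (TopCat.toSSet.obj (TopCat.of Unit)) _⦋l⦌) : σ = τ :=
    (simplexEquiv Unit l).injective (Subsingleton.elim _ _)
  let pt (l : ℕ) : (TopCat.toSSet.obj (TopCat.of Unit)) _⦋l⦌ :=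
    (simplexEquiv Unit l).symm (ContinuousMap.const _ ())
  have hδ {l : ℕ} (g : Cochain (TopCat.toSSet.obj (TopCat.of Unit)) l)
      (σ : (TopCat.toSSet.obj (TopCat.of Unit)) _⦋l + 1⦌) :
      coboundary _ l g σ = if Even l then 0 else g (pt l) := by
    rw [coboundary_apply]
    have : ∀ i : Fin (l + 2), (-1 : ℤ) ^ (i : ℕ) *
        g ((TopCat.toSSet.obj (TopCat.of Unit)).δ i σ) = (-1 : ℤ) ^ (i : ℕ) * g (pt l) := by
      intro i
      rw [hconst ((TopCat.toSSet.obj (TopCat.of Unit)).δ i σ) (pt l)]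
    rw [Finset.sum_congr rfl fun i _ => this i, ← Finset.sum_mul,
      Fin.sum_univ_eq_sum_range (fun i => (-1 : ℤ) ^ i), neg_one_geom_sum]
    by_cases hl : Even l
    · rw [if_pos hl, if_pos (by simpa [Nat.even_add_one] using hl), zero_mul]
    · rw [if_neg hl, if_neg (by simpa [Nat.even_add_one] using hl), one_mul]
  by_cases hk : Even k
  · have : (f : Cochain (TopCat.toSSet.obj (TopCat.of Unit)) (k + 1)) = 0 := by
      ext σ
      have := congrFun (show coboundary _ (k + 1) (f : Cochain (TopCat.toSSet.obj (TopCat.of Unit))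
        (k + 1)) = 0 from f.2) (pt (k + 2))
      rw [hδ, if_neg (by rw [Nat.even_add_one, not_not]; exact hk)] at this
      rw [hconst σ (pt (k + 1)), this]
      rfl
    rw [this]
    exact zero_mem _
  · refine ⟨fun _ => (f : Cochain (TopCat.toSSet.obj (TopCat.of Unit)) (k + 1)) (pt (k + 1)), ?_⟩
    ext σ
    rw [hδ, if_neg hk, hconst σ (pt (k + 1))]

/-- The map to a point. -/
abbrev toUnit (X : Type) [TopologicalSpace X] : C(X, Unit) := ContinuousMap.const _ ()

theorem pull_toUnit (f : C(X, Y)) (k : ℕ) (c : H Unit k) :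
    pull f k (pull (toUnit Y) k c) = pull (toUnit X) k c := by
  rw [← pull_comp]
  rfl

theorem pull_toUnit_succ (k : ℕ) (c : H Unit (k + 1)) : pull (toUnit X) (k + 1) c = 0 := by
  rw [eq_zero_of_unit c, map_zero]

/-- Every class of a contractible space comes from a point. -/
theorem exists_eq_pull_toUnit [ContractibleSpace X] (k : ℕ) (a : H X k) :
    ∃ c : H Unit k, a = pull (toUnit X) k c := by
  obtain ⟨x, hx⟩ := id_nullhomotopic X
  refine ⟨pull (ContinuousMap.const Unit x) k a, ?_⟩
  rw [← pull_comp]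
  conv_lhs => rw [← pull_id k a, pull_eq_of_homotopic hx]
  rfl

theorem eq_zero_of_contractible [ContractibleSpace X] {k : ℕ} (a : H X (k + 1)) : a = 0 := by
  obtain ⟨c, rfl⟩ := exists_eq_pull_toUnit (k + 1) a
  exact pull_toUnit_succ k c

theorem homotopic_of_continuous {f g : C(X, Y)} (F : unitInterval × X → Y) (hF : Continuous F)
    (h₀ : ∀ x, F (0, x) = f x) (h₁ : ∀ x, F (1, x) = g x) : f.Homotopic g :=
  ⟨⟨⟨F, hF⟩, h₀, h₁⟩⟩

end Points

end SingularCohomology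

namespace SingularCohomology

/-! ### Punctured vector spaces -/

section PuncturedSpace

/-- The cohomology of `X` is that of a sphere of dimension `k`, up to classes coming from a point:
these are all classes in degrees other than `k`, and a single further class generates in degree
`k`. -/
def IsSphereLike (X : Type) [TopologicalSpace X] (k : ℕ) : Prop :=
  (∀ i ≠ k, ∀ a : H X i, ∃ c, a = pull (toUnit X) i c) ∧
    ∃ s : H X k, ∀ a : H X k, ∃ (m : ℤ) (c : H Unit k), a = m • s + pull (toUnit X) k c

theorem IsSphereLike.of_bijective {X Y : Type} [TopologicalSpace X] [TopologicalSpace Y]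
    {k : ℕ} (f : C(X, Y)) (hf : ∀ i, Function.Bijective (pull f i)) (h : IsSphereLike Y k) :
    IsSphereLike X k := by
  refine ⟨fun i hi a => ?_, ?_⟩
  · obtain ⟨b, rfl⟩ := (hf i).2 a
    obtain ⟨c, rfl⟩ := h.1 i hi b
    exact ⟨c, pull_toUnit f i c⟩
  · obtain ⟨s, hs⟩ := h.2
    refine ⟨pull f k s, fun a => ?_⟩
    obtain ⟨b, rfl⟩ := (hf k).2 a
    obtain ⟨m, c, rfl⟩ := hs b
    exact ⟨m, c, by rw [map_add, map_zsmul, pull_toUnit]⟩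

theorem isSphereLike_puncturedLine : IsSphereLike ({0}ᶜ : Set ℝ) 0 := by
  have h : IsOpenUnion ({0}ᶜ : Set ℝ) (Set.Iio 0) (Set.Ioi 0) ∅ :=
    ⟨by simp, Set.Iio_inter_Ioi.trans (Set.Ioo_self 0),
      ⟨Set.Iio 0, isOpen_Iio, Set.inter_eq_right.2 fun x hx => ne_of_lt hx⟩,
      ⟨Set.Ioi 0, isOpen_Ioi, Set.inter_eq_right.2 fun x hx => ne_of_gt hx⟩⟩
  have : ContractibleSpace (Set.Iio (0 : ℝ)) :=
    (convex_Iio 0).contractibleSpace ⟨-1, by simp⟩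
  have : ContractibleSpace (Set.Ioi (0 : ℝ)) :=
    (convex_Ioi 0).contractibleSpace ⟨1, by simp⟩
  constructor
  · intro i hi a
    obtain ⟨i, rfl⟩ := Nat.exists_eq_succ_of_ne_zero hi
    obtain ⟨β, hβ⟩ := h.exists_connecting_of_res_eq_zero i a (eq_zero_of_contractible _)
      (eq_zero_of_contractible _)
    rw [eq_zero_of_isEmpty β] at hβ
    exact ⟨0, by rw [hβ.eq_zero, map_zero]⟩
  · obtain ⟨s, hs₁, hs₂⟩ := h.exists_res_eq 0 0 (cohomologyOne _)
      ((eq_zero_of_isEmpty _).trans (eq_zero_of_isEmpty _).symm)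
    refine ⟨s, fun a => ?_⟩
    obtain ⟨x, hx⟩ := exists_eq_zsmul_one (res h.left_subset 0 a)
    obtain ⟨y, hy⟩ := exists_eq_zsmul_one (res h.right_subset 0 a)
    refine ⟨y - x, x • cohomologyOne _, ?_⟩
    rw [← sub_eq_zero]
    apply h.eq_zero_of_res_eq_zero
    · rw [map_sub, map_add, map_zsmul, hs₁, hx, map_zsmul, map_zsmul, pull_one, pull_one]
      simp
    · rw [map_sub, map_add, map_zsmul, hs₂, hy, map_zsmul, map_zsmul, pull_one, pull_one, sub_smul]
      abel

/-- The punctured space `(F × ℝ) \ 0` is the union of two star-shaped open sets, the complements of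
the lower and of the upper half axis; these meet in `(F \ 0) × ℝ`. -/
theorem isSphereLike_suspension {F : Type} [NormedAddCommGroup F] [NormedSpace ℝ F] [Nontrivial F]
    {k : ℕ} (hF : IsSphereLike ({0}ᶜ : Set F) k) : IsSphereLike ({0}ᶜ : Set (F × ℝ)) (k + 1) := by
  let A : Set (F × ℝ) := {p | p.1 ≠ 0 ∨ 0 < p.2}
  let B : Set (F × ℝ) := {p | p.1 ≠ 0 ∨ p.2 < 0}
  let C : Set (F × ℝ) := {p | p.1 ≠ 0}
  have oC : IsOpen C := isOpen_ne.preimage continuous_fst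
  have oA : IsOpen A := oC.union (isOpen_Ioi.preimage continuous_snd)
  have oB : IsOpen B := oC.union (isOpen_Iio.preimage continuous_snd)
  have h : IsOpenUnion ({0}ᶜ : Set (F × ℝ)) A B C := by
    refine ⟨?_, ?_, ⟨A, oA, Set.inter_eq_right.2 ?_⟩, ⟨B, oB, Set.inter_eq_right.2 ?_⟩⟩
    · ext ⟨x, t⟩
      simp only [A, B, Set.mem_union, Set.mem_ofPred_eq, Set.mem_compl_iff, Set.mem_singleton_iff,
        Prod.mk_eq_zero, not_and_or]
      constructor
      · rintro ((h | h) | (h | h))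
        · exact Or.inl h
        · exact Or.inr h.ne'
        · exact Or.inl h
        · exact Or.inr h.ne
      · rintro (h | h)
        · exact Or.inl (Or.inl h)
        · rcases lt_or_gt_of_ne h with h | h
          · exact Or.inr (Or.inr h)
          · exact Or.inl (Or.inr h)
    · ext ⟨x, t⟩
      simp only [A, B, C, Set.mem_inter_iff, Set.mem_ofPred_eq]
      constructor
      · rintro ⟨h | h, h' | h'⟩
        · exact h
        · exact h
        · exact h'
        · linarith
      · exact fun h => ⟨Or.inl h, Or.inl h⟩
    · rintro ⟨x, t⟩ (h | h) h0
      · exact h (congrArg Prod.fst h0)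
      · exact h.ne' (congrArg Prod.snd h0)
    · rintro ⟨x, t⟩ (h | h) h0
      · exact h (congrArg Prod.fst h0)
      · exact h.ne (congrArg Prod.snd h0)
  have : ContractibleSpace A := by
    refine StarConvex.contractibleSpace (x := ((0 : F), (1 : ℝ))) ?_ ⟨((0 : F), (1 : ℝ)),
      Or.inr (show (0 : ℝ) < 1 from one_pos)⟩
    rintro ⟨x, t⟩ hx a b ha hb hab
    simp only [A, Set.mem_ofPred_eq, Prod.smul_mk, Prod.mk_add_mk, smul_zero, zero_add,
      smul_eq_mul, mul_one] at hx ⊢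
    rcases hb.eq_or_lt with rfl | hb
    · right
      rw [add_zero] at hab
      rw [hab]
      simp
    · exact hx.imp (fun h => smul_ne_zero hb.ne' h) (fun h => by positivity)
  have : ContractibleSpace B := by
    refine StarConvex.contractibleSpace (x := ((0 : F), (-1 : ℝ))) ?_
      ⟨(0, -1), Or.inr (show (-1 : ℝ) < 0 by norm_num)⟩
    rintro ⟨x, t⟩ hx a b ha hb hab
    simp only [B, Set.mem_ofPred_eq, Prod.smul_mk, Prod.mk_add_mk, smul_zero, zero_add,
      smul_eq_mul] at hx ⊢
    rcases hb.eq_or_lt with rfl | hb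
    · right
      rw [add_zero] at hab
      rw [hab]
      simp
    · exact hx.imp (fun h => smul_ne_zero hb.ne' h) (fun h => by nlinarith)
  have hC : IsSphereLike C k := by
    let f : C(C, ({0}ᶜ : Set F)) := ⟨fun p => ⟨p.1.1, p.2⟩, by fun_prop⟩
    let g : C(({0}ᶜ : Set F), C) := ⟨fun x => ⟨(x.1, 0), x.2⟩, by fun_prop⟩
    refine hF.of_bijective f (pull_bijective_of_homotopyInverse (g := g) ?_ ?_)
    · refine homotopic_of_continuous
        (fun q => ⟨(q.2.1.1, (q.1 : ℝ) * q.2.1.2), q.2.2⟩) (by fun_prop) ?_ ?_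
      · rintro ⟨⟨x, t⟩, hx⟩
        simp [f, g]
      · rintro ⟨⟨x, t⟩, hx⟩
        simp
    · exact ContinuousMap.Homotopic.refl _
  have hdiff (i : ℕ) (c : H Unit i) : h.Connecting i (pull (toUnit C) i c) 0 := by
    rw [h.connecting_zero_iff]
    exact ⟨pull (toUnit A) i c, 0, by rw [map_zero, sub_zero, pull_toUnit]⟩
  constructor
  · intro i hi a
    cases i with
    | zero =>
      obtain ⟨x, hx⟩ := exists_eq_zsmul_one (res h.left_subset 0 a)
      obtain ⟨y, hy⟩ := exists_eq_zsmul_one (res h.right_subset 0 a)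
      have hxy : x = y := by
        have e := congrArg (res h.inter_subset_left 0) hx
        rw [res_res, ← res_res h.inter_subset_right h.right_subset, hy, map_zsmul, map_zsmul,
          pull_one, pull_one, ← sub_eq_zero, ← sub_smul] at e
        obtain ⟨v, hv⟩ := exists_ne (0 : F)
        have : Nonempty C := ⟨⟨(v, 0), hv⟩⟩
        exact (sub_eq_zero.1 (zsmul_one_eq_zero e)).symm
      refine ⟨x • cohomologyOne _, ?_⟩
      rw [← sub_eq_zero]
      apply h.eq_zero_of_res_eq_zero
      · rw [map_sub, hx, map_zsmul, map_zsmul, pull_one, pull_one, sub_self]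
      · rw [map_sub, hy, map_zsmul, map_zsmul, pull_one, pull_one, hxy, sub_self]
    | succ i =>
      obtain ⟨β, hβ⟩ := h.exists_connecting_of_res_eq_zero i a (eq_zero_of_contractible _)
        (eq_zero_of_contractible _)
      obtain ⟨c, rfl⟩ := hC.1 i (by omega) β
      exact ⟨0, by rw [hβ.unique (hdiff i c), map_zero]⟩
  · obtain ⟨s, hs⟩ := hC.2
    obtain ⟨s', hs'⟩ := h.exists_connecting k s
    refine ⟨s', fun a => ?_⟩
    obtain ⟨β, hβ⟩ := h.exists_connecting_of_res_eq_zero k a (eq_zero_of_contractible _)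
      (eq_zero_of_contractible _)
    obtain ⟨m, c, rfl⟩ := hs β
    refine ⟨m, 0, ?_⟩
    rw [map_zero]
    exact hβ.unique ((hs'.zsmul m).add (hdiff k c))

theorem IsSphereLike.of_equiv {E E' : Type} [NormedAddCommGroup E] [NormedSpace ℝ E]
    [NormedAddCommGroup E'] [NormedSpace ℝ E'] {k : ℕ}
    (h : IsSphereLike ({0}ᶜ : Set E') k) (e : E ≃L[ℝ] E') : IsSphereLike ({0}ᶜ : Set E) k := by
  have he : ∀ x ∈ ({0}ᶜ : Set E), e x ∈ ({0}ᶜ : Set E') := fun x hx => by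
    simpa using hx
  have he' : ∀ x ∈ ({0}ᶜ : Set E'), e.symm x ∈ ({0}ᶜ : Set E) := fun x hx => by
    simpa using hx
  have ce : Continuous e := e.continuous
  have ce' : Continuous e.symm := e.symm.continuous
  let f : C(({0}ᶜ : Set E), ({0}ᶜ : Set E')) :=
    ⟨Set.MapsTo.restrict e _ _ he, ce.restrict he⟩
  let g : C(({0}ᶜ : Set E'), ({0}ᶜ : Set E)) :=
    ⟨Set.MapsTo.restrict e.symm _ _ he', ce'.restrict he'⟩
  have hgf : g.comp f = ContinuousMap.id _ :=
    ContinuousMap.ext fun x => Subtype.ext (e.symm_apply_apply _)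
  have hfg : f.comp g = ContinuousMap.id _ :=
    ContinuousMap.ext fun x => Subtype.ext (e.apply_symm_apply _)
  refine h.of_bijective f fun i => pull_bijective_of_homotopyInverse (g := g) ?_ ?_ i
  · rw [hgf]
  · rw [hfg]

/-- The cohomology of a punctured real vector space is that of a sphere. -/
theorem isSphereLike_punctured (k : ℕ) (E : Type) [NormedAddCommGroup E] [NormedSpace ℝ E]
    [FiniteDimensional ℝ E] (hE : Module.finrank ℝ E = k + 1) :
    IsSphereLike ({0}ᶜ : Set E) k := by
  induction k generalizing E with
  | zero =>
    have e : E ≃L[ℝ] ℝ := ContinuousLinearEquiv.ofFinrankEq (by rw [hE, Module.finrank_self])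
    exact isSphereLike_puncturedLine.of_equiv e
  | succ k ih =>
    have hF := isSphereLike_suspension (ih (Fin (k + 1) → ℝ) (by simp))
    have e : E ≃L[ℝ] (Fin (k + 1) → ℝ) × ℝ :=
      ContinuousLinearEquiv.ofFinrankEq (by simp [hE])
    exact hF.of_equiv e

/-- The cohomology of a punctured vector space vanishes from its dimension on. -/
theorem punctured_eq_zero (E : Type) [NormedAddCommGroup E] [NormedSpace ℝ E]
    [FiniteDimensional ℝ E] {j : ℕ} (hj : j ≠ 0) (hE : Module.finrank ℝ E ≤ j)
    (a : H ({0}ᶜ : Set E) j) : a = 0 := by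
  obtain ⟨j, rfl⟩ := Nat.exists_eq_succ_of_ne_zero hj
  rcases Nat.eq_zero_or_pos (Module.finrank ℝ E) with h0 | h0
  · have : Subsingleton E := Module.finrank_zero_iff.1 h0
    have : IsEmpty ({0}ᶜ : Set E) := ⟨fun x => x.2 (Subsingleton.elim _ _)⟩
    exact eq_zero_of_isEmpty a
  · obtain ⟨k, hk⟩ := Nat.exists_eq_succ_of_ne_zero h0.ne'
    obtain ⟨c, rfl⟩ := (isSphereLike_punctured k E hk).1 (j + 1) (by omega) a
    exact pull_toUnit_succ j c

end PuncturedSpace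

end SingularCohomology

namespace SingularCohomology

/-! ### Products with subsets of the plane -/

section Slabs

theorem IsOpenUnion.eq_zero_of_isEmpty {T : Type} [TopologicalSpace T] {X A B C : Set T}
    [IsEmpty C] (h : IsOpenUnion X A B C) {k : ℕ} (α : H X k)
    (hA : res h.left_subset k α = 0) (hB : res h.right_subset k α = 0) : α = 0 := by
  cases k with
  | zero => exact h.eq_zero_of_res_eq_zero α hA hB
  | succ k =>
    obtain ⟨β, hβ⟩ := h.exists_connecting_of_res_eq_zero k α hA hB
    rw [SingularCohomology.eq_zero_of_isEmpty β] at hβ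
    exact hβ.eq_zero

/-- The product `Z × S` for `S ⊆ ℂ`, as a subset of `Z × ℂ`. -/
abbrev slab (Z : Type) (S : Set ℂ) : Set (Z × ℂ) := Prod.snd ⁻¹' S

theorem slab_mono {Z : Type} {S S' : Set ℂ} (h : S ⊆ S') : slab Z S ⊆ slab Z S' :=
  fun _ hp => h hp

variable (Z : Type) [TopologicalSpace Z] {S S' : Set ℂ}

/-- The projection `Z × S → Z`. -/
def slabFst (S : Set ℂ) : C(slab Z S, Z) := ⟨fun p => p.1.1, by fun_prop⟩

/-- The projection `Z × S → S`. -/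
def slabSnd (S : Set ℂ) : C(slab Z S, S) := ⟨fun p => ⟨p.1.2, p.2⟩, by fun_prop⟩

variable {Z}

/-- The section `z ↦ (z, s)` of the projection `Z × S → Z`. -/
def slabSection {s : ℂ} (hs : s ∈ S) : C(Z, slab Z S) := ⟨fun z => ⟨(z, s), hs⟩, by fun_prop⟩

theorem res_slabFst (h : S ⊆ S') (k : ℕ) (a : H Z k) :
    res (slab_mono h) k (pull (slabFst Z S') k a) = pull (slabFst Z S) k a :=
  (pull_comp _ _ k a).symm

theorem res_slabSnd (h : S ⊆ S') (k : ℕ) (a : H S' k) :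
    res (slab_mono h) k (pull (slabSnd Z S') k a) = pull (slabSnd Z S) k (res h k a) :=
  (pull_comp _ _ k a).symm.trans (pull_comp (incl h) (slabSnd Z S) k a)

theorem pull_slabFst_injective (h : S.Nonempty) (k : ℕ) :
    Function.Injective (pull (slabFst Z S) k) := by
  obtain ⟨s, hs⟩ := h
  refine Function.LeftInverse.injective (g := pull (slabSection hs) k) fun a => ?_
  rw [← pull_comp]
  exact pull_id k a

theorem pull_slabFst_bijective {s : ℂ} (h : StarConvex ℝ s S) (hs : s ∈ S) (k : ℕ) :
    Function.Bijective (pull (slabFst Z S) k) := by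
  refine pull_bijective_of_homotopyInverse (g := slabSection hs) ?_ ?_ k
  · refine homotopic_of_continuous (fun q => ⟨(q.2.1.1, s + (q.1 : ℝ) • (q.2.1.2 - s)),
      h.add_smul_sub_mem q.2.2 q.1.2.1 q.1.2.2⟩) (by fun_prop) ?_ ?_
    · rintro ⟨⟨z, w⟩, hw⟩
      simp [slabFst, slabSection]
    · rintro ⟨⟨z, w⟩, hw⟩
      simp
  · exact ContinuousMap.Homotopic.refl _

theorem isOpenUnion_slab {X A B C : Set ℂ} (h : IsOpenUnion X A B C) :
    IsOpenUnion (slab Z X) (slab Z A) (slab Z B) (slab Z C) := by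
  obtain ⟨O, hO, eO⟩ := h.isOpen_left
  obtain ⟨O', hO', eO'⟩ := h.isOpen_right
  refine ⟨?_, ?_, ⟨slab Z O, hO.preimage continuous_snd, ?_⟩,
    ⟨slab Z O', hO'.preimage continuous_snd, ?_⟩⟩
  · rw [← h.union_eq]; rfl
  · rw [← h.inter_eq]; rfl
  · rw [← eO]; rfl
  · rw [← eO']; rfl

end Slabs

/-! ### Products with the punctured plane -/

section Kunneth

open Complex

/-- The complex numbers off the real axis. -/
abbrev offReal : Set ℂ := {w | w.im ≠ 0}

/-- The upper half plane, as a subset of `ℂ`. -/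
abbrev upperHalf : Set ℂ := {w | 0 < w.im}

/-- The lower half plane, as a subset of `ℂ`. -/
abbrev lowerHalf : Set ℂ := {w | w.im < 0}

/-- The complex plane slit along the nonnegative real axis. -/
abbrev oppositeSlitPlane : Set ℂ := {w | -w ∈ slitPlane}

theorem isOpenUnion_puncturedPlane :
    IsOpenUnion ({0}ᶜ : Set ℂ) slitPlane oppositeSlitPlane offReal := by
  refine ⟨?_, ?_, ⟨slitPlane, isOpen_slitPlane, Set.inter_eq_right.2 ?_⟩,
    ⟨oppositeSlitPlane, isOpen_slitPlane.preimage continuous_neg, Set.inter_eq_right.2 ?_⟩⟩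
  · ext w
    simp only [Set.mem_union, mem_slitPlane_iff, Set.mem_ofPred_eq, neg_re, neg_im, neg_ne_zero,
      Set.mem_compl_iff, Set.mem_singleton_iff, Complex.ext_iff, zero_re, zero_im, neg_pos]
    constructor
    · rintro ((h | h) | (h | h)) ⟨h₁, h₂⟩
      · exact h.ne' h₁
      · exact h h₂
      · exact h.ne h₁
      · exact h h₂
    · intro h
      by_cases h₂ : w.im = 0
      · rcases lt_or_gt_of_ne (fun h₁ => h ⟨h₁, h₂⟩) with h₁ | h₁
        · exact Or.inr (Or.inl h₁)
        · exact Or.inl (Or.inl h₁)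
      · exact Or.inl (Or.inr h₂)
  · ext w
    simp only [Set.mem_inter_iff, mem_slitPlane_iff, Set.mem_ofPred_eq, neg_re, neg_im,
      neg_ne_zero, neg_pos]
    constructor
    · rintro ⟨h | h, h' | h'⟩
      · linarith
      · exact h'
      · exact h
      · exact h
    · exact fun h => ⟨Or.inr h, Or.inr h⟩
  · exact fun w hw => slitPlane_ne_zero hw
  · exact fun w hw => neg_ne_zero.1 (slitPlane_ne_zero hw)

theorem isOpenUnion_offReal : IsOpenUnion offReal upperHalf lowerHalf ∅ := by
  refine ⟨?_, ?_, ⟨upperHalf, isOpen_lt continuous_const continuous_im, Set.inter_eq_right.2 ?_⟩,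
    ⟨lowerHalf, isOpen_lt continuous_im continuous_const, Set.inter_eq_right.2 ?_⟩⟩
  · ext w
    exact ⟨fun h => h.elim (fun h => ne_of_gt (a := w.im) h) (fun h => ne_of_lt (a := w.im) h),
      fun h => (lt_or_gt_of_ne (a := w.im) h).symm⟩
  · ext w
    exact ⟨fun h => lt_asymm (a := w.im) h.2 h.1, False.elim⟩
  · exact fun w h => ne_of_gt (a := w.im) h
  · exact fun w h => ne_of_lt (a := w.im) h

theorem starConvex_oppositeSlitPlane : StarConvex ℝ (-1) oppositeSlitPlane := by
  intro w hw a b ha hb hab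
  have := starConvex_one_slitPlane hw ha hb hab
  change -(a • (-1 : ℂ) + b • w) ∈ slitPlane
  convert this using 1
  simp only [smul_neg]
  abel

theorem starConvex_upperHalf : StarConvex ℝ I upperHalf :=
  (convex_halfSpace_im_gt 0).starConvex (by simp)

theorem starConvex_lowerHalf : StarConvex ℝ (-I) lowerHalf :=
  (convex_halfSpace_im_lt 0).starConvex (by simp)

theorem exists_upperClass : ∃ u : H offReal 0,
    res isOpenUnion_offReal.left_subset 0 u = cohomologyOne _ ∧
      res isOpenUnion_offReal.right_subset 0 u = 0 :=
  isOpenUnion_offReal.exists_res_eq 0 _ _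
    ((eq_zero_of_isEmpty _).trans (eq_zero_of_isEmpty _).symm)

/-- A class of degree `0` off the real axis that is `1` above it and `0` below it. -/
noncomputable def upperClass : H offReal 0 := exists_upperClass.choose

theorem res_upperClass_upper :
    res isOpenUnion_offReal.left_subset 0 upperClass = cohomologyOne _ :=
  exists_upperClass.choose_spec.1

theorem res_upperClass_lower : res isOpenUnion_offReal.right_subset 0 upperClass = 0 :=
  exists_upperClass.choose_spec.2

theorem exists_windingClass : ∃ ε : H ({0}ᶜ : Set ℂ) 1,
    isOpenUnion_puncturedPlane.Connecting 0 upperClass ε :=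
  isOpenUnion_puncturedPlane.exists_connecting 0 _

/-- A generator of the first cohomology group of the punctured plane, obtained from the class
`upperClass` by the connecting homomorphism. -/
noncomputable def windingClass : H ({0}ᶜ : Set ℂ) 1 := exists_windingClass.choose

theorem connecting_windingClass :
    isOpenUnion_puncturedPlane.Connecting 0 upperClass windingClass :=
  exists_windingClass.choose_spec

variable {Z : Type} [TopologicalSpace Z]

theorem isOpenUnion_slab_puncturedPlane : IsOpenUnion (slab Z {0}ᶜ) (slab Z slitPlane)
    (slab Z oppositeSlitPlane) (slab Z offReal) :=
  isOpenUnion_slab isOpenUnion_puncturedPlane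

/-- The connecting homomorphism on a class `b × u`. -/
theorem connecting_cupProduct_windingClass (k : ℕ) (b : H Z k) :
    isOpenUnion_slab_puncturedPlane.Connecting k
      (cupProduct (add_zero k) (pull (slabFst Z offReal) k b) (pull (slabSnd Z offReal) 0 upperClass))
      ((-1 : ℤ) ^ k • cupProduct (show k + 1 = k + 1 from rfl) (pull (slabFst Z {0}ᶜ) k b)
        (pull (slabSnd Z {0}ᶜ) 1 windingClass)) := by
  have h := connecting_windingClass.pull (h' := isOpenUnion_slab_puncturedPlane (Z := Z))
    (slabSnd Z _) (slabSnd Z _) (slabSnd Z _) (slabSnd Z _) rfl rfl rfl rfl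
  have h' := h.cupProduct (add_zero k) (pull (slabFst Z {0}ᶜ) k b)
  rwa [res_slabFst (isOpenUnion_puncturedPlane.inter_subset_left.trans
    isOpenUnion_puncturedPlane.left_subset)] at h'

theorem connecting_slabFst (k : ℕ) (a : H Z k) :
    isOpenUnion_slab_puncturedPlane.Connecting k (pull (slabFst Z offReal) k a) 0 := by
  rw [IsOpenUnion.connecting_zero_iff]
  exact ⟨pull (slabFst Z slitPlane) k a, 0, by
    rw [map_zero, sub_zero, res_slabFst isOpenUnion_puncturedPlane.inter_subset_left]⟩

theorem res_upper (k : ℕ) (a b : H Z k) :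
    res (slab_mono isOpenUnion_offReal.left_subset) k
      (pull (slabFst Z offReal) k a + cupProduct (add_zero k) (pull (slabFst Z offReal) k b)
        (pull (slabSnd Z offReal) 0 upperClass)) = pull (slabFst Z upperHalf) k (a + b) := by
  rw [map_add, res, pull_cupProduct, ← res, res_slabFst isOpenUnion_offReal.left_subset,
    res_slabFst isOpenUnion_offReal.left_subset, res_slabSnd isOpenUnion_offReal.left_subset,
    res_upperClass_upper, pull_one, cupProduct_cohomologyOne, map_add]

theorem res_lower (k : ℕ) (a b : H Z k) :
    res (slab_mono isOpenUnion_offReal.right_subset) k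
      (pull (slabFst Z offReal) k a + cupProduct (add_zero k) (pull (slabFst Z offReal) k b)
        (pull (slabSnd Z offReal) 0 upperClass)) = pull (slabFst Z lowerHalf) k a := by
  rw [map_add, res, pull_cupProduct, ← res, res_slabFst isOpenUnion_offReal.right_subset,
    res_slabFst isOpenUnion_offReal.right_subset, res_slabSnd isOpenUnion_offReal.right_subset,
    res_upperClass_lower, map_zero, map_zero, add_zero]

theorem exists_eq_offReal (k : ℕ) (c : H (slab Z offReal) k) : ∃ a b : H Z k,
    c = pull (slabFst Z offReal) k a + cupProduct (add_zero k) (pull (slabFst Z offReal) k b)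
      (pull (slabSnd Z offReal) 0 upperClass) := by
  have h := isOpenUnion_slab (Z := Z) isOpenUnion_offReal
  have : IsEmpty (slab Z ∅) := ⟨fun p => p.2⟩
  obtain ⟨x, hx⟩ := (pull_slabFst_bijective (Z := Z) starConvex_upperHalf
    (by simp [upperHalf]) k).2 (res h.left_subset k c)
  obtain ⟨y, hy⟩ := (pull_slabFst_bijective (Z := Z) starConvex_lowerHalf
    (by simp [lowerHalf]) k).2 (res h.right_subset k c)
  refine ⟨y, x - y, ?_⟩
  rw [← sub_eq_zero]
  apply h.eq_zero_of_isEmpty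
  · rw [map_sub, res_upper, ← hx, add_sub_cancel, sub_self]
  · rw [map_sub, res_lower, ← hy, sub_self]

theorem pull_slabFst_plane_injective (k : ℕ) :
    Function.Injective (pull (slabFst Z {0}ᶜ) k) :=
  pull_slabFst_injective ⟨1, by simp⟩ k

/-- A class of `Z × ℂˣ` agrees with a class of `Z` over both slit planes. -/
theorem exists_res_sub_slabFst_eq_zero (k : ℕ) (α : H (slab Z {0}ᶜ) k) : ∃ a : H Z k,
    res isOpenUnion_slab_puncturedPlane.left_subset k (α - pull (slabFst Z {0}ᶜ) k a) = 0 ∧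
    res isOpenUnion_slab_puncturedPlane.right_subset k (α - pull (slabFst Z {0}ᶜ) k a) = 0 := by
  have h := isOpenUnion_slab_puncturedPlane (Z := Z)
  obtain ⟨x, hx⟩ := (pull_slabFst_bijective (Z := Z) starConvex_one_slitPlane
    one_mem_slitPlane k).2 (res h.left_subset k α)
  obtain ⟨y, hy⟩ := (pull_slabFst_bijective (Z := Z) starConvex_oppositeSlitPlane
    (by simp) k).2 (res h.right_subset k α)
  have hxy : x = y := by
    apply pull_slabFst_injective (S := offReal) ⟨I, by simp⟩ k
    rw [← res_slabFst isOpenUnion_puncturedPlane.inter_subset_left,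
      ← res_slabFst isOpenUnion_puncturedPlane.inter_subset_right, hx, hy, res_res, res_res]
  refine ⟨x, ?_, ?_⟩
  · rw [map_sub, res_slabFst isOpenUnion_puncturedPlane.left_subset, hx, sub_self]
  · rw [map_sub, res_slabFst isOpenUnion_puncturedPlane.right_subset, hxy, hy, sub_self]

theorem exists_eq_pull_slabFst_zero (α : H (slab Z {0}ᶜ) 0) :
    ∃ a : H Z 0, α = pull (slabFst Z {0}ᶜ) 0 a := by
  obtain ⟨a, hA, hB⟩ := exists_res_sub_slabFst_eq_zero 0 α
  exact ⟨a, sub_eq_zero.1 (isOpenUnion_slab_puncturedPlane.eq_zero_of_res_eq_zero _ hA hB)⟩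

/-- The Künneth theorem for `Z × ℂˣ`: each class of positive degree is `a × 1 + b × ε` with `ε` the
winding class. It follows from the Mayer–Vietoris sequence of the two slit planes times `Z`. -/
theorem exists_eq_windingClass (k : ℕ) (α : H (slab Z {0}ᶜ) (k + 1)) :
    ∃ (a : H Z (k + 1)) (b : H Z k), α = pull (slabFst Z {0}ᶜ) (k + 1) a +
      cupProduct rfl (pull (slabFst Z {0}ᶜ) k b) (pull (slabSnd Z {0}ᶜ) 1 windingClass) := by
  obtain ⟨a, hA, hB⟩ := exists_res_sub_slabFst_eq_zero (k + 1) α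
  obtain ⟨β, hβ⟩ := isOpenUnion_slab_puncturedPlane.exists_connecting_of_res_eq_zero k _ hA hB
  obtain ⟨c, b, rfl⟩ := exists_eq_offReal k β
  refine ⟨a, (-1 : ℤ) ^ k • b, ?_⟩
  rw [← sub_eq_iff_eq_add', map_zsmul, map_zsmul, AddMonoidHom.zsmul_apply]
  have := (connecting_slabFst k c).add (connecting_cupProduct_windingClass k b)
  rw [zero_add] at this
  exact hβ.unique this

/-- Uniqueness of the Künneth decomposition. -/
theorem eq_zero_of_windingClass (k : ℕ) {a : H Z (k + 1)} {b : H Z k}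
    (h0 : pull (slabFst Z {0}ᶜ) (k + 1) a + cupProduct rfl (pull (slabFst Z {0}ᶜ) k b)
      (pull (slabSnd Z {0}ᶜ) 1 windingClass) = 0) : a = 0 ∧ b = 0 := by
  have h := isOpenUnion_slab_puncturedPlane (Z := Z)
  have ha : a = 0 := by
    have := congrArg (res h.left_subset (k + 1)) h0
    rw [map_add, res_slabFst isOpenUnion_puncturedPlane.left_subset, res, pull_cupProduct, ← res,
      ← res, res_slabSnd isOpenUnion_puncturedPlane.left_subset, connecting_windingClass.res_left,
      map_zero, map_zero, add_zero, map_zero] at this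
    exact (map_eq_zero_iff _ (pull_slabFst_bijective (Z := Z) starConvex_one_slitPlane
      one_mem_slitPlane (k + 1)).1).1 this
  refine ⟨ha, ?_⟩
  rw [ha, map_zero, zero_add] at h0
  have hc := connecting_cupProduct_windingClass k b
  rw [h0, smul_zero, IsOpenUnion.connecting_zero_iff] at hc
  obtain ⟨u, v, huv⟩ := hc
  obtain ⟨x, rfl⟩ := (pull_slabFst_bijective (Z := Z) starConvex_one_slitPlane
    one_mem_slitPlane k).2 u
  obtain ⟨y, rfl⟩ := (pull_slabFst_bijective (Z := Z) starConvex_oppositeSlitPlane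
    (by simp) k).2 v
  rw [res_slabFst isOpenUnion_puncturedPlane.inter_subset_left,
    res_slabFst isOpenUnion_puncturedPlane.inter_subset_right, ← map_sub] at huv
  have hL := res_lower k (0 : H Z k) b
  have hU := res_upper k (0 : H Z k) b
  rw [map_zero, zero_add, huv, res_slabFst isOpenUnion_offReal.right_subset] at hL
  rw [map_zero, zero_add, huv, res_slabFst isOpenUnion_offReal.left_subset] at hU
  have hxy := pull_slabFst_injective (S := lowerHalf) ⟨-I, by simp⟩ k (hL.trans (map_zero _).symm)
  rw [hxy, zero_add] at hU
  exact (pull_slabFst_injective (S := upperHalf) ⟨I, by simp⟩ k hU).symm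

end Kunneth

/-! ### The cohomology of the circle -/

section CircleCohomology

open Complex

theorem exists_eq_zsmul_windingClass (α : H ({0}ᶜ : Set ℂ) 1) : ∃ m : ℤ, α = m • windingClass := by
  obtain ⟨a, b, h⟩ := exists_eq_windingClass (Z := Unit) 0 (pull (slabSnd Unit {0}ᶜ) 1 α)
  obtain ⟨m, rfl⟩ := exists_eq_zsmul_one b
  refine ⟨m, ?_⟩
  let s : C(({0}ᶜ : Set ℂ), slab Unit {0}ᶜ) := ⟨fun w => ⟨((), w), w.2⟩, by fun_prop⟩
  have h' := congrArg (pull s 1) h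
  rw [eq_zero_of_unit a, map_zero, zero_add, map_zsmul, map_zsmul, AddMonoidHom.zsmul_apply,
    pull_one, cohomologyOne_cupProduct, map_zsmul, ← pull_comp, ← pull_comp] at h'
  exact (pull_id 1 α).symm.trans (h'.trans (congrArg (m • ·) (pull_id 1 _)))

/-- Radial projection of the punctured plane to the circle. -/
noncomputable def toCircle : C(({0}ᶜ : Set ℂ), Circle) :=
  ⟨fun w => ⟨(w : ℂ) / ‖(w : ℂ)‖, by
    have : (w : ℂ) ≠ 0 := w.2
    simp [Submonoid.unitSphere, this]⟩, by
    refine Continuous.subtype_mk ?_ _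
    refine Continuous.div (by fun_prop) (by fun_prop) fun w => ?_
    have : (w : ℂ) ≠ 0 := w.2
    simpa using this⟩

/-- The inclusion of the circle in the punctured plane. -/
noncomputable def ofCircle : C(Circle, ({0}ᶜ : Set ℂ)) := ⟨fun w => ⟨w, w.coe_ne_zero⟩, by fun_prop⟩

theorem pull_toCircle_bijective (k : ℕ) : Function.Bijective (pull toCircle k) := by
  refine pull_bijective_of_homotopyInverse (g := ofCircle) ?_ ?_ k
  · refine homotopic_of_continuous (fun q => ⟨(((1 - q.1 : ℝ) / ‖(q.2 : ℂ)‖ + q.1 : ℝ) : ℂ) * q.2, ?_⟩)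
      ?_ ?_ ?_
    · have : (q.2 : ℂ) ≠ 0 := q.2.2
      have h0 : 0 < ‖(q.2 : ℂ)‖ := norm_pos_iff.2 this
      refine mul_ne_zero (ofReal_ne_zero.2 (ne_of_gt ?_)) this
      rcases q.1.2.1.eq_or_lt with h | h
      · rw [← h]; simp [h0]
      · have := div_nonneg (sub_nonneg.2 q.1.2.2) h0.le
        linarith
    · refine Continuous.subtype_mk ?_ _
      refine Continuous.mul (continuous_ofReal.comp (Continuous.add (Continuous.div (by fun_prop)
        (by fun_prop) fun q => ?_) (by fun_prop))) (by fun_prop)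
      exact norm_ne_zero_iff.2 q.2.2
    · intro w
      apply Subtype.ext
      change _ = (w : ℂ) / ‖(w : ℂ)‖
      simp [div_eq_inv_mul]
    · intro w
      apply Subtype.ext
      simp
  · have : toCircle.comp ofCircle = ContinuousMap.id _ := by
      ext w
      exact (congrArg (fun t : ℝ => (w : ℂ) / t) w.norm_coe).trans
        ((congrArg _ ofReal_one).trans (div_one _))
    rw [this]

variable {e : H Circle 1}

/-- A generator of `H¹(S¹)` is the class `windingClass` up to sign. -/
theorem pull_toCircle_eq (he : IsFundamentalClass e) :
    ∃ s : ℤ, s * s = 1 ∧ pull toCircle 1 e = s • windingClass := by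
  obtain ⟨s, hs⟩ := exists_eq_zsmul_windingClass (pull toCircle 1 e)
  obtain ⟨a, ha⟩ := (pull_toCircle_bijective 1).2 windingClass
  obtain ⟨t, rfl⟩ := he.2 a
  have h : (s * t - 1) • e = 0 := by
    apply (pull_toCircle_bijective 1).1
    have hω : (t * s) • windingClass = windingClass := by
      rw [mul_smul, ← hs, ← map_zsmul, ha]
    rw [map_zero, map_zsmul, hs, sub_smul, one_smul, mul_smul, smul_smul t s, hω, sub_self]
  refine ⟨s, ?_, hs⟩
  have : s * t - 1 = 0 := he.1 (by simpa using h)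
  rcases Int.eq_one_or_neg_one_of_mul_eq_one (sub_eq_zero.1 this) with rfl | rfl <;> rfl

theorem circle_eq_zero {k : ℕ} (hk : 2 ≤ k) (a : H Circle k) : a = 0 := by
  apply (pull_toCircle_bijective k).1
  rw [punctured_eq_zero ℂ (by omega) (by simpa using hk) (pull toCircle k a), map_zero]

end CircleCohomology

end SingularCohomology

namespace SingularCohomology

/-! ### The cross product with the circle as a ring homomorphism -/

section KunnethRing

instance : PathConnectedSpace Circle :=
  (show Function.Surjective Circle.exp from fun z => ⟨_, Circle.exp_arg z⟩).pathConnectedSpace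
    Circle.exp.continuous

variable {Z : Type} [TopologicalSpace Z] {e : H Circle 1}

variable (Z) in
/-- The map `Z × ℂˣ → S¹`. -/
noncomputable def slabCircle : C(slab Z {0}ᶜ, Circle) := toCircle.comp (slabSnd Z {0}ᶜ)

theorem pull_slabCircle_eq (he : IsFundamentalClass e) : ∃ s : ℤ, s * s = 1 ∧
    pull (slabCircle Z) 1 e = s • pull (slabSnd Z {0}ᶜ) 1 windingClass := by
  obtain ⟨s, hs, h⟩ := pull_toCircle_eq he
  exact ⟨s, hs, by rw [slabCircle, pull_comp, h, map_zsmul]⟩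

theorem exists_eq_slab (he : IsFundamentalClass e) (k : ℕ) (α : H (slab Z {0}ᶜ) (k + 1)) :
    ∃ (a : H Z (k + 1)) (b : H Z k), α = pull (slabFst Z {0}ᶜ) (k + 1) a +
      cupProduct rfl (pull (slabFst Z {0}ᶜ) k b) (pull (slabCircle Z) 1 e) := by
  obtain ⟨s, hs, h⟩ := pull_slabCircle_eq (Z := Z) he
  obtain ⟨a, b, rfl⟩ := exists_eq_windingClass k α
  refine ⟨a, s • b, ?_⟩
  rw [h, map_zsmul, map_zsmul, map_zsmul, AddMonoidHom.zsmul_apply, smul_smul, hs, one_smul]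

theorem eq_zero_of_slab (he : IsFundamentalClass e) (k : ℕ) {a : H Z (k + 1)} {b : H Z k}
    (h0 : pull (slabFst Z {0}ᶜ) (k + 1) a + cupProduct rfl (pull (slabFst Z {0}ᶜ) k b)
      (pull (slabCircle Z) 1 e) = 0) : a = 0 ∧ b = 0 := by
  obtain ⟨s, hs, h⟩ := pull_slabCircle_eq (Z := Z) he
  rw [h, map_zsmul, ← AddMonoidHom.zsmul_apply, ← map_zsmul, ← map_zsmul] at h0
  obtain ⟨ha, hb⟩ := eq_zero_of_windingClass k h0
  refine ⟨ha, ?_⟩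
  rw [← one_smul ℤ b, ← hs, mul_smul, hb, smul_zero]

theorem of_congr {X : Type} [TopologicalSpace X] {i j n n' : ℕ} (h : i + j = n) (h' : i + j = n')
    (a : H X i) (b : H X j) :
    DirectSum.of (H X) n (cupProduct h a b) = DirectSum.of (H X) n' (cupProduct h' a b) := by
  subst h h'
  rfl

theorem of_mul_of_eq {X : Type} [TopologicalSpace X] {i j n : ℕ} (h : i + j = n)
    (a : H X i) (b : H X j) : DirectSum.of (H X) i a * DirectSum.of (H X) j b =
      DirectSum.of (H X) n (cupProduct h a b) := by
  rw [DirectSum.of_mul_of]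
  exact of_congr rfl h a b

theorem exists_eq_circle (he : IsFundamentalClass e) (y : CohomologyRing Circle) :
    ∃ m n : ℤ, y = m • 1 + n • DirectSum.of (H Circle) 1 e := by
  induction y using DirectSum.induction_on with
  | zero => exact ⟨0, 0, by simp⟩
  | of k x =>
    match k, x with
    | 0, x =>
      obtain ⟨m, rfl⟩ := exists_eq_zsmul_one x
      exact ⟨m, 0, by rw [zero_smul, add_zero, map_zsmul]; rfl⟩
    | 1, x =>
      obtain ⟨n, rfl⟩ := he.2 x
      exact ⟨0, n, by simp⟩
    | k + 2, x =>
      rw [circle_eq_zero (by omega) x]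
      exact ⟨0, 0, by simp⟩
  | add x y hx hy =>
    obtain ⟨m, n, rfl⟩ := hx
    obtain ⟨m', n', rfl⟩ := hy
    exact ⟨m + m', n + n', by rw [add_smul, add_smul]; abel⟩

/-- Classes from `Z` and from `S¹` commute in the graded sense; only degrees at most `1` of `S¹`
matter, so graded commutativity for classes of degree one is enough. -/
theorem pullRing_mul_pullRing_of {i j : ℕ} (a : H Z i)
    (b : H Circle j) :
    pullRing (slabFst Z {0}ᶜ) (DirectSum.of (H Z) i a) *
        pullRing (slabCircle Z) (DirectSum.of (H Circle) j b) =
      (-1 : ℤˣ) ^ (j * i) • (pullRing (slabCircle Z) (DirectSum.of (H Circle) j b) *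
        pullRing (slabFst Z {0}ᶜ) (DirectSum.of (H Z) i a)) := by
  match j, b with
  | 0, b =>
    obtain ⟨m, rfl⟩ := exists_eq_zsmul_one b
    have : DirectSum.of (H Circle) 0 (m • cohomologyOne _) = m • 1 := by rw [map_zsmul]; rfl
    rw [this, zero_mul, pow_zero, one_smul, map_zsmul, map_one, mul_smul_comm, smul_mul_assoc,
      one_mul, mul_one]
  | 1, b =>
    rw [one_mul, pullRing_of, pullRing_of, of_mul_of_eq (n := i + 1) rfl,
      of_mul_of_eq (add_comm 1 i), cupProduct_comm_of_degree_one _ rfl, map_zsmul,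
      Units.smul_def, smul_smul, Units.val_pow_eq_pow_val, Units.val_neg, Units.val_one,
      ← mul_pow, neg_one_mul, neg_neg, one_pow, one_smul]
  | j + 2, b =>
    rw [circle_eq_zero (by omega) b, map_zero, map_zero, mul_zero, zero_mul, smul_zero]

theorem anticommute ⦃i j : ℕ⦄ (a : degreePart Z i)
    (b : degreePart Circle j) :
    pullRing (slabFst Z {0}ᶜ) a * pullRing (slabCircle Z) b =
      (-1 : ℤˣ) ^ (j * i) • (pullRing (slabCircle Z) b * pullRing (slabFst Z {0}ᶜ) a) := by
  obtain ⟨_, a, rfl⟩ := a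
  obtain ⟨_, b, rfl⟩ := b
  exact pullRing_mul_pullRing_of a b

variable (Z) in
/-- The homomorphism `H^*(Z) ⊗ H^*(S¹) → H^*(Z × ℂˣ)` given by the cross product. -/
noncomputable def kunnethHom :
    TensorRing Z →+* CohomologyRing (slab Z {0}ᶜ) :=
  (GradedTensorProduct.lift (degreePart Z) (degreePart Circle)
    (pullRing (slabFst Z {0}ᶜ)).toIntAlgHom (pullRing (slabCircle Z)).toIntAlgHom
    anticommute).toRingHom

theorem kunnethHom_tmul (a : CohomologyRing Z)
    (b : CohomologyRing Circle) : kunnethHom Z (a ᵍ⊗ₜ[ℤ] b) =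
      pullRing (slabFst Z {0}ᶜ) a * pullRing (slabCircle Z) b :=
  GradedTensorProduct.lift_tmul _ _ _ _ _ _ _

/-- `H^*(S¹)` is free on `1` and `e`, so each element of `H^*(Z) ⊗ H^*(S¹)` is `a ⊗ 1 + b ⊗ e`. -/
theorem exists_eq_tmul (he : IsFundamentalClass e) (t : TensorRing Z) :
    ∃ a b : CohomologyRing Z, t = a ᵍ⊗ₜ[ℤ] 1 + b ᵍ⊗ₜ[ℤ] (DirectSum.of (H Circle) 1 e) := by
  induction t using TensorProduct.induction_on with
  | zero =>
    refine ⟨0, 0, ?_⟩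
    simp only [GradedTensorProduct.tmul, zero_tmul, map_zero, add_zero]
    rfl
  | tmul x y =>
    obtain ⟨m, n, rfl⟩ := exists_eq_circle he y
    refine ⟨m • x, n • x, ?_⟩
    change (x ᵍ⊗ₜ[ℤ] _ : TensorRing Z) = _
    simp only [GradedTensorProduct.tmul, tmul_add, tmul_smul, smul_tmul', map_add]
  | add t t' ht ht' =>
    obtain ⟨a, b, rfl⟩ := ht
    obtain ⟨a', b', rfl⟩ := ht'
    refine ⟨a + a', b + b', ?_⟩
    simp only [GradedTensorProduct.tmul, add_tmul, map_add]
    abel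

theorem mul_of_one_succ {X : Type} [TopologicalSpace X] (b : CohomologyRing X) (x : H X 1) (k : ℕ) :
    (b * DirectSum.of (H X) 1 x) (k + 1) = cupProduct rfl (b k) x := by
  induction b using DirectSum.induction_on with
  | zero => simp
  | of i c =>
    rw [of_mul_of_eq (n := i + 1) rfl]
    by_cases h : i = k
    · subst h
      rw [DirectSum.of_eq_same, DirectSum.of_eq_same]
    · rw [DirectSum.of_eq_of_ne _ _ _ (by omega), DirectSum.of_eq_of_ne _ _ _ (Ne.symm h), map_zero,
        AddMonoidHom.zero_apply]
  | add b c hb hc =>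
    rw [add_mul, DirectSum.add_apply, hb, hc, DirectSum.add_apply, map_add, AddMonoidHom.add_apply]

theorem mul_of_one_zero {X : Type} [TopologicalSpace X] (b : CohomologyRing X) (x : H X 1) :
    (b * DirectSum.of (H X) 1 x) 0 = 0 := by
  induction b using DirectSum.induction_on with
  | zero => simp
  | of i c =>
    rw [of_mul_of_eq (n := i + 1) rfl, DirectSum.of_eq_of_ne _ _ _ (by omega)]
  | add b c hb hc => rw [add_mul, DirectSum.add_apply, hb, hc, add_zero]

theorem kunnethHom_tmul_add_apply_zero (a b : CohomologyRing Z) :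
    kunnethHom Z (a ᵍ⊗ₜ[ℤ] 1 + b ᵍ⊗ₜ[ℤ] (DirectSum.of (H Circle) 1 e)) 0 =
      pull (slabFst Z {0}ᶜ) 0 (a 0) := by
  rw [map_add, kunnethHom_tmul, kunnethHom_tmul, map_one, mul_one, pullRing_of,
    DirectSum.add_apply, mul_of_one_zero, pullRing_apply, add_zero]

theorem kunnethHom_tmul_add_apply_succ (a b : CohomologyRing Z)
    (k : ℕ) : kunnethHom Z (a ᵍ⊗ₜ[ℤ] 1 + b ᵍ⊗ₜ[ℤ] (DirectSum.of (H Circle) 1 e)) (k + 1) =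
      pull (slabFst Z {0}ᶜ) (k + 1) (a (k + 1)) +
        cupProduct rfl (pull (slabFst Z {0}ᶜ) k (b k)) (pull (slabCircle Z) 1 e) := by
  rw [map_add, kunnethHom_tmul, kunnethHom_tmul, map_one, mul_one, pullRing_of,
    DirectSum.add_apply, mul_of_one_succ, pullRing_apply, pullRing_apply]

theorem kunnethHom_injective (he : IsFundamentalClass e) :
    Function.Injective (kunnethHom Z) := by
  rw [injective_iff_map_eq_zero]
  intro t ht
  obtain ⟨a, b, rfl⟩ := exists_eq_tmul he t
  have h (k : ℕ) : a (k + 1) = 0 ∧ b k = 0 := by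
    apply eq_zero_of_slab he
    rw [← kunnethHom_tmul_add_apply_succ, ht, DirectSum.zero_apply]
  have h0 : a 0 = 0 := by
    apply pull_slabFst_plane_injective 0
    rw [← kunnethHom_tmul_add_apply_zero a b (e := e), ht, DirectSum.zero_apply, map_zero]
  have ha : a = 0 := DFinsupp.ext fun k => by
    cases k with
    | zero => exact h0
    | succ k => exact (h k).1
  have hb : b = 0 := DFinsupp.ext fun k => (h k).2
  simp only [ha, hb, GradedTensorProduct.tmul, zero_tmul, map_zero, add_zero]

theorem exists_kunnethHom_eq_zero (α : H (slab Z {0}ᶜ) 0) :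
    ∃ a : H Z 0, kunnethHom Z (DirectSum.of (H Z) 0 a ᵍ⊗ₜ[ℤ] 1) =
      DirectSum.of (H (slab Z {0}ᶜ)) 0 α := by
  obtain ⟨a, rfl⟩ := exists_eq_pull_slabFst_zero α
  exact ⟨a, by rw [kunnethHom_tmul, map_one, mul_one, pullRing_of]⟩

theorem kunnethHom_of_succ {k : ℕ} (a : H Z (k + 1)) (b : H Z k) :
    kunnethHom Z (DirectSum.of (H Z) (k + 1) a ᵍ⊗ₜ[ℤ] 1 +
        DirectSum.of (H Z) k b ᵍ⊗ₜ[ℤ] (DirectSum.of (H Circle) 1 e)) =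
      DirectSum.of (H (slab Z {0}ᶜ)) (k + 1) (pull (slabFst Z {0}ᶜ) (k + 1) a +
        cupProduct rfl (pull (slabFst Z {0}ᶜ) k b) (pull (slabCircle Z) 1 e)) := by
  rw [map_add, kunnethHom_tmul, kunnethHom_tmul, map_one, mul_one, pullRing_of, pullRing_of,
    pullRing_of, of_mul_of_eq (n := k + 1) rfl, map_add]

end KunnethRing

end SingularCohomology

namespace SingularCohomology

/-! ### The algebra of the reduced tensor ring -/

section ReducedRing

variable {Z : Type} [TopologicalSpace Z] {e : H Circle 1}

/-- A space `V` over `Z` that contains `Z × ℂˣ` and such that the cohomology of `V` consists of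
the classes of `Z × ℂˣ` without `1 ⊗ e` component, and a map `X → V` that is surjective in
cohomology with kernel spanned by a class coming from `ζ ∈ H^d(Z)`. In the application `V` is an open
neighbourhood of `Z × ℂˣ` and `X` is the boundary of the thickening. -/
structure IsReduction {V X : Type} [TopologicalSpace V] [TopologicalSpace X] {d : ℕ} (ζ : H Z d)
    (e : H Circle 1) (q : C(V, Z)) (j : C(slab Z {0}ᶜ, V)) (i : C(X, V)) : Prop where
  comp_eq : q.comp j = slabFst Z {0}ᶜ
  injective (k : ℕ) : Function.Injective (pull j k)
  exists_eq (k : ℕ) (b : H Z (k + 1)) : ∃ v : H V (k + 1 + 1), pull j (k + 1 + 1) v =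
    cupProduct rfl (pull (slabFst Z {0}ᶜ) (k + 1) b) (pull (slabCircle Z) 1 e)
  eq_zero (v : H V 1) (a : H Z 1) (b : H Z 0) (h : pull j 1 v = pull (slabFst Z {0}ᶜ) 1 a +
    cupProduct rfl (pull (slabFst Z {0}ᶜ) 0 b) (pull (slabCircle Z) 1 e)) : b = 0
  surjective (k : ℕ) : Function.Surjective (pull i k)
  pull_eq_zero : pull i d (pull q d ζ) = 0
  exists_eq_zsmul (k : ℕ) (v : H V k) (h : pull i k v = 0) :
    ∃ m : ℤ, DirectSum.of (H V) k v = m • DirectSum.of (H V) d (pull q d ζ)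

theorem add_gradedTmul (a b : CohomologyRing Z) (c : CohomologyRing Circle) :
    ((a + b) ᵍ⊗ₜ[ℤ] c : TensorRing Z) = a ᵍ⊗ₜ[ℤ] c + b ᵍ⊗ₜ[ℤ] c := by
  simp only [GradedTensorProduct.tmul, add_tmul, map_add]

theorem gradedTmul_of_zsmul {k l : ℕ} (m : ℤ) (a : H Z k) (c : H Circle l) :
    (DirectSum.of (H Z) k a ᵍ⊗ₜ[ℤ] DirectSum.of (H Circle) l (m • c) : TensorRing Z) =
      DirectSum.of (H Z) k (m • a) ᵍ⊗ₜ[ℤ] DirectSum.of (H Circle) l c := by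
  rw [map_zsmul, map_zsmul, GradedTensorProduct.tmul, GradedTensorProduct.tmul, smul_tmul]

namespace IsReduction

variable {V X : Type} [TopologicalSpace V] [TopologicalSpace X] {d : ℕ} {ζ : H Z d}
  {q : C(V, Z)} {j : C(slab Z {0}ᶜ, V)} {i : C(X, V)}

theorem pullRing_injective (h : IsReduction ζ e q j i) : Function.Injective (pullRing j) := by
  intro x y hxy
  refine DFinsupp.ext fun k => h.injective k ?_
  rw [← pullRing_apply, ← pullRing_apply, hxy]

theorem pullRing_slabFst (h : IsReduction ζ e q j i) (a : CohomologyRing Z) :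
    pullRing (slabFst Z {0}ᶜ) a = pullRing j (pullRing q a) := by
  rw [← h.comp_eq, pullRing_comp]

theorem kunnethHom_mem_range (h : IsReduction ζ e q j i) (t : omitSubring Z e) :
    kunnethHom Z (t : TensorRing Z) ∈ (pullRing j).range := by
  have : omitSubring Z e ≤ (pullRing j).range.comap (kunnethHom Z) := by
    rw [omitSubring, Subring.closure_le]
    rintro _ (⟨a, rfl⟩ | ⟨k, hk, _, ⟨a, rfl⟩, rfl⟩)
    · refine ⟨pullRing q a, ?_⟩
      rw [← h.pullRing_slabFst, kunnethHom_tmul, map_one, mul_one]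
    · obtain ⟨k, rfl⟩ := Nat.exists_eq_succ_of_ne_zero hk.ne'
      obtain ⟨v, hv⟩ := h.exists_eq k a
      refine ⟨DirectSum.of (H V) (k + 1 + 1) v, ?_⟩
      change _ = kunnethHom Z (DirectSum.of (H Z) (k + 1) a ᵍ⊗ₜ[ℤ] _)
      rw [pullRing_of, hv, kunnethHom_tmul, pullRing_of, pullRing_of, of_mul_of_eq rfl]
  exact this t.2

/-- The class of `V` that restricts to the cross product `t`. -/
noncomputable def lift (h : IsReduction ζ e q j i) : omitSubring Z e →+* CohomologyRing V :=
  (RingEquiv.ofBijective (pullRing j).rangeRestrict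
    ⟨fun _ _ hxy => h.pullRing_injective (congrArg Subtype.val hxy),
      (pullRing j).rangeRestrict_surjective⟩).symm.toRingHom.comp
    (((kunnethHom Z).comp (omitSubring Z e).subtype).codRestrict (pullRing j).range
      h.kunnethHom_mem_range)

theorem pullRing_lift (h : IsReduction ζ e q j i) (t : omitSubring Z e) :
    pullRing j (h.lift t) = kunnethHom Z (t : TensorRing Z) :=
  congrArg Subtype.val (RingEquiv.apply_symm_apply (RingEquiv.ofBijective
    (pullRing j).rangeRestrict ⟨fun _ _ hxy => h.pullRing_injective (congrArg Subtype.val hxy),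
      (pullRing j).rangeRestrict_surjective⟩) _)

theorem lift_injective (h : IsReduction ζ e q j i) (he : IsFundamentalClass e) :
    Function.Injective h.lift := by
  intro s t hst
  apply Subtype.ext
  apply kunnethHom_injective he
  rw [← h.pullRing_lift, hst, h.pullRing_lift]

theorem tmul_one_mem (a : CohomologyRing Z) : (a ᵍ⊗ₜ[ℤ] 1 : TensorRing Z) ∈ omitSubring Z e :=
  Subring.subset_closure (Or.inl ⟨a, rfl⟩)

theorem tmul_of_mem {k : ℕ} (a : H Z (k + 1)) : (DirectSum.of (H Z) (k + 1) a ᵍ⊗ₜ[ℤ]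
    (DirectSum.of (H Circle) 1 e) : TensorRing Z) ∈ omitSubring Z e :=
  Subring.subset_closure (Or.inr ⟨k + 1, by omega, _, of_mem_degreePart a, rfl⟩)

theorem lift_tmul_one (h : IsReduction ζ e q j i) (a : CohomologyRing Z) :
    h.lift ⟨_, tmul_one_mem a⟩ = pullRing q a := by
  apply h.pullRing_injective
  rw [h.pullRing_lift, ← h.pullRing_slabFst, kunnethHom_tmul, map_one, mul_one]

/-- Each class of `V` of degree `k` comes from an element of degree `k` of `omitSubring`. -/
theorem exists_lift_eq (h : IsReduction ζ e q j i) (he : IsFundamentalClass e) (k : ℕ) (v : H V k) :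
    ∃ t : omitSubring Z e, (t : TensorRing Z) ∈ tensorDegreePart Z k ∧
      h.lift t = DirectSum.of (H V) k v := by
  have hone : (1 : CohomologyRing Circle) ∈ degreePart Circle 0 := ⟨cohomologyOne _, rfl⟩
  cases k with
  | zero =>
    obtain ⟨a, ha⟩ := exists_kunnethHom_eq_zero (pull j 0 v)
    refine ⟨⟨_, tmul_one_mem (DirectSum.of (H Z) 0 a)⟩,
      AddSubgroup.subset_closure ⟨0, 0, rfl, _, of_mem_degreePart a, _, hone, rfl⟩, ?_⟩
    apply h.pullRing_injective
    rw [h.pullRing_lift, ha, pullRing_of]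
  | succ k =>
    obtain ⟨a, b, hab⟩ := exists_eq_slab he k (pull j (k + 1) v)
    have hb : (DirectSum.of (H Z) k b ᵍ⊗ₜ[ℤ] (DirectSum.of (H Circle) 1 e) : TensorRing Z) ∈
        omitSubring Z e := by
      cases k with
      | zero =>
        rw [h.eq_zero v a b hab, map_zero, GradedTensorProduct.tmul, zero_tmul, map_zero]
        exact zero_mem _
      | succ k => exact tmul_of_mem b
    refine ⟨⟨_, add_mem (tmul_one_mem (DirectSum.of (H Z) (k + 1) a)) hb⟩, add_mem
      (AddSubgroup.subset_closure ⟨k + 1, 0, rfl, _, of_mem_degreePart a, _, hone, rfl⟩)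
      (AddSubgroup.subset_closure ⟨k, 1, rfl, _, of_mem_degreePart b, _, of_mem_degreePart e,
        rfl⟩), ?_⟩
    apply h.pullRing_injective
    rw [h.pullRing_lift, pullRing_of, hab]
    exact kunnethHom_of_succ a b

/-- The homomorphism from `omitSubring` to the cohomology ring of `X`. -/
noncomputable def toRing (h : IsReduction ζ e q j i) : omitSubring Z e →+* CohomologyRing X :=
  (pullRing i).comp h.lift

theorem exists_toRing_eq (h : IsReduction ζ e q j i) (he : IsFundamentalClass e) (k : ℕ)
    (x : H X k) : ∃ t : omitSubring Z e, (t : TensorRing Z) ∈ tensorDegreePart Z k ∧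
      h.toRing t = DirectSum.of (H X) k x := by
  obtain ⟨v, rfl⟩ := h.surjective k x
  obtain ⟨t, ht, hv⟩ := h.exists_lift_eq he k v
  exact ⟨t, ht, by rw [toRing, RingHom.comp_apply, hv, pullRing_of]⟩

theorem toRing_surjective (h : IsReduction ζ e q j i) (he : IsFundamentalClass e) :
    Function.Surjective h.toRing := by
  intro x
  induction x using DirectSum.induction_on with
  | zero => exact ⟨0, map_zero _⟩
  | of k x =>
    obtain ⟨t, -, ht⟩ := h.exists_toRing_eq he k x
    exact ⟨t, ht⟩
  | add x y hx hy =>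
    obtain ⟨s, rfl⟩ := hx
    obtain ⟨t, rfl⟩ := hy
    exact ⟨s + t, map_add _ _ _⟩

theorem toRing_classInSubring (h : IsReduction ζ e q j i) : h.toRing (classInSubring ζ e) = 0 := by
  rw [toRing, RingHom.comp_apply]
  refine (congrArg (pullRing i) (h.lift_tmul_one _)).trans ?_
  rw [pullRing_of, pullRing_of, h.pull_eq_zero, map_zero]

/-- The kernel of `toRing` is spanned, even additively, by the class `ζ ⊗ 1`. -/
theorem toRing_eq_zero_iff (h : IsReduction ζ e q j i) (he : IsFundamentalClass e)
    (t : omitSubring Z e) : h.toRing t = 0 ↔ ∃ m : ℤ, t = m • classInSubring ζ e := by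
  constructor
  · intro ht
    have key (v : CohomologyRing V) (hv : pullRing i v = 0) :
        ∃ m : ℤ, v = m • DirectSum.of (H V) d (pull q d ζ) := by
      classical
      have hk (k : ℕ) : ∃ m : ℤ, DirectSum.of (H V) k (v k) =
          m • DirectSum.of (H V) d (pull q d ζ) :=
        h.exists_eq_zsmul k (v k) (by rw [← pullRing_apply, hv, DirectSum.zero_apply])
      choose m hm using hk
      refine ⟨∑ k ∈ DFinsupp.support v, m k, ?_⟩
      rw [Finset.sum_smul, ← Finset.sum_congr rfl fun k _ => hm k]
      exact (DirectSum.sum_support_of v).symm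
    obtain ⟨m, hm⟩ := key (h.lift t) ht
    refine ⟨m, h.lift_injective he ?_⟩
    rw [hm, map_zsmul]
    congr 1
    refine Eq.trans ?_ (h.lift_tmul_one _).symm
    rw [pullRing_of]
  · rintro ⟨m, rfl⟩
    rw [map_zsmul, h.toRing_classInSubring, smul_zero]

/-- The multiples of `ζ ⊗ 1` are the kernel of a ring homomorphism, hence already a two-sided ideal. -/
theorem ker_toRing (h : IsReduction ζ e q j i) (he : IsFundamentalClass e) :
    RingHom.ker h.toRing = classIdeal ζ e := by
  ext t
  rw [RingHom.mem_ker]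
  constructor
  · rw [h.toRing_eq_zero_iff he]
    rintro ⟨m, rfl⟩
    rw [← Int.cast_smul_eq_zsmul (omitSubring Z e)]
    exact Ideal.mul_mem_left _ _ (TwoSidedIdeal.mem_asIdeal.2
      (TwoSidedIdeal.subset_span (Set.mem_singleton _)))
  · intro ht
    have : TwoSidedIdeal.span {classInSubring ζ e} ≤ TwoSidedIdeal.ker h.toRing := by
      rw [TwoSidedIdeal.span_le, Set.singleton_subset_iff]
      exact (TwoSidedIdeal.mem_ker _).2 h.toRing_classInSubring
    exact (TwoSidedIdeal.mem_ker _).1 (this (TwoSidedIdeal.mem_asIdeal.1 ht))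

/-- The inclusion of `omitSubring`, followed by the projection to the quotient by the two
classes. -/
noncomputable def toModClasses (ζ : H Z d) (e : H Circle 1) :
    omitSubring Z e →+ TensorModClasses ζ e :=
  (QuotientAddGroup.mk' _).comp (omitSubring Z e).subtype.toAddMonoidHom

theorem zsmul_oneTensorCircle (m : ℤ) : m • oneTensorCircle (Z := Z) e =
    DirectSum.of (H Z) 0 (m • cohomologyOne _) ᵍ⊗ₜ[ℤ] (DirectSum.of (H Circle) 1 e) := by
  rw [map_zsmul, GradedTensorProduct.tmul, ← smul_tmul', map_zsmul]
  rfl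

theorem toModClasses_eq_zero_iff (h : IsReduction ζ e q j i) (t : omitSubring Z e) :
    toModClasses ζ e t = 0 ↔ ∃ m : ℤ, t = m • classInSubring ζ e := by
  refine (QuotientAddGroup.eq_zero_iff _).trans ?_
  rw [AddSubgroup.mem_closure_pair]
  constructor
  · rintro ⟨x, y, hxy⟩
    have hx : x • oneTensorCircle (Z := Z) e = 0 := by
      obtain ⟨v, hv⟩ := h.kunnethHom_mem_range (t - y • classInSubring ζ e)
      have ht : ((t - y • classInSubring ζ e : omitSubring Z e) : TensorRing Z) =
          x • oneTensorCircle e := by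
        rw [AddSubgroupClass.coe_sub, sub_eq_iff_eq_add]
        exact hxy.symm
      rw [ht, zsmul_oneTensorCircle] at hv
      have := DFunLike.congr_fun hv 1
      rw [pullRing_apply, kunnethHom_tmul, pullRing_of, pullRing_of,
        of_mul_of_eq (n := 1) rfl, DirectSum.of_eq_same] at this
      rw [zsmul_oneTensorCircle, h.eq_zero (v 1) 0 (x • cohomologyOne _)
        (by rw [map_zero, zero_add, this]), map_zero, GradedTensorProduct.tmul, zero_tmul, map_zero]
    refine ⟨y, Subtype.ext ?_⟩
    rw [hx, zero_add] at hxy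
    exact hxy.symm
  · rintro ⟨m, rfl⟩
    exact ⟨0, m, by rw [zero_smul, zero_add]; rfl⟩

theorem mk_oneTensorCircle (m : ℤ) :
    (QuotientAddGroup.mk (m • oneTensorCircle e) : TensorModClasses ζ e) = 0 :=
  (QuotientAddGroup.eq_zero_iff _).2
    (zsmul_mem (AddSubgroup.subset_closure (Set.mem_insert _ _)) m)

/-- Modulo `1 ⊗ e` the coefficient of `e` may be taken without component of degree `0`, as
`H⁰(Z) = ℤ`. -/
theorem exists_mk_tmul_eq [PathConnectedSpace Z] (b : CohomologyRing Z) :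
    ∃ t : omitSubring Z e, toModClasses ζ e t =
      QuotientAddGroup.mk (b ᵍ⊗ₜ[ℤ] (DirectSum.of (H Circle) 1 e)) := by
  induction b using DirectSum.induction_on with
  | zero =>
    refine ⟨0, ?_⟩
    rw [map_zero, GradedTensorProduct.tmul, zero_tmul, map_zero]
    rfl
  | of k b =>
    cases k with
    | zero =>
      obtain ⟨m, rfl⟩ := exists_eq_zsmul_one b
      exact ⟨0, by rw [map_zero, ← zsmul_oneTensorCircle, mk_oneTensorCircle]⟩
    | succ k => exact ⟨⟨_, tmul_of_mem b⟩, rfl⟩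
  | add b c hb hc =>
    obtain ⟨s, hs⟩ := hb
    obtain ⟨t, ht⟩ := hc
    refine ⟨s + t, ?_⟩
    rw [map_add, hs, ht, add_gradedTmul]
    rfl

theorem toModClasses_surjective [PathConnectedSpace Z] (he : IsFundamentalClass e) :
    Function.Surjective (toModClasses ζ e) := by
  intro y
  obtain ⟨t, rfl⟩ := QuotientAddGroup.mk_surjective y
  obtain ⟨a, b, rfl⟩ := exists_eq_tmul he t
  obtain ⟨s, hs⟩ := exists_mk_tmul_eq (ζ := ζ) (e := e) b
  refine ⟨⟨_, tmul_one_mem a⟩ + s, ?_⟩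
  rw [map_add, hs]
  rfl

/-- Modulo the two classes, homogeneous elements have representatives whose image in the
cohomology of `X` is homogeneous. -/
theorem exists_toRing_mem (h : IsReduction ζ e q j i) [PathConnectedSpace Z]
    (he : IsFundamentalClass e) {k : ℕ} {t : TensorRing Z} (ht : t ∈ tensorDegreePart Z k) :
    ∃ s : omitSubring Z e, toModClasses ζ e s = QuotientAddGroup.mk t ∧
      h.toRing s ∈ degreePart X k := by
  rw [tensorDegreePart] at ht
  induction ht using AddSubgroup.closure_induction with
  | mem t ht =>
    obtain ⟨k₁, k₂, rfl, _, ⟨a, rfl⟩, _, ⟨b, rfl⟩, rfl⟩ := ht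
    match k₂, b with
    | 0, b =>
      obtain ⟨m, rfl⟩ := exists_eq_zsmul_one b
      refine ⟨⟨_, tmul_one_mem (DirectSum.of (H Z) k₁ (m • a))⟩, ?_, ?_⟩
      · change QuotientAddGroup.mk _ = QuotientAddGroup.mk _
        congr 1
        exact (gradedTmul_of_zsmul m a _).symm
      · rw [toRing, RingHom.comp_apply, h.lift_tmul_one, pullRing_of, pullRing_of]
        exact of_mem_degreePart _
    | 1, b =>
      obtain ⟨m, rfl⟩ := he.2 b
      match k₁, a with
      | 0, a =>
        obtain ⟨l, rfl⟩ := exists_eq_zsmul_one a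
        refine ⟨0, ?_, by rw [map_zero]; exact zero_mem _⟩
        -- in degree `0` this is a multiple of `1 ⊗ e`, which vanishes in the quotient
        rw [map_zero, ← mk_oneTensorCircle (l * m)]
        congr 1
        rw [zsmul_oneTensorCircle, mul_comm, mul_smul]
        exact (gradedTmul_of_zsmul m (l • cohomologyOne _) e).symm
      | k₁ + 1, a =>
        refine ⟨⟨_, tmul_of_mem (m • a)⟩, ?_, ?_⟩
        · change QuotientAddGroup.mk _ = QuotientAddGroup.mk _
          congr 1
          exact (gradedTmul_of_zsmul m a e).symm
        · obtain ⟨v, hv⟩ := h.exists_eq k₁ (m • a)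
          have : h.lift ⟨_, tmul_of_mem (m • a)⟩ = DirectSum.of (H V) (k₁ + 1 + 1) v := by
            apply h.pullRing_injective
            rw [h.pullRing_lift, pullRing_of, hv, kunnethHom_tmul, pullRing_of, pullRing_of,
              of_mul_of_eq rfl]
          rw [toRing, RingHom.comp_apply, this, pullRing_of]
          exact of_mem_degreePart _
    | k₂ + 2, b =>
      refine ⟨0, ?_, by rw [map_zero]; exact zero_mem _⟩
      rw [circle_eq_zero (by omega) b, map_zero, map_zero, GradedTensorProduct.tmul, tmul_zero,
        map_zero]
      rfl
  | zero => exact ⟨0, map_zero _, by rw [map_zero]; exact zero_mem _⟩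
  | add t t' _ _ hs hs' =>
    obtain ⟨s, hs, hd⟩ := hs
    obtain ⟨s', hs', hd'⟩ := hs'
    exact ⟨s + s', by rw [map_add, hs, hs']; rfl, by rw [map_add]; exact add_mem hd hd'⟩
  | neg t _ hs =>
    obtain ⟨s, hs, hd⟩ := hs
    exact ⟨-s, by rw [map_neg, hs]; rfl, by rw [map_neg]; exact neg_mem hd⟩

/-- The cohomology ring of `X` is the reduced tensor ring: `toRing` and `toModClasses` are surjective
homomorphisms on `omitSubring` with the same kernel, the multiples of `ζ ⊗ 1`. -/
theorem exists_ringEquiv (h : IsReduction ζ e q j i) [PathConnectedSpace Z]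
    (he : IsFundamentalClass e) :
    ∃ (Φ : CohomologyRing X ≃+* ReducedTensorRing ζ e)
        (Ψ : CohomologyRing X ≃+ TensorModClasses ζ e),
      (∀ (y : CohomologyRing X) (t : omitSubring _ e),
        Φ y = Ideal.Quotient.mk (classIdeal ζ e) t → Ψ y = QuotientAddGroup.mk (t : TensorRing _)) ∧
      ∀ (k : ℕ) (y : CohomologyRing X), y ∈ degreePart X k ↔
          ∃ t ∈ tensorDegreePart Z k, Ψ y = QuotientAddGroup.mk t := by
  let Φ := ((Ideal.quotEquivOfEq (h.ker_toRing he)).symm.trans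
    (RingHom.quotientKerEquivOfSurjective (h.toRing_surjective he))).symm
  have hΦ (t : omitSubring Z e) : Φ (h.toRing t) = Ideal.Quotient.mk _ t := by
    rw [RingEquiv.symm_apply_eq]
    rfl
  have hker : h.toRing.toAddMonoidHom.ker = (toModClasses ζ e).ker := by
    ext t
    exact (h.toRing_eq_zero_iff he t).trans (h.toModClasses_eq_zero_iff t).symm
  let Ψ := (QuotientAddGroup.quotientKerEquivOfSurjective h.toRing.toAddMonoidHom
    (h.toRing_surjective he)).symm.trans ((QuotientAddGroup.quotientAddEquivOfEq hker).trans
    (QuotientAddGroup.quotientKerEquivOfSurjective _ (toModClasses_surjective (ζ := ζ) he)))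
  have hΨ (t : omitSubring Z e) : Ψ (h.toRing t) = toModClasses ζ e t := by
    have : (QuotientAddGroup.quotientKerEquivOfSurjective h.toRing.toAddMonoidHom
        (h.toRing_surjective he)).symm (h.toRing t) = QuotientAddGroup.mk t := by
      rw [AddEquiv.symm_apply_eq]
      rfl
    rw [AddEquiv.trans_apply, this]
    rfl
  refine ⟨Φ, Ψ, fun y t hy => ?_, fun k y => ⟨?_, ?_⟩⟩
  · rw [← hΦ, Φ.injective.eq_iff] at hy
    rw [hy, hΨ]
    rfl
  · rintro ⟨x, rfl⟩
    obtain ⟨t, ht, hx⟩ := h.exists_toRing_eq he k x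
    exact ⟨t, ht, by rw [← hx, hΨ]; rfl⟩
  · rintro ⟨t, ht, hy⟩
    obtain ⟨s, hs, hd⟩ := h.exists_toRing_mem he ht
    rw [← hs, ← hΨ, Ψ.injective.eq_iff] at hy
    rwa [hy]

end IsReduction

end ReducedRing

end SingularCohomology

/-! ### Height functions of an embedded disc -/

section Disc

open Metric Topology

variable {Z : Type} {d : ℕ} {φ : EuclideanSpace ℝ (Fin d) → Z}

/-- The function on `Z` that is `max 0 (2 - ‖x‖)` at `φ x` and vanishes off the image of `φ`. -/
noncomputable def discHeight (φ : EuclideanSpace ℝ (Fin d) → Z) : Z → ℝ :=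
  Function.extend φ (fun x => max 0 (2 - ‖x‖)) 0

theorem discHeight_apply (hφ : Function.Injective φ) (x : EuclideanSpace ℝ (Fin d)) :
    discHeight φ (φ x) = max 0 (2 - ‖x‖) :=
  hφ.extend_apply _ _ _

theorem discHeight_of_notMem {z : Z} (hz : z ∉ Set.range φ) : discHeight φ z = 0 :=
  Function.extend_apply' _ _ _ hz

theorem continuous_discHeight [TopologicalSpace Z] [T2Space Z] (hφ : IsOpenEmbedding φ) : Continuous (discHeight φ) := by
  rw [continuous_iff_continuousAt]
  intro z
  by_cases hz : z ∈ Set.range φ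
  · obtain ⟨x, rfl⟩ := hz
    rw [← hφ.continuousAt_iff]
    have : discHeight φ ∘ φ = fun x => max 0 (2 - ‖x‖) :=
      funext (discHeight_apply hφ.injective)
    rw [this]
    fun_prop
  · have hc : IsClosed (φ '' closedBall 0 2) :=
      ((isCompact_closedBall _ _).image hφ.continuous).isClosed
    have hz' : (φ '' closedBall 0 2)ᶜ ∈ 𝓝 z :=
      hc.isOpen_compl.mem_nhds fun h => hz (Set.image_subset_range _ _ h)
    refine (continuousAt_const (y := (0 : ℝ))).congr ?_
    filter_upwards [hz'] with y hy
    by_cases hy' : y ∈ Set.range φ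
    · obtain ⟨x, rfl⟩ := hy'
      rw [discHeight_apply hφ.injective, max_eq_left]
      by_contra! h
      exact hy ⟨x, by rw [mem_closedBall_zero_iff]; linarith, rfl⟩
    · exact (discHeight_of_notMem hy').symm

theorem discHeight_nonneg (hφ : Function.Injective φ) (z : Z) : 0 ≤ discHeight φ z := by
  by_cases hz : z ∈ Set.range φ
  · obtain ⟨x, rfl⟩ := hz
    rw [discHeight_apply hφ]
    exact le_max_left _ _
  · rw [discHeight_of_notMem hz]

theorem discHeight_pos_iff (hφ : Function.Injective φ) {z : Z} :
    0 < discHeight φ z ↔ ∃ x, ‖x‖ < 2 ∧ φ x = z := by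
  constructor
  · intro h
    by_cases hz : z ∈ Set.range φ
    · obtain ⟨x, rfl⟩ := hz
      rw [discHeight_apply hφ, lt_max_iff] at h
      exact ⟨x, by linarith [h.resolve_left (lt_irrefl _)], rfl⟩
    · rw [discHeight_of_notMem hz] at h
      exact absurd h (lt_irrefl _)
  · rintro ⟨x, hx, rfl⟩
    rw [discHeight_apply hφ, lt_max_iff]
    exact Or.inr (by linarith)

theorem discHeight_lt_two_iff (hφ : Function.Injective φ) {z : Z} :
    discHeight φ z < 2 ↔ z ≠ φ 0 := by
  by_cases hz : z ∈ Set.range φ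
  · obtain ⟨x, rfl⟩ := hz
    rw [discHeight_apply hφ, max_lt_iff, hφ.ne_iff, ← norm_pos_iff]
    constructor
    · rintro ⟨-, h⟩; linarith
    · intro h; exact ⟨two_pos, by linarith⟩
  · rw [discHeight_of_notMem hz]
    exact ⟨fun _ h => hz ⟨0, h.symm⟩, fun _ => two_pos⟩

theorem notMem_image_ball_iff (hφ : Function.Injective φ) {z : Z} :
    z ∉ φ '' ball 0 1 ↔ discHeight φ z ≤ 1 := by
  by_cases hz : z ∈ Set.range φ
  · obtain ⟨x, rfl⟩ := hz
    rw [discHeight_apply hφ, hφ.mem_set_image, mem_ball_zero_iff, max_le_iff]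
    constructor
    · intro h; exact ⟨zero_le_one, by linarith⟩
    · rintro ⟨-, h⟩; linarith
  · rw [discHeight_of_notMem hz]
    exact ⟨fun _ => zero_le_one, fun _ h => hz (Set.image_subset_range _ _ h)⟩

theorem mem_image_sphere_iff (hφ : Function.Injective φ) {z : Z} :
    z ∈ φ '' sphere 0 1 ↔ discHeight φ z = 1 := by
  by_cases hz : z ∈ Set.range φ
  · obtain ⟨x, rfl⟩ := hz
    rw [discHeight_apply hφ, hφ.mem_set_image, mem_sphere_zero_iff_norm]
    constructor
    · intro h; rw [h]; norm_num
    · intro h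
      rcases max_choice 0 (2 - ‖x‖) with h' | h' <;> rw [h'] at h
      · norm_num at h
      · linarith
  · rw [discHeight_of_notMem hz]
    exact ⟨fun h => absurd (Set.image_subset_range _ _ h) hz, fun h => by norm_num at h⟩

/-- The maximum of the height of the disc and the norm of the second coordinate. -/
noncomputable def totalHeight (φ : EuclideanSpace ℝ (Fin d) → Z) (p : Z × ℂ) : ℝ :=
  max (discHeight φ p.1) ‖p.2‖

theorem continuous_totalHeight [TopologicalSpace Z] [T2Space Z] (hφ : IsOpenEmbedding φ) :
    Continuous (totalHeight φ) := by
  have := continuous_discHeight hφ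
  unfold totalHeight
  fun_prop

/-- The boundary of the thickening is a level set of a continuous function, which makes the radial
deformation onto it explicit. -/
theorem mem_thickeningBoundary_iff [TopologicalSpace Z] [T2Space Z] (hφ : IsOpenEmbedding φ)
    (hd : d ≠ 0) {p : Z × ℂ} :
    p ∈ thickeningBoundary φ ↔ totalHeight φ p = 1 := by
  have : Nonempty (Fin d) := ⟨⟨0, Nat.pos_of_ne_zero hd⟩⟩
  have hc : IsClosed (φ '' closedBall 0 1) :=
    ((isCompact_closedBall _ _).image hφ.continuous).isClosed
  have ho : IsOpen (φ '' ball 0 1) := hφ.isOpenMap _ isOpen_ball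
  have hf : frontier (φ '' ball 0 1)ᶜ = φ '' sphere 0 1 := by
    rw [frontier_compl, ho.frontier_eq, ← closedBall_sdiff_ball, Set.image_sdiff hφ.injective]
    congr 1
    apply subset_antisymm
    · exact closure_minimal (Set.image_mono ball_subset_closedBall) hc
    · rw [← closure_ball _ one_ne_zero]
      exact image_closure_subset_closure_image hφ.continuous
  rw [thickeningBoundary, frontier_prod_eq, hf, ho.isClosed_compl.closure_eq,
    frontier_closedBall _ one_ne_zero, isClosed_closedBall.closure_eq, totalHeight]
  simp only [Set.mem_union, Set.mem_prod, mem_sphere_zero_iff_norm, mem_closedBall_zero_iff,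
    mem_image_sphere_iff hφ.injective, Set.mem_compl_iff, notMem_image_ball_iff hφ.injective]
  constructor
  · rintro (⟨h, h'⟩ | ⟨h, h'⟩)
    · rw [h', max_eq_right h]
    · rw [h, max_eq_left h']
  · intro h
    rcases max_choice (discHeight φ p.1) ‖p.2‖ with h' | h' <;> rw [h'] at h
    · exact Or.inr ⟨h, by rw [← h]; exact max_eq_left_iff.1 h'⟩
    · exact Or.inl ⟨by rw [← h]; exact max_eq_right_iff.1 h', h⟩

/-- The map that moves `φ x`, for `x ≠ 0`, along the ray of `x` until the height of the disc is
multiplied by `1 - c`; it fixes the points of height `0`. -/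
noncomputable def radialPush (φ : EuclideanSpace ℝ (Fin d) → Z) (c : ℝ) : Z → Z :=
  Function.extend φ (fun x => φ ((1 + c * max 0 (2 - ‖x‖) / ‖x‖) • x)) id

theorem radialPush_apply (hφ : Function.Injective φ) (c : ℝ) (x : EuclideanSpace ℝ (Fin d)) :
    radialPush φ c (φ x) = φ ((1 + c * max 0 (2 - ‖x‖) / ‖x‖) • x) :=
  hφ.extend_apply _ _ _

theorem radialPush_of_notMem {z : Z} (c : ℝ) (hz : z ∉ Set.range φ) : radialPush φ c z = z :=
  Function.extend_apply' _ _ _ hz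

theorem radialPush_of_discHeight_eq_zero (hφ : Function.Injective φ) {z : Z} (c : ℝ)
    (hz : discHeight φ z = 0) : radialPush φ c z = z := by
  by_cases h : z ∈ Set.range φ
  · obtain ⟨x, rfl⟩ := h
    rw [discHeight_apply hφ] at hz
    rw [radialPush_apply hφ, hz]
    simp
  · exact radialPush_of_notMem c h

theorem radialPush_zero (hφ : Function.Injective φ) (z : Z) : radialPush φ 0 z = z := by
  by_cases h : z ∈ Set.range φ
  · obtain ⟨x, rfl⟩ := h
    rw [radialPush_apply hφ]
    simp
  · exact radialPush_of_notMem 0 h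

theorem discHeight_radialPush (hφ : Function.Injective φ) {z : Z} (hz : z ≠ φ 0) {c : ℝ}
    (hc : c ≤ 1) (hc' : (c - 1) * discHeight φ z > -2) :
    discHeight φ (radialPush φ c z) = (1 - c) * discHeight φ z := by
  by_cases h : z ∈ Set.range φ
  · obtain ⟨x, rfl⟩ := h
    have hx : 0 < ‖x‖ := norm_pos_iff.2 fun h => hz (by rw [h])
    rw [discHeight_apply hφ] at hc'
    rw [radialPush_apply hφ, discHeight_apply hφ, discHeight_apply hφ, norm_smul, Real.norm_eq_abs]
    rcases le_total 2 ‖x‖ with h2 | h2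
    · have hm : max 0 (2 - ‖x‖) = 0 := max_eq_left (by linarith)
      simp [h2]
    · have hm : max 0 (2 - ‖x‖) = 2 - ‖x‖ := max_eq_right (by linarith)
      rw [hm] at hc' ⊢
      have e : |1 + c * (2 - ‖x‖) / ‖x‖| * ‖x‖ = ‖x‖ + c * (2 - ‖x‖) := by
        rw [← abs_of_pos hx, ← abs_mul, abs_of_pos hx, add_mul, one_mul,
          div_mul_cancel₀ _ hx.ne', abs_of_nonneg]
        nlinarith
      rw [e, max_eq_right (by nlinarith)]
      ring
  · rw [radialPush_of_notMem c h, discHeight_of_notMem h, mul_zero]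

theorem continuousAt_radialPush [TopologicalSpace Z] [T2Space Z] (hφ : IsOpenEmbedding φ) {z : Z} (hz : z ≠ φ 0)
    (c : ℝ) : ContinuousAt (fun p : ℝ × Z => radialPush φ p.1 p.2) (c, z) := by
  by_cases h : z ∈ Set.range φ
  · obtain ⟨x, rfl⟩ := h
    have hx : ‖x‖ ≠ 0 := norm_ne_zero_iff.2 fun h => hz (by rw [h])
    change ContinuousAt _ (Prod.map id φ (c, x))
    rw [← (IsOpenEmbedding.id.prodMap hφ).continuousAt_iff]
    have : (fun p : ℝ × Z => radialPush φ p.1 p.2) ∘ Prod.map id φ =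
        fun p => φ ((1 + p.1 * max 0 (2 - ‖p.2‖) / ‖p.2‖) • p.2) :=
      funext fun p => radialPush_apply hφ.injective _ _
    rw [this]
    have hs : ContinuousAt (fun p : ℝ × EuclideanSpace ℝ (Fin d) =>
        1 + p.1 * max 0 (2 - ‖p.2‖) / ‖p.2‖) (c, x) :=
      continuousAt_const.add (ContinuousAt.div (by fun_prop) (by fun_prop) hx)
    exact hφ.continuous.continuousAt.comp (hs.smul continuousAt_snd)
  · have hc : IsClosed (φ '' closedBall 0 2) :=
      ((isCompact_closedBall _ _).image hφ.continuous).isClosed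
    have hz' : (φ '' closedBall 0 2)ᶜ ∈ 𝓝 z :=
      hc.isOpen_compl.mem_nhds fun h' => h (Set.image_subset_range _ _ h')
    refine continuousAt_snd.congr ?_
    filter_upwards [continuousAt_snd.preimage_mem_nhds hz'] with p hp
    rw [radialPush_of_discHeight_eq_zero hφ.injective]
    refine le_antisymm (not_lt.1 fun h => ?_) (discHeight_nonneg hφ.injective _)
    obtain ⟨x, hx, hxp⟩ := (discHeight_pos_iff hφ.injective).1 h
    exact hp ⟨x, mem_closedBall_zero_iff.2 hx.le, hxp⟩

end Disc

/-! ### A neighbourhood of the boundary of the thickening -/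

section Disc

open Metric Topology

variable {Z : Type} {d : ℕ} {φ : EuclideanSpace ℝ (Fin d) → Z}

/-- The open subset of `Z × ℂ` obtained from `Z × ℂˣ` by adding `φ(B) × ℂ`, where `B` is the open
ball of radius `2`. -/
def tracePlus (φ : EuclideanSpace ℝ (Fin d) → Z) : Set (Z × ℂ) := {p | 0 < totalHeight φ p}

/-- The part of `tracePlus φ` outside the fibre over the center of the disc. -/
def traceOff (φ : EuclideanSpace ℝ (Fin d) → Z) : Set (Z × ℂ) :=
  {p | 0 < totalHeight φ p ∧ discHeight φ p.1 < 2}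

theorem traceOff_subset : traceOff φ ⊆ tracePlus φ := fun _ h => h.1

theorem thickeningBoundary_subset [TopologicalSpace Z] [T2Space Z] (hφ : IsOpenEmbedding φ)
    (hd : d ≠ 0) : thickeningBoundary φ ⊆ traceOff φ := by
  intro p hp
  rw [mem_thickeningBoundary_iff hφ hd] at hp
  refine ⟨by rw [hp]; exact one_pos, ?_⟩
  have := (le_max_left (discHeight φ p.1) ‖p.2‖).trans_eq hp
  linarith

/-- The parameter of the radial deformation of `traceOff φ` at time `s`, chosen so that at time `1` the
total height is divided by itself. -/
noncomputable def radialParam (φ : EuclideanSpace ℝ (Fin d) → Z) (s : ℝ) (p : Z × ℂ) : ℝ :=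
  s * (1 - 1 / totalHeight φ p)

/-- The radial deformation of `traceOff φ` onto the level set `totalHeight φ = 1`. -/
noncomputable def radialDeform (φ : EuclideanSpace ℝ (Fin d) → Z) (s : ℝ) (p : Z × ℂ) : Z × ℂ :=
  (radialPush φ (radialParam φ s p) p.1, ((1 - radialParam φ s p : ℝ) : ℂ) * p.2)

theorem one_sub_radialParam_pos {p : Z × ℂ} (hp : 0 < totalHeight φ p) {s : ℝ} (h0 : 0 ≤ s)
    (h1 : s ≤ 1) : 0 < 1 - radialParam φ s p := by
  have e : 1 - radialParam φ s p = (1 - s) + s * (1 / totalHeight φ p) := by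
    rw [radialParam]; ring
  have hN : 0 < 1 / totalHeight φ p := by positivity
  rw [e]
  rcases h0.eq_or_lt with rfl | h0
  · simp
  · have := mul_pos h0 hN
    linarith

theorem discHeight_radialDeform (hφ : Function.Injective φ) {p : Z × ℂ} (hp : p ∈ traceOff φ)
    {s : ℝ} (h0 : 0 ≤ s) (h1 : s ≤ 1) :
    discHeight φ (radialDeform φ s p).1 = (1 - radialParam φ s p) * discHeight φ p.1 ∧
      (1 - radialParam φ s p) * discHeight φ p.1 < 2 := by
  have hc := one_sub_radialParam_pos hp.1 h0 h1
  have hlt : (1 - radialParam φ s p) * discHeight φ p.1 < 2 := by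
    have e : (1 - radialParam φ s p) * discHeight φ p.1 =
        (1 - s) * discHeight φ p.1 + s * (discHeight φ p.1 / totalHeight φ p) := by
      rw [radialParam]; field_simp; ring
    have h2 : discHeight φ p.1 / totalHeight φ p ≤ 1 := div_le_one_of_le₀ (le_max_left _ _) hp.1.le
    rw [e]
    have h3 := mul_le_mul_of_nonneg_left h2 h0
    rcases h1.eq_or_lt with rfl | h1
    · linarith
    · have := mul_lt_mul_of_pos_left hp.2 (sub_pos.2 h1)
      linarith
  refine ⟨?_, hlt⟩
  rw [radialDeform]
  refine discHeight_radialPush hφ ((discHeight_lt_two_iff hφ).1 hp.2) (by linarith) ?_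
  have : (radialParam φ s p - 1) * discHeight φ p.1 =
    -((1 - radialParam φ s p) * discHeight φ p.1) := by ring
  linarith

theorem totalHeight_radialDeform (hφ : Function.Injective φ) {p : Z × ℂ} (hp : p ∈ traceOff φ)
    {s : ℝ} (h0 : 0 ≤ s) (h1 : s ≤ 1) :
    totalHeight φ (radialDeform φ s p) = (1 - radialParam φ s p) * totalHeight φ p := by
  have hc := one_sub_radialParam_pos hp.1 h0 h1
  rw [totalHeight, (discHeight_radialDeform hφ hp h0 h1).1, totalHeight, radialDeform, norm_mul,
    Complex.norm_real, Real.norm_of_nonneg hc.le, mul_max_of_nonneg _ _ hc.le]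

theorem radialDeform_mem (hφ : Function.Injective φ) {p : Z × ℂ} (hp : p ∈ traceOff φ)
    {s : ℝ} (h0 : 0 ≤ s) (h1 : s ≤ 1) : radialDeform φ s p ∈ traceOff φ := by
  refine ⟨?_, ?_⟩
  · rw [totalHeight_radialDeform hφ hp h0 h1]
    exact mul_pos (one_sub_radialParam_pos hp.1 h0 h1) hp.1
  · obtain ⟨h, h'⟩ := discHeight_radialDeform hφ hp h0 h1
    rwa [h]

theorem radialDeform_zero (hφ : Function.Injective φ) (p : Z × ℂ) : radialDeform φ 0 p = p := by
  simp [radialDeform, radialParam, radialPush_zero hφ]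

theorem totalHeight_radialDeform_one (hφ : Function.Injective φ) {p : Z × ℂ}
    (hp : p ∈ traceOff φ) : totalHeight φ (radialDeform φ 1 p) = 1 := by
  rw [totalHeight_radialDeform hφ hp zero_le_one le_rfl, radialParam, one_mul, sub_sub_cancel,
    one_div_mul_cancel hp.1.ne']

theorem radialDeform_of_totalHeight_eq_one (hφ : Function.Injective φ) {p : Z × ℂ} (s : ℝ)
    (hp : totalHeight φ p = 1) : radialDeform φ s p = p := by
  simp [radialDeform, radialParam, radialPush_zero hφ, hp]

variable [TopologicalSpace Z] [T2Space Z]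

theorem continuous_radialDeform (hφ : IsOpenEmbedding φ) :
    Continuous fun q : ℝ × traceOff φ => radialDeform φ q.1 q.2 := by
  have hp : Continuous fun q : ℝ × traceOff φ => radialParam φ q.1 q.2 := by
    unfold radialParam
    refine continuous_fst.mul (continuous_const.sub (continuous_const.div
      ((continuous_totalHeight hφ).comp (by fun_prop)) fun q => q.2.2.1.ne'))
  refine Continuous.prodMk ?_ (by fun_prop)
  rw [continuous_iff_continuousAt]
  intro q
  have hq := continuousAt_radialPush hφ ((discHeight_lt_two_iff hφ.injective).1 q.2.2.2)
    (radialParam φ q.1 q.2)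
  exact ContinuousAt.comp (f := fun q : ℝ × traceOff φ => (radialParam φ q.1 q.2, q.2.1.1)) hq
    (hp.continuousAt.prodMk (by fun_prop))

/-- The inclusion of the boundary of the thickening in `traceOff φ` is a homotopy equivalence. -/
theorem pull_incl_traceOff_bijective (hφ : IsOpenEmbedding φ) (hd : d ≠ 0) (k : ℕ) :
    Function.Bijective (pull (incl (thickeningBoundary_subset hφ hd)) k) := by
  let r : C(traceOff φ, thickeningBoundary φ) := ⟨fun p => ⟨radialDeform φ 1 p,
    (mem_thickeningBoundary_iff hφ hd).2 (totalHeight_radialDeform_one hφ.injective p.2)⟩,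
    ((continuous_radialDeform hφ).comp (by fun_prop :
      Continuous fun p : traceOff φ => ((1 : ℝ), p))).subtype_mk _⟩
  refine pull_bijective_of_homotopyInverse (g := r) ?_ ?_ k
  · have : r.comp (incl (thickeningBoundary_subset hφ hd)) = ContinuousMap.id _ := by
      ext1 p
      exact Subtype.ext (radialDeform_of_totalHeight_eq_one hφ.injective 1
        ((mem_thickeningBoundary_iff hφ hd).1 p.2))
    rw [this]
  · refine ContinuousMap.Homotopic.symm (homotopic_of_continuous
      (fun q => ⟨radialDeform φ q.1 q.2, radialDeform_mem hφ.injective q.2.2 q.1.2.1 q.1.2.2⟩)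
      (((continuous_radialDeform hφ).comp (by fun_prop :
        Continuous fun q : unitInterval × traceOff φ => ((q.1 : ℝ), q.2))).subtype_mk _) ?_ ?_)
    · intro p
      exact Subtype.ext (radialDeform_zero hφ.injective _)
    · intro p
      rfl

omit [T2Space Z] in
/-- The inverse of `φ` on the open disc of radius `2`. -/
theorem exists_discChart (hφ : IsOpenEmbedding φ) :
    ∃ ψ : C({z | 0 < discHeight φ z}, EuclideanSpace ℝ (Fin d)), ∀ z, φ (ψ z) = z := by
  have h (z : {z | 0 < discHeight φ z}) : (z : Z) ∈ Set.range φ := by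
    obtain ⟨x, -, hx⟩ := (discHeight_pos_iff hφ.injective).1 z.2
    exact ⟨x, hx⟩
  refine ⟨⟨fun z => hφ.isEmbedding.toHomeomorph.symm ⟨z, h z⟩, by fun_prop⟩, fun z => ?_⟩
  exact congrArg Subtype.val (hφ.isEmbedding.toHomeomorph.apply_symm_apply ⟨z, h z⟩)

omit [T2Space Z] in
theorem contractibleSpace_disc (hφ : IsOpenEmbedding φ) :
    ContractibleSpace {z | 0 < discHeight φ z} := by
  obtain ⟨ψ, hψ⟩ := exists_discChart hφ
  have h0 : 0 < discHeight φ (φ 0) := (discHeight_pos_iff hφ.injective).2 ⟨0, by simp, rfl⟩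
  have hψ' (z : {z | 0 < discHeight φ z}) : ‖ψ z‖ < 2 := by
    obtain ⟨x, hx, hxz⟩ := (discHeight_pos_iff hφ.injective).1 z.2
    rwa [← hφ.injective ((hψ z).trans hxz.symm)] at hx
  rw [contractible_iff_id_nullhomotopic]
  refine ⟨⟨φ 0, h0⟩, ContinuousMap.Homotopic.symm (homotopic_of_continuous
    (fun q => ⟨φ ((q.1 : ℝ) • ψ q.2), (discHeight_pos_iff hφ.injective).2 ⟨_, ?_, rfl⟩⟩) ?_ ?_ ?_)⟩
  · rw [norm_smul, Real.norm_of_nonneg q.1.2.1]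
    nlinarith [hψ' q.2, norm_nonneg (ψ q.2), q.1.2.1, q.1.2.2]
  · have := hφ.continuous
    exact Continuous.subtype_mk (by fun_prop) _
  · intro z
    apply Subtype.ext
    simp
  · intro z
    apply Subtype.ext
    simp [hψ]

omit [T2Space Z] in
theorem isSphereLike_puncturedDisc (hφ : IsOpenEmbedding φ) {k : ℕ} (hd : d = k + 1) :
    IsSphereLike {z | 0 < discHeight φ z ∧ discHeight φ z < 2} k := by
  obtain ⟨ψ, hψ⟩ := exists_discChart hφ
  let ψ' : C({z | 0 < discHeight φ z ∧ discHeight φ z < 2}, EuclideanSpace ℝ (Fin d)) :=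
    ⟨fun z => ψ ⟨z.1, z.2.1⟩, by fun_prop⟩
  have hψ' (z) : φ (ψ' z) = z.1 := hψ _
  have hlt (z) : ‖ψ' z‖ < 2 := by
    obtain ⟨x, hx, hxz⟩ := (discHeight_pos_iff hφ.injective).1 z.2.1
    rwa [← hφ.injective ((hψ' z).trans hxz.symm)] at hx
  have hpos (z) : 0 < ‖ψ' z‖ := by
    have := (discHeight_lt_two_iff hφ.injective).1 z.2.2
    rw [norm_pos_iff]
    rintro h
    exact this (by rw [← hψ', h])
  have hmem (x : EuclideanSpace ℝ (Fin d)) (h0 : x ≠ 0) (h2 : ‖x‖ < 2) :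
      0 < discHeight φ (φ x) ∧ discHeight φ (φ x) < 2 :=
    ⟨(discHeight_pos_iff hφ.injective).2 ⟨x, h2, rfl⟩,
      (discHeight_lt_two_iff hφ.injective).2 (hφ.injective.ne h0)⟩
  have hc := hφ.continuous
  let f : C({z | 0 < discHeight φ z ∧ discHeight φ z < 2},
      ({0}ᶜ : Set (EuclideanSpace ℝ (Fin d)))) :=
    ⟨fun z => ⟨ψ' z, norm_pos_iff.1 (hpos z)⟩, by fun_prop⟩
  have hne (x : ({0}ᶜ : Set (EuclideanSpace ℝ (Fin d)))) : ‖(x : EuclideanSpace ℝ (Fin d))‖ ≠ 0 :=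
    norm_ne_zero_iff.2 x.2
  have hcinv : Continuous fun x : ({0}ᶜ : Set (EuclideanSpace ℝ (Fin d))) =>
      ‖(x : EuclideanSpace ℝ (Fin d))‖⁻¹ := (continuous_norm.comp continuous_subtype_val).inv₀ hne
  have hcont : Continuous fun q : unitInterval × ({0}ᶜ : Set (EuclideanSpace ℝ (Fin d))) =>
      ((1 - (q.1 : ℝ)) * ‖(q.2 : EuclideanSpace ℝ (Fin d))‖⁻¹ + q.1) •
        (q.2 : EuclideanSpace ℝ (Fin d)) :=
    (((continuous_const.sub (continuous_subtype_val.comp continuous_fst)).mul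
      (hcinv.comp continuous_snd)).add (continuous_subtype_val.comp continuous_fst)).smul
      (continuous_subtype_val.comp continuous_snd)
  let g : C(({0}ᶜ : Set (EuclideanSpace ℝ (Fin d))),
      {z | 0 < discHeight φ z ∧ discHeight φ z < 2}) :=
    ⟨fun x => ⟨φ (‖(x : EuclideanSpace ℝ (Fin d))‖⁻¹ • x), hmem _
      (smul_ne_zero (inv_ne_zero (hne x)) x.2)
      (by rw [norm_smul, norm_inv, norm_norm, inv_mul_cancel₀ (hne x)]; norm_num)⟩,
    Continuous.subtype_mk (hc.comp (hcinv.smul continuous_subtype_val)) _⟩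
  have hψφ (z) (x : EuclideanSpace ℝ (Fin d)) (hz : φ x = z.1) : ψ' z = x :=
    hφ.injective ((hψ' z).trans hz.symm)
  have hfac (s : unitInterval) {t : ℝ} (ht : 0 < t) : 0 < (1 - (s : ℝ)) * t⁻¹ + s := by
    rcases s.2.1.eq_or_lt with h | h
    · rw [← h]; simpa using ht
    · have := mul_nonneg (sub_nonneg.2 s.2.2) (inv_pos.2 ht).le
      linarith
  refine (isSphereLike_punctured k (EuclideanSpace ℝ (Fin d)) (by simpa using hd)).of_bijective f
    fun i => pull_bijective_of_homotopyInverse (g := g) ?_ ?_ i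
  · refine homotopic_of_continuous
      (fun q => ⟨φ (((1 - (q.1 : ℝ)) * ‖ψ' q.2‖⁻¹ + q.1) • ψ' q.2), hmem _
        (smul_ne_zero (hfac q.1 (hpos q.2)).ne' (norm_pos_iff.1 (hpos q.2))) ?_⟩) ?_ ?_ ?_
    · rw [norm_smul, Real.norm_of_nonneg (hfac q.1 (hpos q.2)).le, add_mul, mul_assoc,
        inv_mul_cancel₀ (hpos q.2).ne', mul_one]
      rcases q.1.2.1.eq_or_lt with h | h
      · rw [← h]; norm_num
      · have := mul_pos h (sub_pos.2 (hlt q.2))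
        linarith [q.1.2.2]
    · exact Continuous.subtype_mk (hc.comp (hcont.comp (continuous_fst.prodMk
        (f.continuous.comp continuous_snd)))) _
    · intro z
      apply Subtype.ext
      simp [g, f]
    · intro z
      apply Subtype.ext
      simp [hψ']
  · refine homotopic_of_continuous
      (fun q => ⟨((1 - (q.1 : ℝ)) * ‖(q.2 : EuclideanSpace ℝ (Fin d))‖⁻¹ + q.1) •
        (q.2 : EuclideanSpace ℝ (Fin d)),
        smul_ne_zero (hfac q.1 (norm_pos_iff.2 q.2.2)).ne' q.2.2⟩) ?_ ?_ ?_
    · exact Continuous.subtype_mk hcont _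
    · intro x
      apply Subtype.ext
      change _ = ψ' (g x)
      rw [hψφ (g x) _ rfl]
      simp
    · intro x
      apply Subtype.ext
      simp

end Disc

/-! ### The cohomology of the boundary of the thickening -/

section Disc

open Metric Topology

variable {Z : Type} {d : ℕ} {φ : EuclideanSpace ℝ (Fin d) → Z}

/-- The open disc `φ(B)`, where `B` is the open ball of radius `2`. -/
abbrev openDisc (φ : EuclideanSpace ℝ (Fin d) → Z) : Set Z := {z | 0 < discHeight φ z}

/-- The complement of the center of the disc. -/
abbrev offCenter (φ : EuclideanSpace ℝ (Fin d) → Z) : Set Z := {z | discHeight φ z < 2}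

/-- The open disc without its center. -/
abbrev puncturedDisc (φ : EuclideanSpace ℝ (Fin d) → Z) : Set Z :=
  {z | 0 < discHeight φ z ∧ discHeight φ z < 2}

theorem slab_subset_tracePlus : slab Z {0}ᶜ ⊆ tracePlus φ :=
  fun _ hp => lt_max_of_lt_right (norm_pos_iff.2 hp)

variable [TopologicalSpace Z] [T2Space Z]

theorem isOpenUnion_disc (hφ : IsOpenEmbedding φ) :
    IsOpenUnion Set.univ (offCenter φ) (openDisc φ) (puncturedDisc φ) := by
  have hc := continuous_discHeight hφ
  refine ⟨?_, ?_, ⟨offCenter φ, isOpen_lt hc continuous_const, Set.univ_inter _⟩,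
    ⟨openDisc φ, isOpen_lt continuous_const hc, Set.univ_inter _⟩⟩
  · ext z
    simp only [Set.mem_union, Set.mem_ofPred_eq, Set.mem_univ, iff_true]
    rcases lt_or_ge 0 (discHeight φ z) with h | h
    · exact Or.inr h
    · exact Or.inl (h.trans_lt two_pos)
  · ext z
    exact and_comm

theorem isOpenUnion_tracePlus_slab (hφ : IsOpenEmbedding φ) :
    IsOpenUnion (tracePlus φ) (slab Z {0}ᶜ) (Prod.fst ⁻¹' openDisc φ)
      {p | 0 < discHeight φ p.1 ∧ p.2 ≠ 0} := by
  have hc := continuous_discHeight hφ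
  refine ⟨?_, ?_, ⟨slab Z {0}ᶜ, isOpen_compl_singleton.preimage continuous_snd,
    Set.inter_eq_right.2 slab_subset_tracePlus⟩, ⟨Prod.fst ⁻¹' openDisc φ,
    (isOpen_lt continuous_const hc).preimage continuous_fst,
    Set.inter_eq_right.2 fun p hp => show 0 < totalHeight φ p from lt_max_of_lt_left hp⟩⟩
  · ext p
    refine (or_comm.trans (or_congr Iff.rfl norm_pos_iff.symm)).trans
      (lt_max_iff (a := (0 : ℝ)) (b := discHeight φ p.1) (c := ‖p.2‖)).symm
  · ext p
    exact and_comm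

theorem isOpenUnion_tracePlus_off (hφ : IsOpenEmbedding φ) :
    IsOpenUnion (tracePlus φ) (traceOff φ) (Prod.fst ⁻¹' openDisc φ)
      (Prod.fst ⁻¹' puncturedDisc φ) := by
  have hc := continuous_discHeight hφ
  refine ⟨?_, ?_, ⟨Prod.fst ⁻¹' offCenter φ,
    (isOpen_lt hc continuous_const).preimage continuous_fst, rfl⟩, ⟨Prod.fst ⁻¹' openDisc φ,
    (isOpen_lt continuous_const hc).preimage continuous_fst,
    Set.inter_eq_right.2 fun p hp => show 0 < totalHeight φ p from lt_max_of_lt_left hp⟩⟩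
  · ext p
    constructor
    · exact fun h => h.elim (fun h => h.1) fun h => show 0 < totalHeight φ p from lt_max_of_lt_left h
    · intro h
      rcases lt_or_ge 0 (discHeight φ p.1) with h' | h'
      · exact Or.inr h'
      · exact Or.inl ⟨h, h'.trans_lt two_pos⟩
  · ext p
    constructor
    · exact fun h => ⟨h.2, h.1.2⟩
    · exact fun h => ⟨⟨lt_max_of_lt_left h.1, h.2⟩, h.1⟩

omit [T2Space Z] in
/-- The projection to a subspace of the first factor of a product with `ℂ`. -/
def tubeFst (S : Set Z) : C((Prod.fst ⁻¹' S : Set (Z × ℂ)), S) := ⟨fun p => ⟨p.1.1, p.2⟩, by fun_prop⟩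

omit [T2Space Z] in
theorem pull_tubeFst_bijective (S : Set Z) (k : ℕ) : Function.Bijective (pull (tubeFst S) k) := by
  let g : C(S, (Prod.fst ⁻¹' S : Set (Z × ℂ))) := ⟨fun z => ⟨(z, 0), z.2⟩, by fun_prop⟩
  refine pull_bijective_of_homotopyInverse (g := g) ?_ (ContinuousMap.Homotopic.refl _) k
  refine homotopic_of_continuous (fun q => ⟨(q.2.1.1, ((q.1 : ℝ) : ℂ) * q.2.1.2), q.2.2⟩)
    (by fun_prop) ?_ ?_
  · rintro ⟨⟨z, w⟩, hz⟩
    simp [g, tubeFst]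
  · rintro ⟨⟨z, w⟩, hz⟩
    simp

omit [T2Space Z] in
theorem exists_eq_tube (hφ : IsOpenEmbedding φ) (k : ℕ)
    (a : H (Prod.fst ⁻¹' openDisc φ : Set (Z × ℂ)) k) : ∃ c, a = pull (toUnit _) k c := by
  obtain ⟨b, rfl⟩ := (pull_tubeFst_bijective _ k).2 a
  have := contractibleSpace_disc hφ
  obtain ⟨c, rfl⟩ := exists_eq_pull_toUnit k b
  exact ⟨c, pull_toUnit _ _ _⟩

/-- On the product of the disc with `ℂˣ` all classes come from the circle. -/
theorem exists_eq_annulus (hφ : IsOpenEmbedding φ) (k : ℕ)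
    (a : H {p : Z × ℂ | 0 < discHeight φ p.1 ∧ p.2 ≠ 0} k) : ∃ c : H (slab Z {0}ᶜ) k,
      a = res (isOpenUnion_tracePlus_slab hφ).inter_subset_left k c := by
  obtain ⟨ψ, hψ⟩ := exists_discChart hφ
  have h0 : 0 < discHeight φ (φ 0) := (discHeight_pos_iff hφ.injective).2 ⟨0, by simp, rfl⟩
  have hψ' (z : openDisc φ) : ‖ψ z‖ < 2 := by
    obtain ⟨x, hx, hxz⟩ := (discHeight_pos_iff hφ.injective).1 z.2
    rwa [← hφ.injective ((hψ z).trans hxz.symm)] at hx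
  let g : C(({0}ᶜ : Set ℂ), {p : Z × ℂ | 0 < discHeight φ p.1 ∧ p.2 ≠ 0}) :=
    ⟨fun w => ⟨(φ 0, w), h0, w.2⟩, by fun_prop⟩
  refine ⟨pull (slabSnd Z {0}ᶜ) k (pull g k a), ?_⟩
  rw [res, ← pull_comp, ← pull_comp]
  conv_lhs => rw [← pull_id k a]
  have hlt (q : unitInterval × {p : Z × ℂ | 0 < discHeight φ p.1 ∧ p.2 ≠ 0}) :
      ‖(q.1 : ℝ) • ψ ⟨q.2.1.1, q.2.2.1⟩‖ < 2 := by
    rw [norm_smul, Real.norm_of_nonneg q.1.2.1]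
    nlinarith [hψ' ⟨q.2.1.1, q.2.2.1⟩, norm_nonneg (ψ ⟨q.2.1.1, q.2.2.1⟩), q.1.2.1, q.1.2.2]
  let F (q : unitInterval × {p : Z × ℂ | 0 < discHeight φ p.1 ∧ p.2 ≠ 0}) :
      {p : Z × ℂ | 0 < discHeight φ p.1 ∧ p.2 ≠ 0} :=
    ⟨(φ ((q.1 : ℝ) • ψ ⟨q.2.1.1, q.2.2.1⟩), q.2.1.2),
      (discHeight_pos_iff hφ.injective).2 ⟨_, hlt q, rfl⟩, q.2.2.2⟩
  have hF : Continuous F := by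
    have := hφ.continuous
    exact Continuous.subtype_mk (by fun_prop) _
  refine DFunLike.congr_fun (pull_eq_of_homotopic (ContinuousMap.Homotopic.symm
    (homotopic_of_continuous F hF ?_ ?_)) k) a
  · rintro ⟨⟨z, w⟩, hz⟩
    apply Subtype.ext
    change (φ ((0 : ℝ) • _), w) = (φ 0, w)
    rw [zero_smul]
  · rintro ⟨⟨z, w⟩, hz⟩
    apply Subtype.ext
    change (φ ((1 : ℝ) • ψ ⟨z, _⟩), w) = (z, w)
    rw [one_smul, hψ]

theorem connecting_toUnit {T : Type} [TopologicalSpace T] {X A B C : Set T}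
    (h : IsOpenUnion X A B C) (k : ℕ) (c : H Unit k) :
    h.Connecting k (pull (toUnit C) k c) 0 := by
  rw [h.connecting_zero_iff]
  exact ⟨pull (toUnit A) k c, 0, by rw [map_zero, sub_zero, res, pull_toUnit]⟩

/-- The projection of `tracePlus φ` to `Z`. -/
def traceFst (φ : EuclideanSpace ℝ (Fin d) → Z) : C(tracePlus φ, Z) :=
  ⟨fun p => p.1.1, by fun_prop⟩

/-- The set `tracePlus φ` is the union of `Z × ℂˣ` and the contractible set `φ(B) × ℂ`, with intersection
`φ(B) × ℂˣ`, whose classes all extend to `Z × ℂˣ`. -/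
theorem pull_tracePlus_injective (hφ : IsOpenEmbedding φ) (k : ℕ) :
    Function.Injective (res (slab_subset_tracePlus (φ := φ)) k) := by
  rw [injective_iff_map_eq_zero]
  intro v hv
  have h := isOpenUnion_tracePlus_slab hφ
  cases k with
  | zero =>
    obtain ⟨c, hc⟩ := exists_eq_tube hφ 0 (res h.right_subset 0 v)
    obtain ⟨m, rfl⟩ := exists_eq_zsmul_one c
    have h0 : 0 < discHeight φ (φ 0) := (discHeight_pos_iff hφ.injective).2 ⟨0, by simp, rfl⟩
    have : Nonempty {p : Z × ℂ | 0 < discHeight φ p.1 ∧ p.2 ≠ 0} :=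
      ⟨⟨(φ 0, 1), h0, one_ne_zero⟩⟩
    have hm : m = 0 := by
      apply zsmul_one_eq_zero (X := {p : Z × ℂ | 0 < discHeight φ p.1 ∧ p.2 ≠ 0})
      have e := congrArg (res h.inter_subset_right 0) hc
      rw [res_res, ← res_res h.inter_subset_left h.left_subset, hv, map_zero, map_zsmul, map_zsmul,
        pull_one, pull_one] at e
      exact e.symm
    refine h.eq_zero_of_res_eq_zero v hv ?_
    rw [hc, hm, zero_smul, map_zero]
  | succ k =>
    obtain ⟨c, hc⟩ := exists_eq_tube hφ (k + 1) (res h.right_subset (k + 1) v)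
    rw [pull_toUnit_succ] at hc
    obtain ⟨β, hβ⟩ := h.exists_connecting_of_res_eq_zero k v hv hc
    obtain ⟨b, rfl⟩ := exists_eq_annulus hφ k β
    refine hβ.unique ((h.connecting_zero_iff k _).2 ⟨b, 0, ?_⟩)
    rw [map_zero, sub_zero]

/-- Classes `b × e` with `b` of positive degree extend over `φ(B) × ℂ`, because `b` vanishes on the disc. -/
theorem exists_res_tracePlus_eq {e : H Circle 1} (hφ : IsOpenEmbedding φ) (k : ℕ)
    (b : H Z (k + 1)) : ∃ v : H (tracePlus φ) (k + 1 + 1),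
      res slab_subset_tracePlus (k + 1 + 1) v =
        cupProduct rfl (pull (slabFst Z {0}ᶜ) (k + 1) b) (pull (slabCircle Z) 1 e) := by
  have h := isOpenUnion_tracePlus_slab hφ
  have hb : res h.inter_subset_left (k + 1) (pull (slabFst Z {0}ᶜ) (k + 1) b) = 0 := by
    let f : C({p : Z × ℂ | 0 < discHeight φ p.1 ∧ p.2 ≠ 0}, openDisc φ) :=
      ⟨fun p => ⟨p.1.1, p.2.1⟩, by fun_prop⟩
    let f' : C(openDisc φ, Z) := ⟨Subtype.val, by fun_prop⟩
    have := contractibleSpace_disc hφ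
    rw [res, ← pull_comp]
    change pull (f'.comp f) (k + 1) b = 0
    rw [pull_comp, eq_zero_of_contractible (pull f' (k + 1) b), map_zero]
  obtain ⟨v, hv, -⟩ := h.exists_res_eq (k + 1 + 1)
    (cupProduct rfl (pull (slabFst Z {0}ᶜ) (k + 1) b) (pull (slabCircle Z) 1 e)) 0 (by
      rw [map_zero, res, pull_cupProduct, ← res, hb, map_zero, AddMonoidHom.zero_apply])
  exact ⟨v, hv⟩

omit [T2Space Z] in
/-- The class `1 × e` does not extend: in the fibre `ℂ` over the center of the disc the circle bounds. -/
theorem eq_zero_of_res_tracePlus [PathConnectedSpace Z] {e : H Circle 1}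
    (he : IsFundamentalClass e) (hφ : Function.Injective φ) (v : H (tracePlus φ) 1)
    (a : H Z 1) (b : H Z 0) (hv : res slab_subset_tracePlus 1 v = pull (slabFst Z {0}ᶜ) 1 a +
      cupProduct rfl (pull (slabFst Z {0}ᶜ) 0 b) (pull (slabCircle Z) 1 e)) : b = 0 := by
  obtain ⟨m, rfl⟩ := exists_eq_zsmul_one b
  have h0 : 0 < discHeight φ (φ 0) := (discHeight_pos_iff hφ).2 ⟨0, by simp, rfl⟩
  let ι : C(({0}ᶜ : Set ℂ), slab Z {0}ᶜ) := ⟨fun w => ⟨(φ 0, w), w.2⟩, by fun_prop⟩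
  let ι' : C(ℂ, tracePlus φ) := ⟨fun w => ⟨(φ 0, w), lt_max_of_lt_left h0⟩, by fun_prop⟩
  let κ : C(({0}ᶜ : Set ℂ), ℂ) := ⟨Subtype.val, by fun_prop⟩
  have hl : pull ι 1 (res slab_subset_tracePlus 1 v) = 0 := by
    rw [res, ← pull_comp]
    change pull (ι'.comp κ) 1 v = 0
    rw [pull_comp, eq_zero_of_contractible (pull ι' 1 v), map_zero]
  have hr : pull ι 1 (pull (slabFst Z {0}ᶜ) 1 a) = 0 := by
    rw [← pull_comp]
    change pull ((ContinuousMap.const Unit (φ 0)).comp (toUnit _)) 1 a = 0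
    rw [pull_comp, pull_toUnit_succ]
  rw [hv, map_add, hr, zero_add, map_zsmul, pull_one, map_zsmul, AddMonoidHom.zsmul_apply,
    cohomologyOne_cupProduct, map_zsmul, ← pull_comp] at hl
  have he0 : m • e = 0 := by
    apply (pull_toCircle_bijective 1).1
    rw [map_zsmul, map_zero]
    exact hl
  have : m = 0 := he.1 (by simpa using he0)
  rw [this, zero_smul]

omit [TopologicalSpace Z] [T2Space Z] in
theorem nonempty_puncturedDisc (hφ : Function.Injective φ) (hd : d ≠ 0) :
    (puncturedDisc φ).Nonempty := by
  have : Nonempty (Fin d) := ⟨⟨0, Nat.pos_of_ne_zero hd⟩⟩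
  obtain ⟨x, hx⟩ := exists_norm_eq (EuclideanSpace ℝ (Fin d)) zero_le_one
  refine ⟨φ x, ?_, ?_⟩ <;> rw [discHeight_apply hφ, hx] <;> norm_num

/-- If top-dimensional classes vanish off the center of the disc, then the connecting homomorphism
maps a generator of the cohomology of the punctured disc to a generator of the top cohomology. -/
theorem exists_connecting_generator {k : ℕ} (hφ : IsOpenEmbedding φ) (hd : d = k + 1) {ζ : H Z d}
    (hζ : IsFundamentalClass ζ)
    (hG : ∀ α : H (Set.univ : Set Z) d, res (isOpenUnion_disc hφ).left_subset d α = 0) :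
    ∃ (s : H (puncturedDisc φ) k) (σ : H (Set.univ : Set Z) (k + 1)),
      (isOpenUnion_disc hφ).Connecting k s σ ∧
      (∀ β : H (puncturedDisc φ) k, ∃ (m : ℤ) (c : H Unit k), β = m • s + pull (toUnit _) k c) ∧
      (∀ m : ℤ, m • σ = 0 → m = 0) ∧
      ∃ t : ℤ, DirectSum.of (H (Set.univ : Set Z)) (k + 1) σ =
        t • DirectSum.of (H (Set.univ : Set Z)) d (pull ⟨Subtype.val, continuous_subtype_val⟩ d ζ) := by
  subst hd
  let ν : C((Set.univ : Set Z), Z) := ⟨Subtype.val, continuous_subtype_val⟩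
  have hν : Function.Bijective (pull ν (k + 1)) :=
    pull_homeomorph_bijective (Homeomorph.Set.univ Z) (k + 1)
  obtain ⟨s, hs⟩ := (isSphereLike_puncturedDisc hφ rfl).2
  obtain ⟨σ, hσ⟩ := (isOpenUnion_disc hφ).exists_connecting k s
  have hgen (α : H (Set.univ : Set Z) (k + 1)) : ∃ m : ℤ, α = m • σ := by
    have := contractibleSpace_disc hφ
    obtain ⟨β, hβ⟩ := (isOpenUnion_disc hφ).exists_connecting_of_res_eq_zero k α (hG α)
      (eq_zero_of_contractible _)
    obtain ⟨m, c, rfl⟩ := hs β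
    refine ⟨m, hβ.unique ?_⟩
    have := (hσ.zsmul m).add (connecting_toUnit (isOpenUnion_disc hφ) k c)
    rwa [add_zero] at this
  refine ⟨s, σ, hσ, hs, fun m hm => ?_, ?_⟩
  · obtain ⟨l, hl⟩ := hgen (pull ν (k + 1) ζ)
    have : m • ζ = 0 := by
      apply hν.1
      rw [map_zsmul, hl, smul_smul, mul_comm, mul_smul, hm, smul_zero, map_zero]
    exact hζ.1 (by simpa using this)
  · obtain ⟨a, rfl⟩ := hν.2 σ
    obtain ⟨t, rfl⟩ := hζ.2 a
    exact ⟨t, by rw [map_zsmul, map_zsmul]⟩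

/-- The cohomology of the boundary of the thickening. Up to homotopy the boundary is `tracePlus φ` without
the fibre over the center of the disc. Filling in this fibre adds the relation given by the
connecting homomorphism on the generator of the cohomology of the punctured disc, and that relation
is the top class of `Z`. -/
theorem isReduction_tracePlus [PathConnectedSpace Z] {k : ℕ} (hφ : IsOpenEmbedding φ)
    (hd : d = k + 1) {ζ : H Z d} (hζ : IsFundamentalClass ζ) {e : H Circle 1}
    (he : IsFundamentalClass e)
    (hG : ∀ α : H (Set.univ : Set Z) d, res (isOpenUnion_disc hφ).left_subset d α = 0) :
    IsReduction ζ e (traceFst φ) (incl slab_subset_tracePlus)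
      (incl ((thickeningBoundary_subset hφ (by omega)).trans traceOff_subset)) := by
  have hd0 : d ≠ 0 := by omega
  have h := isOpenUnion_tracePlus_off hφ
  let P : C(tracePlus φ, (Set.univ : Set Z)) := ⟨fun p => ⟨p.1.1, trivial⟩, by fun_prop⟩
  let ν : C((Set.univ : Set Z), Z) := ⟨Subtype.val, continuous_subtype_val⟩
  obtain ⟨s, σ, hσ, hs, hσ0, t, ht⟩ := exists_connecting_generator hφ hd hζ hG
  have hP : Function.Injective (pull P (k + 1)) := by
    refine Function.LeftInverse.injective (g := pull (⟨fun z => ⟨(z, 1), slab_subset_tracePlus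
      (one_ne_zero (α := ℂ))⟩, by fun_prop⟩ : C((Set.univ : Set Z), tracePlus φ)) (k + 1))
      fun a => ?_
    rw [← pull_comp]
    exact pull_id (k + 1) a
  have hδ : h.Connecting k (pull (tubeFst (puncturedDisc φ)) k s) (pull P (k + 1) σ) :=
    hσ.pull P ⟨fun p => ⟨p.1.1, p.2.2⟩, by fun_prop⟩ (tubeFst _) (tubeFst _) rfl rfl rfl rfl
  have hgen (β : H (Prod.fst ⁻¹' puncturedDisc φ : Set (Z × ℂ)) k) :
      ∃ (m : ℤ) (c : H Unit k), β = m • pull (tubeFst (puncturedDisc φ)) k s +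
        pull (toUnit _) k c := by
    obtain ⟨b, rfl⟩ := (pull_tubeFst_bijective _ k).2 β
    obtain ⟨m, c, rfl⟩ := hs b
    exact ⟨m, c, by rw [map_add, map_zsmul, pull_toUnit]⟩
  have hpt (l : ℕ) (hl : l ≠ k) (β : H (Prod.fst ⁻¹' puncturedDisc φ : Set (Z × ℂ)) l) :
      ∃ c : H Unit l, β = pull (toUnit _) l c := by
    obtain ⟨b, rfl⟩ := (pull_tubeFst_bijective _ l).2 β
    obtain ⟨c, rfl⟩ := (isSphereLike_puncturedDisc hφ hd).1 l hl b
    exact ⟨c, pull_toUnit _ _ _⟩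
  -- a class on `traceOff φ` has no component along the generator of the punctured disc, since the
  -- connecting homomorphism kills it but is injective on multiples of the generator
  have hsurj (l : ℕ) : Function.Surjective (res (traceOff_subset (φ := φ)) l) := by
    intro α
    obtain ⟨c, hc⟩ : ∃ c : H Unit l, res h.inter_subset_left l α = pull (toUnit _) l c := by
      by_cases hl : l = k
      · subst hl
        obtain ⟨m, c, hmc⟩ := hgen (res h.inter_subset_left l α)
        refine ⟨c, ?_⟩
        have h0 : h.Connecting l (res h.inter_subset_left l α) 0 :=
          (h.connecting_zero_iff l _).2 ⟨α, 0, by rw [map_zero, sub_zero]⟩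
        have h1 := (hδ.zsmul m).add (connecting_toUnit h l c)
        rw [← hmc, add_zero] at h1
        have h2 : m • σ = 0 := by
          apply hP
          rw [map_zsmul, map_zero]
          exact h1.unique h0
        rw [hmc, hσ0 m h2, zero_smul, zero_add]
      · exact hpt l hl _
    obtain ⟨v, hv, -⟩ := h.exists_res_eq l α (pull (toUnit _) l c) (by
      rw [hc, res, pull_toUnit])
    exact ⟨v, hv⟩
  have hker (l : ℕ) (v : H (tracePlus φ) l) (hv : res traceOff_subset l v = 0) :
      ∃ m : ℤ, DirectSum.of (H (tracePlus φ)) l v =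
        m • DirectSum.of (H (tracePlus φ)) d (pull (traceFst φ) d ζ) := by
    cases l with
    | zero =>
      refine ⟨0, ?_⟩
      obtain ⟨c, hc⟩ := exists_eq_tube hφ 0 (res h.right_subset 0 v)
      obtain ⟨m, rfl⟩ := exists_eq_zsmul_one c
      obtain ⟨z, hz⟩ := nonempty_puncturedDisc hφ.injective hd0
      have : Nonempty (Prod.fst ⁻¹' puncturedDisc φ : Set (Z × ℂ)) := ⟨⟨(z, 0), hz⟩⟩
      have hm : m = 0 := by
        apply zsmul_one_eq_zero (X := (Prod.fst ⁻¹' puncturedDisc φ : Set (Z × ℂ)))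
        have e := congrArg (res h.inter_subset_right 0) hc
        rw [res_res, ← res_res h.inter_subset_left h.left_subset, hv, map_zero, map_zsmul,
          map_zsmul, pull_one, pull_one] at e
        exact e.symm
      rw [h.eq_zero_of_res_eq_zero v hv (by rw [hc, hm, zero_smul, map_zero]), map_zero, zero_smul]
    | succ l =>
      obtain ⟨c, hc⟩ := exists_eq_tube hφ (l + 1) (res h.right_subset (l + 1) v)
      rw [pull_toUnit_succ] at hc
      obtain ⟨β, hβ⟩ := h.exists_connecting_of_res_eq_zero l v hv hc
      by_cases hl : l = k
      · subst hl
        obtain ⟨m, c, rfl⟩ := hgen β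
        have h1 := (hδ.zsmul m).add (connecting_toUnit h l c)
        rw [add_zero] at h1
        refine ⟨m * t, ?_⟩
        rw [hβ.unique h1, map_zsmul, mul_smul]
        congr 1
        have h2 := congrArg (pullRing P) ht
        rw [pullRing_of, map_zsmul, pullRing_of, ← pull_comp] at h2
        exact h2
      · obtain ⟨c, rfl⟩ := hpt l hl β
        exact ⟨0, by rw [hβ.unique (connecting_toUnit h l c), map_zero, zero_smul]⟩
  refine ⟨rfl, pull_tracePlus_injective hφ, exists_res_tracePlus_eq hφ,
    eq_zero_of_res_tracePlus he hφ.injective, fun l α => ?_, ?_, fun l v hv => ?_⟩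
  · obtain ⟨a, rfl⟩ := (pull_incl_traceOff_bijective hφ hd0 l).2 α
    obtain ⟨v, rfl⟩ := hsurj l a
    exact ⟨v, (res_res _ _ _ _).symm⟩
  · let f : C(thickeningBoundary φ, offCenter φ) :=
      ⟨fun p => ⟨p.1.1, (thickeningBoundary_subset hφ hd0 p.2).2⟩, by fun_prop⟩
    have := congrArg (pull f d) (hG (pull ν d ζ))
    rw [res, ← pull_comp, ← pull_comp, map_zero] at this
    rw [← pull_comp]
    exact this
  · refine hker l v ((pull_incl_traceOff_bijective hφ hd0 l).1 ?_)
    rw [map_zero]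
    exact (res_res _ _ _ _).trans hv

end Disc

/-! ### The boundary of the thickening as the result of a surgery -/

section Surgery

open Metric Topology

variable {Z : Type} {d : ℕ} {φ : EuclideanSpace ℝ (Fin d) → Z}

/-- The map `φ × id` along which the surgery is done. -/
def surgeryEmbedding (φ : EuclideanSpace ℝ (Fin d) → Z) :
    EuclideanSpace ℝ (Fin d) × Circle → Z × Circle := fun p => (φ p.1, p.2)

theorem notMem_image_surgeryEmbedding_iff {p : Z × Circle} :
    p ∉ surgeryEmbedding φ '' (ball 0 1 ×ˢ Set.univ) ↔ p.1 ∉ φ '' ball 0 1 := by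
  refine not_congr ⟨?_, ?_⟩
  · rintro ⟨⟨x, w⟩, ⟨hx, -⟩, rfl⟩
    exact ⟨x, hx, rfl⟩
  · rintro ⟨x, hx, h⟩
    exact ⟨(x, p.2), ⟨hx, trivial⟩, Prod.ext h rfl⟩

variable [TopologicalSpace Z] [T2Space Z]

theorem inl_mem_thickeningBoundary (hφ : IsOpenEmbedding φ) (hd : d ≠ 0) (z : Z) (w : Circle)
    (hz : z ∉ φ '' ball 0 1) : (z, (w : ℂ)) ∈ thickeningBoundary φ := by
  rw [mem_thickeningBoundary_iff hφ hd, totalHeight]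
  rw [notMem_image_ball_iff hφ.injective] at hz
  change max (discHeight φ z) ‖(w : ℂ)‖ = 1
  rw [w.norm_coe, max_eq_right hz]

theorem inr_mem_thickeningBoundary (hφ : IsOpenEmbedding φ) (hd : d ≠ 0)
    (x : sphere (0 : EuclideanSpace ℝ (Fin d)) 1) (w : closedBall (0 : ℂ) 1) :
    (φ x, (w : ℂ)) ∈ thickeningBoundary φ := by
  rw [mem_thickeningBoundary_iff hφ hd, totalHeight]
  have hx := (mem_image_sphere_iff hφ.injective).1 ⟨x, x.2, rfl⟩
  change max (discHeight φ (φ x)) ‖(w : ℂ)‖ = 1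
  rw [hx, max_eq_left (mem_closedBall_zero_iff.1 w.2)]

/-- The boundary of the thickening is the result of the surgery: the two pieces
`(Z - int D) × S¹` and `S^{d-1} × D²` cover it and overlap along `S^{d-1} × S¹`. -/
theorem nonempty_homeomorph_surgery [CompactSpace Z] (hφ : IsOpenEmbedding φ) (hd : d ≠ 0) :
    Nonempty (thickeningBoundary φ ≃ₜ Surgery (surgeryEmbedding φ)) := by
  let f : {p : Z × Circle // p ∉ surgeryEmbedding φ '' (ball 0 1 ×ˢ Set.univ)} ⊕
      (sphere (0 : EuclideanSpace ℝ (Fin d)) 1 × closedBall (0 : ℂ) 1) → thickeningBoundary φ :=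
    Sum.elim (fun p => ⟨(p.1.1, (p.1.2 : ℂ)), inl_mem_thickeningBoundary hφ hd _ _
      (notMem_image_surgeryEmbedding_iff.1 p.2)⟩)
      (fun q => ⟨(φ q.1, (q.2 : ℂ)), inr_mem_thickeningBoundary hφ hd _ _⟩)
  have hφc := hφ.continuous
  have hf : Continuous f := continuous_sum_dom.2 ⟨by
    change Continuous fun p : {p : Z × Circle // _} => (⟨(p.1.1, (p.1.2 : ℂ)), _⟩ : thickeningBoundary φ)
    exact Continuous.subtype_mk (by fun_prop) _, by
    change Continuous fun q : sphere (0 : EuclideanSpace ℝ (Fin d)) 1 × closedBall (0 : ℂ) 1 =>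
      (⟨(φ q.1, (q.2 : ℂ)), _⟩ : thickeningBoundary φ)
    exact Continuous.subtype_mk (by fun_prop) _⟩
  have hr (a b) (hab : SurgeryRel (surgeryEmbedding φ) a b) : f a = f b := by
    obtain ⟨x, w, w', hw, h⟩ := hab
    exact Subtype.ext (Prod.ext rfl hw.symm)
  let g : Surgery (surgeryEmbedding φ) → thickeningBoundary φ := Quot.lift f hr
  have hg : Continuous g := continuous_quot_lift hr hf
  have glue (z : Z) (w : Circle) (hz) (x : sphere (0 : EuclideanSpace ℝ (Fin d)) 1)
      (w' : closedBall (0 : ℂ) 1) (h₁ : z = φ x) (h₂ : (w : ℂ) = w') :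
      (Quot.mk _ (Sum.inl ⟨(z, w), hz⟩) : Surgery (surgeryEmbedding φ)) =
        Quot.mk _ (Sum.inr (x, w')) := by
    subst h₁
    exact Quot.sound (SurgeryRel.glue x w w' h₂.symm hz)
  have hinj : Function.Injective g := by
    rintro ⟨⟨⟨z, w⟩, hz⟩ | ⟨x, w'⟩⟩ ⟨⟨⟨y, v⟩, hy⟩ | ⟨t, v'⟩⟩ h
    · have h1 : z = y := congrArg (fun p => p.1.1) h
      have h2 : (w : ℂ) = v := congrArg (fun p => p.1.2) h
      obtain rfl : w = v := Circle.ext h2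
      subst h1
      rfl
    · exact glue _ _ _ _ _ (congrArg (fun p => p.1.1) h) (congrArg (fun p => p.1.2) h)
    · exact (glue _ _ _ _ _ (congrArg (fun p => p.1.1) h).symm
        (congrArg (fun p => p.1.2) h).symm).symm
    · have h1 : φ x = φ t := congrArg (fun p => p.1.1) h
      have h2 : (w' : ℂ) = v' := congrArg (fun p => p.1.2) h
      obtain rfl : x = t := Subtype.ext (hφ.injective h1)
      obtain rfl : w' = v' := Subtype.ext h2
      rfl
  have hsurj : Function.Surjective g := by
    rintro ⟨⟨z, w⟩, hp⟩
    have hp' := (mem_thickeningBoundary_iff hφ hd).1 hp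
    rw [totalHeight] at hp'
    by_cases hw : ‖w‖ = 1
    · refine ⟨Quot.mk _ (Sum.inl ⟨(z, ⟨w, by simp [Submonoid.unitSphere, hw]⟩),
        notMem_image_surgeryEmbedding_iff.2 ((notMem_image_ball_iff hφ.injective).2 ?_)⟩), rfl⟩
      exact (le_max_left _ _).trans hp'.le
    · have hu : discHeight φ z = 1 := by
        rcases max_choice (discHeight φ z) ‖w‖ with h | h
        · exact h.symm.trans hp'
        · exact absurd (h.symm.trans hp') hw
      obtain ⟨x, hx, rfl⟩ := (mem_image_sphere_iff hφ.injective).2 hu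
      exact ⟨Quot.mk _ (Sum.inr (⟨x, hx⟩, ⟨w, mem_closedBall_zero_iff.2
        ((le_max_right _ _).trans hp'.le)⟩)), rfl⟩
  have hcl : IsClosed {p : Z × Circle | p ∉ surgeryEmbedding φ '' (ball 0 1 ×ˢ Set.univ)} := by
    have : {p : Z × Circle | p ∉ surgeryEmbedding φ '' (ball 0 1 ×ˢ Set.univ)} =
        Prod.fst ⁻¹' (φ '' ball 0 1)ᶜ := by
      ext p
      exact notMem_image_surgeryEmbedding_iff
    rw [this]
    exact (hφ.isOpenMap _ isOpen_ball).isClosed_compl.preimage continuous_fst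
  have : CompactSpace {p : Z × Circle // p ∉ surgeryEmbedding φ '' (ball 0 1 ×ˢ Set.univ)} :=
    isCompact_iff_compactSpace.1 hcl.isCompact
  have : CompactSpace (closedBall (0 : ℂ) 1) :=
    isCompact_iff_compactSpace.1 (isCompact_closedBall _ _)
  have : CompactSpace (Surgery (surgeryEmbedding φ)) :=
    inferInstanceAs (CompactSpace (Quot (SurgeryRel (surgeryEmbedding φ))))
  -- a continuous bijection from a compact space to a Hausdorff space
  exact ⟨(Continuous.homeoOfEquivCompactToT2 (f := Equiv.ofBijective g ⟨hinj, hsurj⟩) hg).symm⟩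

end Surgery

/-! ### Moving a point inside a chart -/

section Transport

open Metric Topology

variable {Z B E : Type} [NormedAddCommGroup E] [NormedSpace ℝ E] {g : E × B → Z}

/-- A bump function on `E` that is `1` exactly at `v` and has bounded support. -/
noncomputable def pointBump (v x : E) : ℝ := max 0 (1 - ‖x - v‖ / (‖v‖ + 1))

/-- Only `v` is moved to the origin by `x ↦ x - χ(x) v`: on the line through `v` the bump function
decreases with slope less than `1 / ‖v‖`. -/
theorem sub_pointBump_smul_eq_zero {v x : E} (h : x - pointBump v x • v = 0) : x = v := by
  have hR : 0 < ‖v‖ + 1 := by positivity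
  have hx : x = pointBump v x • v := sub_eq_zero.1 h
  have hn : ‖x - v‖ = |1 - pointBump v x| * ‖v‖ := by
    conv_lhs => rw [hx]
    rw [← norm_neg, ← Real.norm_eq_abs, ← norm_smul, sub_smul, one_smul, neg_sub]
  rcases max_choice 0 (1 - ‖x - v‖ / (‖v‖ + 1)) with hχ | hχ
  · change pointBump v x = 0 at hχ
    rw [hχ, sub_zero, abs_one, one_mul] at hn
    have h1 : pointBump v x ≥ 1 - ‖x - v‖ / (‖v‖ + 1) := le_max_right _ _
    rw [hχ, hn, ge_iff_le, sub_nonpos, one_le_div hR] at h1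
    linarith
  · change pointBump v x = 1 - ‖x - v‖ / (‖v‖ + 1) at hχ
    have h1 : 1 - pointBump v x = ‖x - v‖ / (‖v‖ + 1) := by rw [hχ]; ring
    rw [h1, abs_of_nonneg (by positivity), div_mul_eq_mul_div, eq_div_iff hR.ne'] at hn
    have h2 : ‖x - v‖ = 0 := by linarith
    exact sub_eq_zero.1 (norm_eq_zero.1 h2)

/-- The map of `Z` that is `(x, b) ↦ (x - c χ(x) v, b)` in the chart `g`, with `χ` a bump function
at `v`. -/
noncomputable def chartPush (g : E × B → Z) (v : E) (c : ℝ) : Z → Z :=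
  Function.extend g (fun p => g (p.1 - (c * pointBump v p.1) • v, p.2)) id

theorem chartPush_apply (hg : Function.Injective g) (v : E) (c : ℝ) (p : E × B) :
    chartPush g v c (g p) = g (p.1 - (c * pointBump v p.1) • v, p.2) :=
  hg.extend_apply _ _ _

theorem chartPush_of_notMem {z : Z} (v : E) (c : ℝ) (hz : z ∉ Set.range g) :
    chartPush g v c z = z :=
  Function.extend_apply' _ _ _ hz

theorem chartPush_zero (hg : Function.Injective g) (v : E) (z : Z) : chartPush g v 0 z = z := by
  by_cases h : z ∈ Set.range g
  · obtain ⟨p, rfl⟩ := h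
    rw [chartPush_apply hg, zero_mul, zero_smul, sub_zero]
  · exact chartPush_of_notMem v 0 h

theorem chartPush_one_ne (hg : Function.Injective g) {v : E} {b : B} {z : Z} (hz : z ≠ g (v, b)) :
    chartPush g v 1 z ≠ g (0, b) := by
  by_cases h : z ∈ Set.range g
  · obtain ⟨p, rfl⟩ := h
    rw [chartPush_apply hg, one_mul]
    intro h
    have h' := hg h
    apply hz
    rw [← sub_pointBump_smul_eq_zero (congrArg Prod.fst h'), ← show p.2 = b from congrArg Prod.snd h']
  · rw [chartPush_of_notMem v 1 h]
    rintro rfl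
    exact h ⟨_, rfl⟩

variable [TopologicalSpace Z] [T2Space Z] [TopologicalSpace B] [CompactSpace B]

theorem continuous_chartPush [FiniteDimensional ℝ E] (hg : IsOpenEmbedding g) (v : E) :
    Continuous fun q : ℝ × Z => chartPush g v q.1 q.2 := by
  have := FiniteDimensional.proper_real E
  rw [continuous_iff_continuousAt]
  rintro ⟨c, z⟩
  by_cases h : z ∈ Set.range g
  · obtain ⟨p, rfl⟩ := h
    change ContinuousAt _ (Prod.map id g (c, p))
    rw [← (IsOpenEmbedding.id.prodMap hg).continuousAt_iff]
    have : (fun q : ℝ × Z => chartPush g v q.1 q.2) ∘ Prod.map id g =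
        fun q => g (q.2.1 - (q.1 * max 0 (1 - ‖q.2.1 - v‖ / (‖v‖ + 1))) • v, q.2.2) :=
      funext fun q => chartPush_apply hg.injective _ _ _
    rw [this]
    have hc := hg.continuous
    fun_prop
  · have hc : IsClosed (g '' (closedBall v (‖v‖ + 1) ×ˢ Set.univ)) :=
      (((isCompact_closedBall _ _).prod isCompact_univ).image hg.continuous).isClosed
    have hz' : (g '' (closedBall v (‖v‖ + 1) ×ˢ Set.univ))ᶜ ∈ 𝓝 z :=
      hc.isOpen_compl.mem_nhds fun h' => h (Set.image_subset_range _ _ h')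
    refine continuousAt_snd.congr ?_
    filter_upwards [continuousAt_snd.preimage_mem_nhds hz'] with q hq
    by_cases hr : q.2 ∈ Set.range g
    · obtain ⟨p, hp⟩ := hr
      rw [← hp, chartPush_apply hg.injective]
      have : pointBump v p.1 = 0 := by
        rw [pointBump, max_eq_left]
        rw [sub_nonpos, one_le_div (by positivity)]
        by_contra! hlt
        exact hq ⟨p, ⟨mem_closedBall_iff_norm.2 hlt.le, trivial⟩, hp⟩
      rw [this, mul_zero, zero_smul, sub_zero]
    · exact (chartPush_of_notMem v _ hr).symm

/-- The inclusion of the complement of a point. -/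
def complIncl (z : Z) : C(({z}ᶜ : Set Z), Z) := ⟨Subtype.val, continuous_subtype_val⟩

/-- A class that vanishes off the point `g (0, b)` of a chart vanishes off `g (v, b)`, since a map
homotopic to the identity moves the complement of the second point into that of the first. -/
theorem pull_complIncl_eq_zero [FiniteDimensional ℝ E] (hg : IsOpenEmbedding g) (v : E) (b : B)
    {k : ℕ} (α : H Z k) (h0 : pull (complIncl (g (0, b))) k α = 0) :
    pull (complIncl (g (v, b))) k α = 0 := by
  have hc := continuous_chartPush hg v
  let f : C(Z, Z) := ⟨chartPush g v 1, hc.comp (by fun_prop : Continuous fun z : Z => ((1 : ℝ), z))⟩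
  have hf : (ContinuousMap.id Z).Homotopic f :=
    homotopic_of_continuous (fun q => chartPush g v q.1 q.2)
      (hc.comp (by fun_prop : Continuous fun q : unitInterval × Z => ((q.1 : ℝ), q.2)))
      (fun z => chartPush_zero hg.injective v z) fun z => rfl
  let f' : C(({g (v, b)}ᶜ : Set Z), ({g (0, b)}ᶜ : Set Z)) :=
    ⟨fun z => ⟨f z, chartPush_one_ne hg.injective z.2⟩, by fun_prop⟩
  have h1 : α = pull f k α := by rw [← pull_eq_of_homotopic hf, pull_id]
  rw [h1, ← pull_comp]
  change pull ((complIncl (g (0, b))).comp f') k α = 0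
  rw [pull_comp, h0, map_zero]

end Transport

/-! ### Complements of coordinate subspace arrangements -/

section Arrangement

variable {J : Type} [Fintype J] [DecidableEq J]

/-- The complement of a coordinate subspace arrangement: the points of `ℂ^J` whose set of
vanishing coordinates is a simplex of `K`, with the coordinates in `S` fixed to be `1`. -/
def arrangement (K : Set (Set J)) (S : Finset J) : Set (J → ℂ) :=
  {z | (∀ F ∈ S, z F = 1) ∧ {F | z F = 0} ∈ K}

/-- The sets that are simplices of `K` after adding the vertex `F`. -/
def starComplex (K : Set (Set J)) (F : J) : Set (Set J) := {σ | insert F σ ∈ K}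

omit [Fintype J] [DecidableEq J] in
theorem isLowerSet_starComplex {K : Set (Set J)} (hK : IsLowerSet K) (F : J) :
    IsLowerSet (starComplex K F) :=
  fun _ _ h hσ => hK (Set.insert_subset_insert h) hσ

omit [DecidableEq J] in
theorem isOpen_zeroSet_mem {K : Set (Set J)} (hK : IsLowerSet K) :
    IsOpen {z : J → ℂ | {F | z F = 0} ∈ K} := by
  have : {z : J → ℂ | {F | z F = 0} ∈ K} = ⋃ σ ∈ K, ⋂ F ∈ σᶜ, {z | z F ≠ 0} := by
    ext z
    simp only [Set.mem_iUnion, Set.mem_iInter, Set.mem_ofPred_eq, Set.mem_compl_iff, exists_prop]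
    constructor
    · exact fun h => ⟨_, h, fun F hF => hF⟩
    · rintro ⟨σ, hσ, h⟩
      exact hK (fun F (hF : z F = 0) => by_contra fun hn => h F hn hF) hσ
  rw [this]
  refine isOpen_biUnion fun σ _ => Set.Finite.isOpen_biInter (Set.toFinite _) fun F _ => ?_
  exact isOpen_ne.preimage (continuous_apply F)

/-- The part of the arrangement complement where the coordinate `F` does not vanish. -/
def arrangementUnits (K : Set (Set J)) (S : Finset J) (F : J) : Set (J → ℂ) :=
  {z ∈ arrangement K S | z F ≠ 0}

/-- The part of the arrangement complement where the coordinate `F` may be changed to `0`. -/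
def arrangementStar (K : Set (Set J)) (S : Finset J) (F : J) : Set (J → ℂ) :=
  {z | (∀ G ∈ S, z G = 1) ∧ insert F {G | z G = 0} ∈ K}

omit [Fintype J] in
theorem setOf_update_one (z : J → ℂ) (F : J) :
    {G | Function.update z F 1 G = 0} = {G | z G = 0} \ {F} := by
  ext G
  by_cases h : G = F
  · subst h; simp
  · simp [h]

omit [Fintype J] in
theorem update_mem_arrangement {K : Set (Set J)} (hK : IsLowerSet K) {S : Finset J} {F : J}
    {z : J → ℂ} (hz : z ∈ arrangement K S) :
    Function.update z F 1 ∈ arrangement K (insert F S) := by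
  refine ⟨fun G hG => ?_, ?_⟩
  · by_cases h : G = F
    · subst h; simp
    · rw [Function.update_of_ne h]
      exact hz.1 G ((Finset.mem_insert.1 hG).resolve_left h)
  · rw [setOf_update_one]
    exact hK Set.sdiff_subset hz.2

omit [Fintype J] in
/-- The coordinate `F` splits off where it does not vanish. -/
theorem exists_homeomorph_units {K : Set (Set J)} (hK : IsLowerSet K) {S : Finset J} {F : J}
    (hF : F ∉ S) :
    Nonempty (arrangementUnits K S F ≃ₜ slab (arrangement K (insert F S)) {0}ᶜ) := by
  refine ⟨⟨⟨fun z => ⟨(⟨Function.update z.1 F 1, update_mem_arrangement hK z.2.1⟩, z.1 F), z.2.2⟩,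
    fun p => ⟨Function.update p.1.1.1 F p.1.2, ⟨fun G hG => ?_, ?_⟩, ?_⟩, ?_, ?_⟩, ?_, ?_⟩⟩
  · rw [Function.update_of_ne (fun h : G = F => hF (h ▸ hG))]
    exact p.1.1.2.1 G (Finset.mem_insert_of_mem hG)
  · have hp : p.1.2 ≠ 0 := p.2
    refine hK ?_ p.1.1.2.2
    intro G (hG : Function.update p.1.1.1 F p.1.2 G = 0)
    by_cases h : G = F
    · subst h
      rw [Function.update_self] at hG
      exact absurd hG hp
    · rwa [Function.update_of_ne h] at hG
  · rw [Function.update_self]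
    exact p.2
  · intro z
    apply Subtype.ext
    simp
  · rintro ⟨⟨⟨y, hy⟩, w⟩, hw⟩
    apply Subtype.ext
    have hyF : y F = 1 := hy.1 F (Finset.mem_insert_self _ _)
    simp only [Function.update_self, Function.update_idem, Prod.mk.injEq, and_true,
      Subtype.mk.injEq]
    rw [← hyF, Function.update_eq_self]
  · exact Continuous.subtype_mk (Continuous.prodMk (Continuous.subtype_mk (by fun_prop) _)
      ((continuous_apply F).comp continuous_subtype_val)) _
  · exact Continuous.subtype_mk (by fun_prop) _

theorem eq_zero_of_slab_eq_zero {Y : Type} [TopologicalSpace Y] {k : ℕ}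
    (h₁ : ∀ a : H Y (k + 1), a = 0) (h₀ : ∀ a : H Y k, a = 0) (α : H (slab Y {0}ᶜ) (k + 1)) :
    α = 0 := by
  obtain ⟨a, b, rfl⟩ := exists_eq_windingClass k α
  rw [h₁ a, h₀ b, map_zero, map_zero, map_zero, AddMonoidHom.zero_apply, add_zero]

omit [Fintype J] in
theorem arrangementUnits_eq_zero {K : Set (Set J)} (hK : IsLowerSet K) {S : Finset J} {F : J} (hF : F ∉ S)
    {k : ℕ} (h₁ : ∀ a : H (arrangement K (insert F S)) (k + 1), a = 0)
    (h₀ : ∀ a : H (arrangement K (insert F S)) k, a = 0)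
    (α : H (arrangementUnits K S F) (k + 1)) : α = 0 := by
  obtain ⟨f⟩ := exists_homeomorph_units hK hF
  obtain ⟨β, rfl⟩ := (pull_homeomorph_bijective f (k + 1)).2 α
  rw [eq_zero_of_slab_eq_zero h₁ h₀ β, map_zero]

omit [Fintype J] in
theorem arrangementStar_eq_zero {K : Set (Set J)} (hK : IsLowerSet K) {S : Finset J} {F : J} (hF : F ∉ S)
    {k : ℕ} (h : ∀ a : H (arrangement (starComplex K F) (insert F S)) k, a = 0)
    (α : H (arrangementStar K S F) k) : α = 0 := by
  have hmem (z : arrangementStar K S F) (w : ℂ) :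
      Function.update z.1 F w ∈ arrangementStar K S F := by
    refine ⟨fun G hG => ?_, hK ?_ z.2.2⟩
    · rw [Function.update_of_ne (fun h : G = F => hF (h ▸ hG))]
      exact z.2.1 G hG
    · refine Set.insert_subset (Set.mem_insert _ _) fun G (hG : Function.update z.1 F w G = 0) => ?_
      by_cases hGF : G = F
      · exact Or.inl hGF
      · rw [Function.update_of_ne hGF] at hG
        exact Or.inr hG
  let p : C(arrangementStar K S F, arrangement (starComplex K F) (insert F S)) :=
    ⟨fun z => ⟨Function.update z.1 F 1, by
      refine ⟨fun G hG => ?_, ?_⟩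
      · by_cases h : G = F
        · subst h; simp
        · rw [Function.update_of_ne h]
          exact z.2.1 G ((Finset.mem_insert.1 hG).resolve_left h)
      · rw [setOf_update_one]
        exact hK (Set.insert_subset_insert Set.sdiff_subset) z.2.2⟩, by fun_prop⟩
  let s : C(arrangement (starComplex K F) (insert F S), arrangementStar K S F) :=
    ⟨fun y => ⟨y.1, fun G hG => y.2.1 G (Finset.mem_insert_of_mem hG), y.2.2⟩, by fun_prop⟩
  have hsp : (ContinuousMap.id _).Homotopic (s.comp p) := by
    have hc : Continuous fun q : unitInterval × arrangementStar K S F => q.2.1 F :=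
      (continuous_apply F).comp (continuous_subtype_val.comp continuous_snd)
    refine homotopic_of_continuous (fun q => ⟨Function.update q.2.1 F
      ((1 - (q.1 : ℝ) : ℂ) * q.2.1 F + (q.1 : ℝ)), hmem q.2 _⟩) (Continuous.subtype_mk
        ((continuous_subtype_val.comp continuous_snd).update F (by fun_prop)) _) ?_ ?_
    · intro z
      apply Subtype.ext
      simp
    · intro z
      apply Subtype.ext
      simp [s, p]
  rw [← pull_id k α, pull_eq_of_homotopic hsp, pull_comp, h (pull s k α), map_zero]

omit [DecidableEq J] in
theorem isOpenUnion_arrangement {K : Set (Set J)} (hK : IsLowerSet K) (S : Finset J) (F : J) :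
    IsOpenUnion (arrangement K S) (arrangementUnits K S F) (arrangementStar K S F)
      (arrangementUnits (starComplex K F) S F) := by
  refine ⟨?_, ?_, ⟨{z | z F ≠ 0}, isOpen_ne.preimage (continuous_apply F), rfl⟩,
    ⟨{z | {G | z G = 0} ∈ starComplex K F}, isOpen_zeroSet_mem (isLowerSet_starComplex hK F), ?_⟩⟩
  · ext z
    constructor
    · rintro (h | h)
      · exact h.1
      · exact ⟨h.1, hK (Set.subset_insert _ _) h.2⟩
    · intro h
      by_cases hz : z F = 0
      · refine Or.inr ⟨h.1, ?_⟩
        rw [Set.insert_eq_of_mem (show F ∈ {G | z G = 0} from hz)]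
        exact h.2
      · exact Or.inl ⟨h, hz⟩
  · ext z
    constructor
    · exact fun h => ⟨⟨h.1.1.1, h.2.2⟩, h.1.2⟩
    · exact fun h => ⟨⟨⟨h.1.1, hK (Set.subset_insert _ _) h.1.2⟩, h.2⟩, h.1.1, h.1.2⟩
  · ext z
    constructor
    · exact fun h => ⟨h.1.1, h.2⟩
    · exact fun h => ⟨⟨h.1, hK (Set.subset_insert _ _) h.2⟩, h.2⟩

/-- The cohomology of the complement of a coordinate subspace arrangement vanishes above the
dimension of the associated moment-angle complex. The arrangement complement is covered by the open
set where a coordinate `F` does not vanish and the set where it may vanish; these sets and their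
intersection are, up to homotopy, arrangement complements with fewer free coordinates, the first
and the third times `ℂˣ`. -/
theorem arrangement_eq_zero (N : ℕ) {K : Set (Set J)} (hK : IsLowerSet K) {S : Finset J}
    (hS : Sᶜ.card = N) {j : ℕ} (hj : ∀ σ ∈ K, N + (σ \ S).ncard < j)
    (a : H (arrangement K S) j) : a = 0 := by
  induction N generalizing K S j with
  | zero =>
    rcases isEmpty_or_nonempty (arrangement K S) with h | ⟨⟨z, hz⟩⟩
    · exact eq_zero_of_isEmpty a
    · have hS' : ∀ F, F ∈ S := by
        rw [Finset.card_eq_zero, Finset.compl_eq_empty_iff] at hS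
        simp [hS]
      obtain ⟨j, rfl⟩ := Nat.exists_eq_succ_of_ne_zero (Nat.ne_zero_of_lt (hj _ hz.2))
      have : Unique (arrangement K S) :=
        { default := ⟨z, hz⟩
          uniq := fun y => Subtype.ext (funext fun F =>
            (y.2.1 F (hS' F)).trans (hz.1 F (hS' F)).symm) }
      exact eq_zero_of_contractible a
  | succ N ih =>
    rcases isEmpty_or_nonempty (arrangement K S) with h | ⟨⟨z, hz⟩⟩
    · exact eq_zero_of_isEmpty a
    · obtain ⟨i, rfl⟩ : ∃ i, j = i + 1 + 1 := ⟨j - 2, by have := hj _ hz.2; omega⟩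
      obtain ⟨F, hF⟩ : Sᶜ.Nonempty := Finset.card_pos.1 (by omega)
      have hFS : F ∉ S := Finset.mem_compl.1 hF
      have hS' : (insert F S)ᶜ.card = N := by
        rw [Finset.compl_insert, Finset.card_erase_of_mem hF, hS, Nat.add_sub_cancel]
      have h₁ (σ) (hσ : σ ∈ K) : N + (σ \ (insert F S : Finset J)).ncard < i + 1 := by
        have := hj σ hσ
        have hle : (σ \ (insert F S : Finset J)).ncard ≤ (σ \ S).ncard :=
          Set.ncard_le_ncard (Set.sdiff_subset_sdiff_right (by simp)) (Set.toFinite _)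
        omega
      have h₂ (σ) (hσ : σ ∈ starComplex K F) : N + (σ \ (insert F S : Finset J)).ncard < i := by
        have := hj _ hσ
        have hle : (σ \ (insert F S : Finset J)).ncard + 1 ≤ (insert F σ \ S).ncard := by
          rw [← Set.ncard_insert_of_notMem (a := F) (by simp) (Set.toFinite _)]
          refine Set.ncard_le_ncard ?_ (Set.toFinite _)
          refine Set.insert_subset ⟨Set.mem_insert _ _, hFS⟩ ?_
          exact Set.sdiff_subset_sdiff (Set.subset_insert _ _) (by simp)
        omega
      have hK' := isLowerSet_starComplex hK F
      have h := isOpenUnion_arrangement hK S F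
      obtain ⟨β, hβ⟩ := h.exists_connecting_of_res_eq_zero (i + 1) a
        (arrangementUnits_eq_zero hK hFS (ih hK hS' fun σ hσ => (h₁ σ hσ).trans (by omega))
          (ih hK hS' h₁) _)
        (arrangementStar_eq_zero hK hFS (ih hK' hS' fun σ hσ => (h₂ σ hσ).trans (by omega)) _)
      have hβ0 : β = 0 := arrangementUnits_eq_zero hK' hFS
        (ih hK' hS' fun σ hσ => (h₂ σ hσ).trans (by omega)) (ih hK' hS' h₂) β
      rw [hβ0] at hβ
      exact hβ.eq_zero

end Arrangement

/-! ### The top cohomology of a polyhedral product off a point of the torus -/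

section PolyDisc

open scoped NNReal

variable {J : Type} [Fintype J]

/-- The polyhedral product of the pairs `(D², S¹)`: the points of the polydisc whose set of
coordinates off the unit circle is a simplex of `K`. -/
def polyDisc (K : Set (Set J)) : Set (J → ℂ) := {z | (∀ F, ‖z F‖ ≤ 1) ∧ {F | ‖z F‖ < 1} ∈ K}

/-- The subset of `polyDisc K` where the coordinates in `S` are equal to `1`. -/
def polyDiscOne (K : Set (Set J)) (S : Finset J) : Set (J → ℂ) :=
  {z ∈ polyDisc K | ∀ F ∈ S, z F = 1}

open Classical in
/-- The largest product of the numbers `min 1 |z F|` over the complement of a simplex. -/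
noncomputable def simplexDepth (K : Set (Set J)) (z : J → ℂ) : ℝ≥0 :=
  Finset.univ.sup fun σ : K => ∏ F, if F ∈ σ.1 then 1 else min 1 ‖z F‖₊

theorem continuous_simplexDepth (K : Set (Set J)) : Continuous (simplexDepth K) := by
  classical
  refine Continuous.finset_sup_apply fun σ _ => continuous_finsetProd _ fun F _ => ?_
  split_ifs
  · exact continuous_const
  · fun_prop

theorem simplexDepth_le_one (K : Set (Set J)) (z : J → ℂ) : simplexDepth K z ≤ 1 := by
  classical
  refine Finset.sup_le fun σ _ => Finset.prod_le_one' fun F _ => ?_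
  split_ifs
  · exact le_rfl
  · exact min_le_left _ _

theorem simplexDepth_pos {K : Set (Set J)} {z : J → ℂ} (hz : {F | z F = 0} ∈ K) :
    0 < simplexDepth K z := by
  classical
  refine lt_of_lt_of_le (Finset.prod_pos fun F _ => ?_)
    (Finset.le_sup (f := fun σ : K => ∏ F, if F ∈ σ.1 then 1 else min 1 ‖z F‖₊)
      (Finset.mem_univ ⟨_, hz⟩))
  split_ifs with h
  · exact one_pos
  · exact lt_min one_pos (nnnorm_pos.2 h)

theorem simplexDepth_eq_one {K : Set (Set J)} {z : J → ℂ} (hz : z ∈ polyDisc K) :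
    simplexDepth K z = 1 := by
  classical
  refine le_antisymm (simplexDepth_le_one K z) ?_
  refine le_trans (le_of_eq (Finset.prod_eq_one fun F _ => ?_).symm)
    (Finset.le_sup (f := fun σ : K => ∏ F, if F ∈ σ.1 then 1 else min 1 ‖z F‖₊)
      (Finset.mem_univ ⟨_, hz.2⟩))
  split_ifs with h
  · rfl
  · exact min_eq_left (not_lt.1 h)

/-- The coordinates smaller than the depth lie in the simplex for which the depth is attained. -/
theorem setOf_lt_simplexDepth_mem {K : Set (Set J)} (hK : IsLowerSet K) {z : J → ℂ}
    (hz : {F | z F = 0} ∈ K) : {F | ‖z F‖₊ < simplexDepth K z} ∈ K := by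
  classical
  have : Nonempty K := ⟨⟨_, hz⟩⟩
  obtain ⟨σ, -, hσ⟩ := Finset.exists_mem_eq_sup (Finset.univ : Finset K) Finset.univ_nonempty
    (fun σ : K => ∏ F, if F ∈ σ.1 then 1 else min 1 ‖z F‖₊)
  refine hK (fun F (hF : ‖z F‖₊ < simplexDepth K z) => ?_) σ.2
  by_contra hFσ
  refine hF.not_ge ?_
  rw [simplexDepth, hσ]
  have h1 : ∀ G ∈ Finset.univ, (if G ∈ σ.1 then 1 else min 1 ‖z G‖₊) ≤ 1 := by
    intro G _
    split_ifs
    · exact le_rfl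
    · exact min_le_left _ _
  refine (Finset.prod_le_prod_of_subset_of_le_one' (Finset.subset_univ {F}) fun G hG _ => h1 G hG).trans ?_
  rw [Finset.prod_singleton, if_neg hFσ]
  exact min_le_right _ _

/-- `polyDiscOne K S` is a retract of an arrangement complement: divide each coordinate `z F` by the
maximum of its norm and the depth of `z`, a number that is `1` on the polyhedral product. -/
theorem exists_retraction {K : Set (Set J)} (hK : IsLowerSet K) (S : Finset J) :
    ∃ (i : C(polyDiscOne K S, arrangement K S)) (r : C(arrangement K S, polyDiscOne K S)),
      r.comp i = ContinuousMap.id _ := by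
  have hpos (z : arrangement K S) (F : J) : 0 < max ‖z.1 F‖₊ (simplexDepth K z.1) :=
    lt_max_of_lt_right (simplexDepth_pos z.2.2)
  have hn (z : arrangement K S) (F : J) :
      ‖z.1 F / ((max ‖z.1 F‖₊ (simplexDepth K z.1) : ℝ≥0) : ℂ)‖₊ =
        ‖z.1 F‖₊ / max ‖z.1 F‖₊ (simplexDepth K z.1) := by
    rw [nnnorm_div]
    congr 1
    ext
    simp
  have hc (F : J) : Continuous fun z : arrangement K S => z.1 F :=
    (continuous_apply F).comp continuous_subtype_val
  refine ⟨⟨fun z => ⟨z.1, z.2.2, hK (fun F (hF : z.1 F = 0) => ?_) z.2.1.2⟩, by fun_prop⟩,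
    ⟨fun z => ⟨fun F => z.1 F / ((max ‖z.1 F‖₊ (simplexDepth K z.1) : ℝ≥0) : ℂ),
      ⟨fun F => ?_, hK ?_ (setOf_lt_simplexDepth_mem hK z.2.2)⟩, fun F hF => ?_⟩, ?_⟩, ?_⟩
  · change ‖z.1 F‖ < 1
    rw [hF, norm_zero]
    exact one_pos
  · rw [← coe_nnnorm, hn, ← NNReal.coe_one, NNReal.coe_le_coe]
    exact div_le_one_of_le₀ (le_max_left _ _) zero_le
  · intro F (hF : ‖_‖ < 1)
    rw [← coe_nnnorm, hn, ← NNReal.coe_one, NNReal.coe_lt_coe, div_lt_one (hpos z F),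
      lt_max_iff] at hF
    exact hF.resolve_left (lt_irrefl _)
  · have h1 : z.1 F = 1 := z.2.1 F hF
    simp [h1, simplexDepth_le_one]
  · refine Continuous.subtype_mk (continuous_pi fun F => (hc F).div ?_ fun z => ?_) _
    · have := (continuous_simplexDepth K).comp (continuous_subtype_val (p := (· ∈ arrangement K S)))
      exact Complex.continuous_ofReal.comp (NNReal.continuous_coe.comp
        ((continuous_nnnorm.comp (hc F)).max this))
    · exact Complex.ofReal_ne_zero.2 (NNReal.coe_ne_zero.2 (hpos z F).ne')
  · ext1 z
    apply Subtype.ext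
    funext F
    change z.1 F / ((max ‖z.1 F‖₊ (simplexDepth K z.1) : ℝ≥0) : ℂ) = z.1 F
    rw [simplexDepth_eq_one z.2.1, max_eq_right (show ‖z.1 F‖₊ ≤ 1 from z.2.1.1 F)]
    simp

theorem polyDiscOne_eq_zero {K : Set (Set J)} (hK : IsLowerSet K) {S : Finset J} {j : ℕ}
    [DecidableEq J] (hj : ∀ σ ∈ K, Sᶜ.card + (σ \ S).ncard < j) (a : H (polyDiscOne K S) j) :
    a = 0 := by
  obtain ⟨i, r, hri⟩ := exists_retraction hK S
  rw [← pull_id j a, ← hri, pull_comp, arrangement_eq_zero _ hK rfl hj (pull r j a), map_zero]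

/-- A contraction of the closed disc without `-1` to `1` that preserves the circle: under the
Cayley transform it is multiplication by `s`. -/
noncomputable def cayleyPush (s : ℝ) (z : ℂ) : ℂ := (1 + z - s * (1 - z)) / (1 + z + s * (1 - z))

theorem normSq_cayley (s : ℝ) (z : ℂ) : Complex.normSq (1 + z + s * (1 - z)) =
    Complex.normSq (1 + z - s * (1 - z)) + 4 * s * (1 - Complex.normSq z) := by
  simp [Complex.normSq_apply]
  ring

theorem cayley_ne_zero {s : ℝ} (hs : 0 ≤ s) {z : ℂ} (hz : ‖z‖ ≤ 1) (hz' : z ≠ -1) :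
    1 + z + s * (1 - z) ≠ 0 := by
  intro h
  have h1 := normSq_cayley s z
  rw [h, map_zero] at h1
  have h2 : 0 ≤ 1 - Complex.normSq z := by
    rw [Complex.normSq_eq_norm_sq]
    nlinarith [norm_nonneg z]
  have h3 : Complex.normSq (1 + z - s * (1 - z)) = 0 := by
    have := Complex.normSq_nonneg (1 + z - s * (1 - z))
    have := mul_nonneg (mul_nonneg zero_le_four hs) h2
    linarith
  rw [Complex.normSq_eq_zero] at h3
  apply hz'
  linear_combination (h + h3) / 2

theorem norm_cayleyPush_le {s : ℝ} (hs : 0 ≤ s) {z : ℂ} (hz : ‖z‖ ≤ 1) : ‖cayleyPush s z‖ ≤ 1 := by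
  rw [cayleyPush, norm_div]
  refine div_le_one_of_le₀ ?_ (norm_nonneg _)
  have h1 := normSq_cayley s z
  have h2 : 0 ≤ 1 - Complex.normSq z := by
    rw [Complex.normSq_eq_norm_sq]
    nlinarith [norm_nonneg z]
  rw [Complex.normSq_eq_norm_sq, Complex.normSq_eq_norm_sq] at h1
  have := mul_nonneg (mul_nonneg zero_le_four hs) h2
  exact abs_le_of_sq_le_sq' (by linarith) (norm_nonneg _) |>.2

theorem norm_lt_one_of_cayleyPush {s : ℝ} (hs : 0 ≤ s) {z : ℂ} (hz : ‖z‖ ≤ 1) (hz' : z ≠ -1)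
    (h : ‖cayleyPush s z‖ < 1) : ‖z‖ < 1 := by
  refine lt_of_le_of_ne hz fun h1 => h.ne ?_
  have h2 := normSq_cayley s z
  rw [Complex.normSq_eq_norm_sq, Complex.normSq_eq_norm_sq, Complex.normSq_eq_norm_sq, h1] at h2
  have h3 : ‖1 + z + s * (1 - z)‖ = ‖1 + z - s * (1 - z)‖ :=
    (sq_eq_sq₀ (norm_nonneg _) (norm_nonneg _)).1 (by rw [h2]; ring)
  rw [cayleyPush, norm_div, ← h3, div_self (norm_ne_zero_iff.2 (cayley_ne_zero hs hz hz'))]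

theorem cayleyPush_ne {s : ℝ} (hs : 0 ≤ s) {z : ℂ} (hz : ‖z‖ ≤ 1) (hz' : z ≠ -1) :
    cayleyPush s z ≠ -1 := by
  intro h
  rw [cayleyPush, div_eq_iff (cayley_ne_zero hs hz hz')] at h
  apply hz'
  linear_combination h / 2

theorem cayleyPush_zero {z : ℂ} (hz' : z ≠ -1) : cayleyPush 0 z = 1 := by
  have : 1 + z ≠ 0 := fun h => hz' (by linear_combination h)
  simp [cayleyPush, this]

theorem cayleyPush_one (z : ℂ) : cayleyPush 1 z = z := by
  rw [cayleyPush, Complex.ofReal_one, div_eq_iff (by norm_num)]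
  ring

/-- The subset of `polyDisc K` where the coordinates in `S` differ from `-1`. -/
def polyDiscNe (K : Set (Set J)) (S : Finset J) : Set (J → ℂ) :=
  {z ∈ polyDisc K | ∀ F ∈ S, z F ≠ -1}

/-- The coordinates in `S` are contracted to `1` inside the disc without `-1`. -/
theorem polyDiscNe_eq_zero [DecidableEq J] {K : Set (Set J)} (hK : IsLowerSet K) {S : Finset J}
    {j : ℕ} (hj : ∀ σ ∈ K, Sᶜ.card + (σ \ S).ncard < j) (a : H (polyDiscNe K S) j) :
    a = 0 := by
  let f (s : ℝ) (z : J → ℂ) : J → ℂ := fun F => if F ∈ S then cayleyPush s (z F) else z F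
  have hf (s : ℝ) (hs : 0 ≤ s) (z) (hz : z ∈ polyDiscNe K S) : f s z ∈ polyDiscNe K S := by
    refine ⟨⟨fun F => ?_, hK (fun F (hF : ‖f s z F‖ < 1) => ?_) hz.1.2⟩, fun F hF => ?_⟩
    · by_cases h : F ∈ S
      · simp only [f, if_pos h]
        exact norm_cayleyPush_le hs (hz.1.1 F)
      · simp only [f, if_neg h]
        exact hz.1.1 F
    · by_cases h : F ∈ S
      · simp only [f, if_pos h] at hF
        exact norm_lt_one_of_cayleyPush hs (hz.1.1 F) (hz.2 F h) hF
      · simp only [f, if_neg h] at hF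
        exact hF
    · simp only [f, if_pos hF]
      exact cayleyPush_ne hs (hz.1.1 F) (hz.2 F hF)
  have hc : Continuous fun q : unitInterval × polyDiscNe K S => f q.1 q.2.1 := by
    refine continuous_pi fun F => ?_
    have h1 : Continuous fun q : unitInterval × polyDiscNe K S => q.2.1 F :=
      (continuous_apply F).comp (continuous_subtype_val.comp continuous_snd)
    by_cases h : F ∈ S
    · simp only [f, if_pos h, cayleyPush]
      exact Continuous.div (by fun_prop) (by fun_prop)
        fun q => cayley_ne_zero q.1.2.1 (q.2.2.1.1 F) (q.2.2.2 F h)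
    · simpa only [f, if_neg h] using h1
  have h0 (z) (hz : z ∈ polyDiscNe K S) : f 0 z ∈ polyDiscOne K S := by
    refine ⟨(hf 0 le_rfl z hz).1, fun F hF => ?_⟩
    simp only [f, if_pos hF]
    exact cayleyPush_zero (hz.2 F hF)
  let ρ : C(polyDiscNe K S, polyDiscOne K S) := ⟨fun z => ⟨f 0 z.1, h0 z.1 z.2⟩,
    Continuous.subtype_mk (hc.comp (by fun_prop :
      Continuous fun z : polyDiscNe K S => ((0 : unitInterval), z))) _⟩
  have hsub : polyDiscOne K S ⊆ polyDiscNe K S := fun z hz =>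
    ⟨hz.1, fun F hF => by rw [hz.2 F hF]; norm_num⟩
  have hh : ((incl hsub).comp ρ).Homotopic (ContinuousMap.id _) := by
    refine homotopic_of_continuous (fun q => ⟨f q.1 q.2.1, hf _ q.1.2.1 _ q.2.2⟩)
      (hc.subtype_mk _) (fun z => rfl) fun z => Subtype.ext (funext fun F => ?_)
    change (if F ∈ S then cayleyPush 1 (z.1 F) else z.1 F) = z.1 F
    rw [cayleyPush_one, ite_self]
  rw [← pull_id j a, ← pull_eq_of_homotopic hh, pull_comp,
    polyDiscOne_eq_zero hK hj (pull (incl hsub) j a), map_zero]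

/-- The subset of `polyDiscNe K S` where some coordinate in `R` differs from `-1`. -/
def polyDiscPunctured (K : Set (Set J)) (S R : Finset J) : Set (J → ℂ) :=
  {z ∈ polyDiscNe K S | ∃ F ∈ R, z F ≠ -1}

theorem isOpenUnion_polyDiscPunctured [DecidableEq J] (K : Set (Set J)) (S R : Finset J) (F : J) :
    IsOpenUnion (polyDiscPunctured K S (insert F R)) (polyDiscNe K (insert F S))
      (polyDiscPunctured K S R) (polyDiscPunctured K (insert F S) R) := by
  have ho (G : J) : IsOpen {z : J → ℂ | z G ≠ -1} := isOpen_ne.preimage (continuous_apply G)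
  refine ⟨?_, ?_, ⟨{z | z F ≠ -1}, ho F, ?_⟩, ⟨⋃ G ∈ R, {z | z G ≠ -1},
    isOpen_biUnion fun G _ => ho G, ?_⟩⟩
  · ext z
    simp only [polyDiscPunctured, polyDiscNe, Finset.mem_insert, forall_eq_or_imp,
      exists_eq_or_imp, Set.mem_union, Set.mem_ofPred_eq]
    tauto
  · ext z
    simp only [polyDiscPunctured, polyDiscNe, Finset.mem_insert, forall_eq_or_imp,
      Set.mem_inter_iff, Set.mem_ofPred_eq]
    tauto
  · ext z
    simp only [polyDiscPunctured, polyDiscNe, Finset.mem_insert, forall_eq_or_imp,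
      exists_eq_or_imp, Set.mem_inter_iff, Set.mem_ofPred_eq]
    tauto
  · ext z
    simp only [polyDiscPunctured, polyDiscNe, Finset.mem_insert,
      exists_eq_or_imp, Set.mem_inter_iff, Set.mem_ofPred_eq, Set.mem_iUnion, exists_prop]
    tauto

/-- Induction on `R` by the Mayer–Vietoris sequence: requiring one more coordinate to differ from `-1`
lowers by one the degree from which the cohomology vanishes. -/
theorem polyDiscPunctured_eq_zero [DecidableEq J] {K : Set (Set J)} (hK : IsLowerSet K) {n : ℕ}
    (hn : ∀ σ ∈ K, σ.ncard ≤ n) {R : Finset J} (hR : R.Nonempty) {S : Finset J}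
    (hRS : ∀ F ∈ R, F ∉ S) {i : ℕ} (hi : i + S.card = Fintype.card J + n)
    (a : H (polyDiscPunctured K S R) i) : a = 0 := by
  have hNe (S : Finset J) (F : J) (hF : F ∉ S) (i : ℕ) (hi : i + S.card = Fintype.card J + n)
      (a : H (polyDiscNe K (insert F S)) i) : a = 0 := by
    refine polyDiscNe_eq_zero hK (fun σ hσ => ?_) a
    have h1 := hn σ hσ
    have h2 : (σ \ (insert F S : Finset J)).ncard ≤ σ.ncard :=
      Set.ncard_le_ncard Set.sdiff_subset (Set.toFinite _)
    have h3 := Finset.card_compl_add_card (insert F S)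
    rw [Finset.card_insert_of_notMem hF] at h3
    omega
  induction hR using Finset.Nonempty.cons_induction generalizing S i with
  | singleton F =>
    have : polyDiscPunctured K S {F} = polyDiscNe K (insert F S) := by
      ext z
      simp only [polyDiscPunctured, polyDiscNe, Finset.mem_insert, forall_eq_or_imp,
        Finset.mem_singleton, exists_eq_left, Set.mem_ofPred_eq]
      tauto
    revert a
    rw [this]
    exact hNe S F (hRS F (Finset.mem_singleton_self F)) i hi
  | cons F R hF hR ih =>
    revert a
    rw [Finset.cons_eq_insert]
    intro a
    have hFS : F ∉ S := hRS F (Finset.mem_cons_self F R)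
    have hS : S.card < Fintype.card J := by
      have := Finset.card_le_univ (insert F S)
      rw [Finset.card_insert_of_notMem hFS] at this
      omega
    obtain ⟨i, rfl⟩ : ∃ i', i = i' + 1 := ⟨i - 1, by omega⟩
    have h := isOpenUnion_polyDiscPunctured K S R F
    obtain ⟨β, hβ⟩ := h.exists_connecting_of_res_eq_zero i a (hNe S F hFS _ hi _)
      (ih (fun G hG => hRS G (Finset.mem_cons_of_mem hG)) hi _)
    have hβ0 : β = 0 := by
      refine ih (fun G hG => ?_) (by rw [Finset.card_insert_of_notMem hFS]; omega) β
      rw [Finset.mem_insert, not_or]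
      exact ⟨fun h => hF (h ▸ hG), hRS G (Finset.mem_cons_of_mem hG)⟩
    rw [hβ0] at hβ
    exact hβ.eq_zero

/-- The top cohomology of a polyhedral product of pairs `(D², S¹)` vanishes off any point of the torus.
A rotation of the coordinates moves the point to the one with all coordinates `-1`. -/
theorem pull_complIncl_torus_eq_zero {K : Set (Set J)} (hK : IsLowerSet K) {n : ℕ}
    (hn : ∀ σ ∈ K, σ.ncard ≤ n) (hJ : Nonempty J) (p : polyDisc K) (hp : ∀ F, ‖p.1 F‖ = 1)
    (α : H (polyDisc K) (Fintype.card J + n)) : pull (complIncl p) _ α = 0 := by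
  classical
  have hrot (c : J → ℂ) (hc : ∀ F, ‖c F‖ = 1) (z) (hz : z ∈ polyDisc K) :
      (fun F => c F * z F) ∈ polyDisc K := by
    have hnorm (F : J) : ‖c F * z F‖ = ‖z F‖ := by rw [norm_mul, hc, one_mul]
    refine ⟨fun F => (hnorm F).trans_le (hz.1 F), ?_⟩
    simp only [hnorm]
    exact hz.2
  have hp0 (F) : p.1 F ≠ 0 := norm_ne_zero_iff.1 (by rw [hp]; exact one_ne_zero)
  have hcF (F : J) : Continuous fun z : ({p}ᶜ : Set (polyDisc K)) => z.1.1 F :=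
    (continuous_apply F).comp (continuous_subtype_val.comp continuous_subtype_val)
  have hcF' (F : J) : Continuous fun z : polyDiscPunctured K ∅ Finset.univ => z.1 F :=
    (continuous_apply F).comp continuous_subtype_val
  have hf (z : ({p}ᶜ : Set (polyDisc K))) :
      (fun F => -(p.1 F)⁻¹ * z.1.1 F) ∈ polyDiscPunctured K ∅ Finset.univ := by
    refine ⟨⟨hrot _ (fun F => by simp [hp]) _ z.1.2, by simp⟩, ?_⟩
    by_contra! h
    refine z.2 (Subtype.ext (funext fun F => ?_))
    have := h F (Finset.mem_univ F)
    rw [neg_mul, neg_inj, inv_mul_eq_iff_eq_mul₀ (hp0 F), mul_one] at this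
    exact this
  let f : C(({p}ᶜ : Set (polyDisc K)), polyDiscPunctured K ∅ Finset.univ) :=
    ⟨fun z => ⟨_, hf z⟩, Continuous.subtype_mk
      (continuous_pi fun F => continuous_const.mul (hcF F)) hf⟩
  have hg (z : polyDiscPunctured K ∅ Finset.univ) : (fun F => -p.1 F * z.1 F) ∈ polyDisc K :=
    hrot _ (fun F => by simp [hp]) _ z.2.1.1
  have hg' (z : polyDiscPunctured K ∅ Finset.univ) :
      (⟨_, hg z⟩ : polyDisc K) ∈ ({p}ᶜ : Set (polyDisc K)) := by
    intro h
    obtain ⟨F, -, hF⟩ := z.2.2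
    have := congrFun (congrArg Subtype.val h) F
    change -p.1 F * z.1 F = p.1 F at this
    apply hF
    apply mul_left_cancel₀ (hp0 F)
    linear_combination -this
  let g : C(polyDiscPunctured K ∅ Finset.univ, ({p}ᶜ : Set (polyDisc K))) :=
    ⟨fun z => ⟨⟨_, hg z⟩, hg' z⟩, Continuous.subtype_mk (Continuous.subtype_mk
      (continuous_pi fun F => continuous_const.mul (hcF' F)) hg) hg'⟩
  have hgf : g.comp f = ContinuousMap.id _ := by
    ext1 z
    apply Subtype.ext
    apply Subtype.ext
    funext F
    change -p.1 F * (-(p.1 F)⁻¹ * z.1.1 F) = z.1.1 F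
    rw [← mul_assoc, neg_mul_neg, mul_inv_cancel₀ (hp0 F), one_mul]
  rw [← pull_id _ (pull (complIncl p) _ α), ← hgf, pull_comp,
    polyDiscPunctured_eq_zero hK hn Finset.univ_nonempty (by simp) (by simp)
      (pull g _ (pull (complIncl p) _ α)), map_zero]

end PolyDisc

/-! ### The normal fan of a simple polytope -/

section PolarBody

open scoped InnerProductSpace

variable {n : ℕ} {J : Type}

/-- The convex body `{y | ⟪u F, y⟫ ≤ 1 for all F}` cut out by a family of normal vectors. -/
def polarBody (u : J → EuclideanSpace ℝ (Fin n)) : Set (EuclideanSpace ℝ (Fin n)) :=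
  {y | ∀ F, ⟪u F, y⟫_ℝ ≤ 1}

/-- The sets of normal vectors whose inequalities are simultaneously tight at some point. -/
def tightComplex (u : J → EuclideanSpace ℝ (Fin n)) : Set (Set J) :=
  {σ | ∃ y ∈ polarBody u, ∀ F ∈ σ, ⟪u F, y⟫_ℝ = 1}

/-- The family `u` of normal vectors describes a simple polytope with the origin in its interior:
`polarBody u` is compact and exactly `n` inequalities are tight at each vertex. -/
structure IsSimpleNormals (u : J → EuclideanSpace ℝ (Fin n)) : Prop where
  isCompact : IsCompact (polarBody u)
  ncard_tight : ∀ v ∈ (polarBody u).extremePoints ℝ, {F | ⟪u F, v⟫_ℝ = 1}.ncard = n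

variable {u : J → EuclideanSpace ℝ (Fin n)}

theorem isLowerSet_tightComplex : IsLowerSet (tightComplex u) :=
  fun _ _ h ⟨y, hy, h1⟩ => ⟨y, hy, fun F hF => h1 F (h hF)⟩

theorem zero_mem_polarBody : (0 : EuclideanSpace ℝ (Fin n)) ∈ polarBody u := fun F => by simp

/-- A linear form on the polytope attains its maximum at a vertex. -/
theorem IsSimpleNormals.exists_extremePoint_le (h : IsSimpleNormals u)
    (w : EuclideanSpace ℝ (Fin n)) :
    ∃ v ∈ (polarBody u).extremePoints ℝ, ∀ y ∈ polarBody u, ⟪w, y⟫_ℝ ≤ ⟪w, v⟫_ℝ := by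
  obtain ⟨x, hx, hmax⟩ := h.isCompact.exists_isMaxOn ⟨0, zero_mem_polarBody⟩
    (innerSL ℝ w).continuous.continuousOn
  have hE : IsExposed ℝ (polarBody u) ((innerSL ℝ w).toExposed (polarBody u)) :=
    ContinuousLinearMap.toExposed.isExposed
  obtain ⟨v, hv⟩ := (hE.isCompact h.isCompact).extremePoints_nonempty ⟨x, hx, hmax⟩
  refine ⟨v, hE.isExtreme.extremePoints_subset_extremePoints hv, fun y hy => ?_⟩
  exact (extremePoints_subset hv).2 y hy

theorem IsSimpleNormals.nonempty (h : IsSimpleNormals u) (hn : n ≠ 0) : Nonempty J := by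
  by_contra hJ
  rw [not_nonempty_iff] at hJ
  have h1 : polarBody u = Set.univ := Set.eq_univ_of_forall fun y F => hJ.elim F
  have : NeZero n := ⟨hn⟩
  exact noncompact_univ (EuclideanSpace ℝ (Fin n)) (h1 ▸ h.isCompact)

variable [Fintype J]

/-- A small move along `w` from a point of the body stays in the body if it does not violate the
tight inequalities. -/
theorem exists_add_smul_mem_polarBody {v w : EuclideanSpace ℝ (Fin n)} (hv : v ∈ polarBody u)
    (hw : ∀ F, ⟪u F, v⟫_ℝ = 1 → ⟪u F, w⟫_ℝ ≤ 0) : ∃ ε : ℝ, 0 < ε ∧ v + ε • w ∈ polarBody u := by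
  have h : ∀ F, ∀ᶠ ε : ℝ in nhdsWithin 0 (Set.Ioi 0), ⟪u F, v + ε • w⟫_ℝ ≤ 1 := by
    intro F
    by_cases hF : ⟪u F, v⟫_ℝ = 1
    · filter_upwards [self_mem_nhdsWithin] with ε hε
      rw [inner_add_right, inner_smul_right, hF]
      have := mul_nonpos_of_nonneg_of_nonpos (le_of_lt hε) (hw F hF)
      linarith
    · have h1 : ⟪u F, v⟫_ℝ < 1 := lt_of_le_of_ne (hv F) hF
      have h2 : Continuous fun ε : ℝ => ⟪u F, v + ε • w⟫_ℝ := by fun_prop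
      have h3 := (h2.tendsto 0).eventually_lt_const (u := 1) (by simpa using h1)
      exact (h3.filter_mono nhdsWithin_le_nhds).mono fun ε hε => hε.le
  obtain ⟨ε, hε, hε0⟩ := ((Filter.eventually_all.2 h).and self_mem_nhdsWithin).exists
  exact ⟨ε, hε0, hε⟩

/-- The normal vectors that are tight at a vertex span: a vector orthogonal to all of them would be
the direction of a segment in the body around the vertex. -/
theorem span_tight_eq_top {v : EuclideanSpace ℝ (Fin n)}
    (hv : v ∈ (polarBody u).extremePoints ℝ) :
    Submodule.span ℝ (Set.range fun F : {F | ⟪u F, v⟫_ℝ = 1} => u F) = ⊤ := by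
  rw [← Submodule.orthogonal_eq_bot_iff, Submodule.eq_bot_iff]
  intro w hw
  have hw' (F) (hF : ⟪u F, v⟫_ℝ = 1) : ⟪u F, w⟫_ℝ = 0 :=
    (Submodule.mem_orthogonal _ _).1 hw _ (Submodule.subset_span ⟨⟨F, hF⟩, rfl⟩)
  obtain ⟨ε, hε, h1⟩ := exists_add_smul_mem_polarBody (w := w) hv.1 fun F hF => (hw' F hF).le
  obtain ⟨δ, hδ, h2⟩ := exists_add_smul_mem_polarBody (w := -w) hv.1 fun F hF => by
    rw [inner_neg_right, hw' F hF, neg_zero]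
  have h3 : v ∈ openSegment ℝ (v + ε • w) (v + δ • -w) := by
    refine ⟨δ / (ε + δ), ε / (ε + δ), by positivity, by positivity, by field_simp; ring, ?_⟩
    rw [smul_add, smul_add, add_add_add_comm, ← add_smul, smul_neg, smul_neg, smul_smul,
      smul_smul, ← neg_smul, ← add_smul]
    have e1 : δ / (ε + δ) + ε / (ε + δ) = 1 := by field_simp; ring
    have e2 : δ / (ε + δ) * ε + -(ε / (ε + δ) * δ) = 0 := by ring
    rw [e1, e2, one_smul, zero_smul, add_zero]
  have h4 := hv.2 h1 h2 h3
  rw [add_eq_left, smul_eq_zero] at h4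
  exact h4.resolve_left hε.ne'

/-- The normal vectors that are tight at a vertex form a basis. -/
theorem IsSimpleNormals.tight_basis (h : IsSimpleNormals u) {v : EuclideanSpace ℝ (Fin n)}
    (hv : v ∈ (polarBody u).extremePoints ℝ) :
    LinearIndependent ℝ (fun F : {F | ⟪u F, v⟫_ℝ = 1} => u F) ∧
      Submodule.span ℝ (Set.range fun F : {F | ⟪u F, v⟫_ℝ = 1} => u F) = ⊤ := by
  classical
  have hspan := span_tight_eq_top hv
  refine ⟨linearIndependent_of_top_le_span_of_card_eq_finrank hspan.ge ?_, hspan⟩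
  rw [finrank_euclideanSpace_fin, ← Nat.card_eq_fintype_card]
  exact h.ncard_tight v hv

/-- A set of inequalities that are tight at a common point is tight at a common vertex. -/
theorem IsSimpleNormals.exists_extremePoint_tight (h : IsSimpleNormals u) {σ : Set J}
    (hσ : σ ∈ tightComplex u) :
    ∃ v ∈ (polarBody u).extremePoints ℝ, σ ⊆ {F | ⟪u F, v⟫_ℝ = 1} := by
  classical
  obtain ⟨y, hy, hyσ⟩ := hσ
  obtain ⟨v, hv, hmax⟩ := h.exists_extremePoint_le (∑ F with F ∈ σ, u F)
  refine ⟨v, hv, ?_⟩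
  have h1 := hmax y hy
  rw [sum_inner, sum_inner] at h1
  have h2 := (Finset.sum_eq_sum_iff_of_le (s := Finset.univ.filter (· ∈ σ))
    (f := fun F => ⟪u F, v⟫_ℝ) (g := fun F => ⟪u F, y⟫_ℝ) fun F hF => by
      rw [hyσ F (Finset.mem_filter.1 hF).2]
      exact hv.1 F).1 (le_antisymm (Finset.sum_le_sum fun F hF => by
        rw [hyσ F (Finset.mem_filter.1 hF).2]
        exact hv.1 F) h1)
  intro F hF
  exact (h2 F (by simpa using hF)).trans (hyσ F hF)

theorem IsSimpleNormals.ncard_le (h : IsSimpleNormals u) {σ : Set J} (hσ : σ ∈ tightComplex u) :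
    σ.ncard ≤ n := by
  obtain ⟨v, hv, h1⟩ := h.exists_extremePoint_tight hσ
  exact (Set.ncard_le_ncard h1 (Set.toFinite _)).trans (h.ncard_tight v hv).le

/-- The normal fan: the nonnegative coefficient vectors supported on a simplex. -/
def normalFan (u : J → EuclideanSpace ℝ (Fin n)) : Set (J → ℝ) :=
  {r | (∀ F, 0 ≤ r F) ∧ {F | r F ≠ 0} ∈ tightComplex u}

theorem isClosed_normalFan : IsClosed (normalFan u) := by
  have : normalFan u = {r | ∀ F, 0 ≤ r F} ∩
      ⋃ σ : tightComplex u, {r | ∀ F, F ∉ σ.1 → r F = 0} := by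
    ext r
    simp only [normalFan, Set.mem_inter_iff, Set.mem_iUnion, Set.mem_ofPred_eq]
    refine and_congr_right fun _ => ⟨fun h => ⟨⟨_, h⟩, fun F hF => not_not.1 hF⟩, ?_⟩
    rintro ⟨σ, hσ⟩
    exact isLowerSet_tightComplex (fun F hF => by_contra fun h => hF (hσ F h)) σ.2
  rw [this]
  refine IsClosed.inter ?_ (isClosed_iUnion_of_finite fun σ => ?_)
  · simp only [Set.ofPred_forall]
    exact isClosed_iInter fun F => isClosed_le continuous_const (continuous_apply F)
  · simp only [Set.ofPred_forall]
    exact isClosed_iInter fun F => isClosed_iInter fun _ =>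
      isClosed_eq (continuous_apply F) continuous_const

/-- The point of the normal fan with given coefficients. -/
def fanSum (u : J → EuclideanSpace ℝ (Fin n)) (r : J → ℝ) : EuclideanSpace ℝ (Fin n) :=
  ∑ F, r F • u F

theorem fanSum_eq_sum_subtype {r : J → ℝ} {s : Set J} [Fintype s] (h : ∀ F ∉ s, r F = 0) :
    fanSum u r = ∑ F : s, r F • u F :=
  (Fintype.sum_of_injective Subtype.val Subtype.val_injective _ _
    (fun F hF => by rw [h F (by simpa using hF), zero_smul]) fun _ => rfl).symm

theorem inner_fanSum (r : J → ℝ) (y : EuclideanSpace ℝ (Fin n)) :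
    ⟪fanSum u r, y⟫_ℝ = ∑ F, r F * ⟪u F, y⟫_ℝ := by
  simp [fanSum, sum_inner, real_inner_smul_left]

theorem exists_inner_fanSum_eq {r : J → ℝ} (hr : r ∈ normalFan u) :
    ∃ y ∈ polarBody u, ⟪fanSum u r, y⟫_ℝ = ∑ F, r F := by
  obtain ⟨y, hy, h1⟩ := hr.2
  refine ⟨y, hy, ?_⟩
  rw [inner_fanSum]
  refine Finset.sum_congr rfl fun F _ => ?_
  by_cases hF : r F = 0
  · rw [hF, zero_mul]
  · rw [h1 F hF, mul_one]

/-- The coefficients are supported on the inequalities tight at a maximizer of the linear form. -/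
theorem eq_zero_of_not_tight {r : J → ℝ} (hr : r ∈ normalFan u) {v : EuclideanSpace ℝ (Fin n)}
    (hv : v ∈ polarBody u) (hmax : ∀ y ∈ polarBody u, ⟪fanSum u r, y⟫_ℝ ≤ ⟪fanSum u r, v⟫_ℝ)
    {F : J} (hF : ⟪u F, v⟫_ℝ ≠ 1) : r F = 0 := by
  obtain ⟨y, hy, h1⟩ := exists_inner_fanSum_eq hr
  have h2 := hmax y hy
  rw [h1, inner_fanSum] at h2
  have h3 := (Finset.sum_eq_sum_iff_of_le fun F _ => mul_le_of_le_one_right (hr.1 F) (hv F)).1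
    (le_antisymm (Finset.sum_le_sum fun F _ => mul_le_of_le_one_right (hr.1 F) (hv F)) h2) F
    (Finset.mem_univ F)
  by_contra h4
  exact hF (mul_left_cancel₀ h4 (h3.trans (mul_one _).symm))

/-- A vector `w` determines its coefficients in the fan: they are supported on the inequalities that are
tight at a vertex maximizing `⟪w, ·⟫`, and there the normals are linearly independent. -/
theorem IsSimpleNormals.fanSum_injOn (h : IsSimpleNormals u) :
    Set.InjOn (fanSum u) (normalFan u) := by
  classical
  intro r hr r' hr' hrr
  obtain ⟨v, hv, hmax⟩ := h.exists_extremePoint_le (fanSum u r)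
  have h0 {r : J → ℝ} (hr : r ∈ normalFan u)
      (hmax : ∀ y ∈ polarBody u, ⟪fanSum u r, y⟫_ℝ ≤ ⟪fanSum u r, v⟫_ℝ) :
      fanSum u r = ∑ F : {F | ⟪u F, v⟫_ℝ = 1}, r F • u F :=
    fanSum_eq_sum_subtype fun F hF => eq_zero_of_not_tight hr hv.1 hmax hF
  have h1 := (Fintype.linearIndependent_iff.1 (h.tight_basis hv).1) (fun F => r F - r' F) (by
    simp only [sub_smul, Finset.sum_sub_distrib]
    rw [← h0 hr hmax, ← h0 hr' (hrr ▸ hmax), hrr, sub_self])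
  funext F
  by_cases hF : ⟪u F, v⟫_ℝ = 1
  · exact sub_eq_zero.1 (h1 ⟨F, hF⟩)
  · rw [eq_zero_of_not_tight hr hv.1 hmax hF, eq_zero_of_not_tight hr' hv.1 (hrr ▸ hmax) hF]

/-- The normal fan of a simple polytope is complete. If `v` is a vertex maximizing `⟪w, ·⟫`, a
negative coefficient of `w` in the basis of normals tight at `v` would give an edge of the polytope
at `v` along which `⟪w, ·⟫` increases. -/
theorem IsSimpleNormals.exists_fanSum_eq (h : IsSimpleNormals u) (w : EuclideanSpace ℝ (Fin n)) :
    ∃ r ∈ normalFan u, fanSum u r = w := by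
  classical
  obtain ⟨v, hv, hmax⟩ := h.exists_extremePoint_le w
  obtain ⟨hli, hsp⟩ := h.tight_basis hv
  let b := Module.Basis.mk hli hsp.ge
  let r : J → ℝ := fun F => if hF : ⟪u F, v⟫_ℝ = 1 then b.repr w ⟨F, hF⟩ else 0
  refine ⟨r, ⟨fun F => ?_, v, hv.1, fun F hF => ?_⟩, ?_⟩
  · by_cases hF : ⟪u F, v⟫_ℝ = 1
    swap
    · simp [r, hF]
    simp only [r, dif_pos hF]
    by_contra! hneg
    -- `f` represents minus the coordinate function of `F` in the basis `b`
    let f := (InnerProductSpace.toDual ℝ (EuclideanSpace ℝ (Fin n))).symm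
      (LinearMap.toContinuousLinearMap (-(b.coord ⟨F, hF⟩)))
    have hf (x) : ⟪x, f⟫_ℝ = -b.repr x ⟨F, hF⟩ := by
      rw [real_inner_comm, InnerProductSpace.toDual_symm_apply]
      rfl
    obtain ⟨ε, hε, h1⟩ := exists_add_smul_mem_polarBody (w := f) hv.1 fun G hG => by
      have : u G = b ⟨G, hG⟩ := (Module.Basis.mk_apply hli hsp.ge ⟨G, hG⟩).symm
      rw [hf, this, Module.Basis.repr_self, Finsupp.single_apply]
      split_ifs <;> norm_num
    have h2 := hmax _ h1
    rw [inner_add_right, inner_smul_right, hf] at h2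
    nlinarith
  · by_contra h1
    exact hF (dif_neg h1)
  · rw [fanSum_eq_sum_subtype (r := r) (s := {F | ⟪u F, v⟫_ℝ = 1}) fun F hF => dif_neg hF]
    refine Eq.trans (Finset.sum_congr rfl fun F _ => ?_) (b.sum_repr w)
    rw [Module.Basis.mk_apply]
    exact congrArg (· • u F) (dif_pos F.2)

theorem continuous_fanSum : Continuous (fanSum u) :=
  continuous_finsetSum _ fun F _ => (continuous_apply F).smul continuous_const

/-- Properness: the sum of the coefficients of `w` is the maximum of `⟪w, ·⟫` on the body, so it is
bounded by a multiple of `‖w‖`. -/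
theorem IsSimpleNormals.isCompact_preimage (h : IsSimpleNormals u)
    {C : Set (EuclideanSpace ℝ (Fin n))} (hC : IsCompact C) :
    IsCompact (normalFan u ∩ fanSum u ⁻¹' C) := by
  obtain ⟨R, hR⟩ := h.isCompact.isBounded.exists_norm_le
  obtain ⟨M, hM⟩ := hC.isBounded.exists_norm_le
  refine (isCompact_univ_pi fun F : J => isCompact_Icc (a := (0 : ℝ)) (b := M * R)).of_isClosed_subset
    (isClosed_normalFan.inter (hC.isClosed.preimage continuous_fanSum)) ?_
  rintro r ⟨hr, hrC⟩ F -
  obtain ⟨y, hy, h1⟩ := exists_inner_fanSum_eq hr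
  refine ⟨hr.1 F, (Finset.single_le_sum (fun G _ => hr.1 G) (Finset.mem_univ F)).trans ?_⟩
  rw [← h1]
  exact (real_inner_le_norm _ _).trans
    (mul_le_mul (hM _ hrC) (hR y hy) (norm_nonneg _) ((norm_nonneg _).trans (hM _ hrC)))

/-- The normal fan of a simple polytope is homeomorphic to the ambient space. -/
noncomputable def IsSimpleNormals.fanHomeomorph (h : IsSimpleNormals u) :
    normalFan u ≃ₜ EuclideanSpace ℝ (Fin n) :=
  (Equiv.ofBijective (fun r : normalFan u => fanSum u r)
    ⟨fun r r' hrr => Subtype.ext (h.fanSum_injOn r.2 r'.2 hrr), fun w =>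
      let ⟨r, hr, hw⟩ := h.exists_fanSum_eq w
      ⟨⟨r, hr⟩, hw⟩⟩).toHomeomorphOfContinuousClosed
    (continuous_fanSum.comp continuous_subtype_val) (by
      refine IsProperMap.isClosedMap (isProperMap_iff_isCompact_preimage.2
        ⟨continuous_fanSum.comp continuous_subtype_val, fun C hC => ?_⟩)
      rw [Subtype.isCompact_iff]
      exact (congrArg IsCompact (Subtype.image_preimage_coe (normalFan u) (fanSum u ⁻¹' C))).mpr
        (h.isCompact_preimage hC))

theorem IsSimpleNormals.fanHomeomorph_apply (h : IsSimpleNormals u) (r : normalFan u) :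
    h.fanHomeomorph r = fanSum u r := rfl

theorem IsSimpleNormals.fanHomeomorph_symm_zero (h : IsSimpleNormals u) :
    (h.fanHomeomorph.symm 0).1 = 0 := by
  have h0 : (0 : J → ℝ) ∈ normalFan u :=
    ⟨fun F => le_rfl, 0, zero_mem_polarBody, fun F hF => absurd rfl hF⟩
  rw [show h.fanHomeomorph.symm 0 = ⟨0, h0⟩ by
    rw [Homeomorph.symm_apply_eq, h.fanHomeomorph_apply]; simp [fanSum]]

end PolarBody

/-! ### Facet normals of a simple polytope -/

section SimplePolytope

open scoped InnerProductSpace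

variable {n : ℕ} {P : Set (EuclideanSpace ℝ (Fin n))}

theorem IsSimplePolytope.isCompact (hP : IsSimplePolytope P) : IsCompact P := by
  obtain ⟨V, hV, rfl⟩ := hP.exists_finite
  exact hV.isCompact_convexHull ℝ

theorem IsSimplePolytope.convex (hP : IsSimplePolytope P) : Convex ℝ P := by
  obtain ⟨V, hV, rfl⟩ := hP.exists_finite
  exact convex_convexHull ℝ V

theorem not_isFacet_zero {P F : Set (EuclideanSpace ℝ (Fin 0))} : ¬IsFacet P F :=
  fun h => Nat.succ_ne_zero _ h.2.2

/-- A simple polytope has finitely many facets, since each contains a vertex. -/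
theorem IsSimplePolytope.finite_facets (hP : IsSimplePolytope P) : {F | IsFacet P F}.Finite := by
  rcases eq_or_ne n 0 with rfl | hn
  · exact Set.Finite.subset Set.finite_empty fun F hF => not_isFacet_zero hF
  have hV : (P.extremePoints ℝ).Finite := by
    obtain ⟨V, hV, rfl⟩ := hP.exists_finite
    exact hV.subset extremePoints_convexHull_subset
  refine (hV.biUnion fun v hv => Set.finite_of_ncard_ne_zero
    (s := {F | IsFacet P F ∧ v ∈ F}) (by rwa [hP.simple v hv])).subset fun F hF => ?_
  obtain ⟨v, hv⟩ := (hF.1.isCompact hP.isCompact).extremePoints_nonempty hF.2.1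
  exact Set.mem_biUnion (hF.1.isExtreme.extremePoints_subset_extremePoints hv)
    ⟨hF, extremePoints_subset hv⟩

instance {P : Set (EuclideanSpace ℝ (Fin 0))} : IsEmpty (Facet P) :=
  ⟨fun F => not_isFacet_zero F.2⟩

theorem vectorSpan_eq_top (hP : IsSimplePolytope P) : vectorSpan ℝ P = ⊤ := by
  rw [← direction_affineSpan, hP.convex.interior_nonempty_iff_affineSpan_eq_top.1
    hP.interior_nonempty, AffineSubspace.direction_top]

/-- The supporting hyperplane of a facet, normalized at an interior point `c`. -/
theorem IsSimplePolytope.exists_normal (hP : IsSimplePolytope P) {c : EuclideanSpace ℝ (Fin n)}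
    (hc : c ∈ interior P) {F : Set (EuclideanSpace ℝ (Fin n))} (hF : IsFacet P F) :
    ∃ w, (∀ x ∈ P, ⟪w, x - c⟫_ℝ ≤ 1) ∧ F = {x ∈ P | ⟪w, x - c⟫_ℝ = 1} := by
  obtain ⟨l, hl⟩ := hF.1 hF.2.1
  obtain ⟨x₀, hx₀⟩ := hF.2.1
  rw [hl] at hx₀
  have hlt : l c < l x₀ := by
    refine lt_of_le_of_ne (hx₀.2 c (interior_subset hc)) fun h => ?_
    have hmax : IsLocalMax l c := by
      filter_upwards [mem_interior_iff_mem_nhds.1 hc] with y hy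
      rw [h]
      exact hx₀.2 y hy
    have h0 : l = 0 := by
      rw [← hmax.fderiv_eq_zero, ContinuousLinearMap.fderiv]
    have hFP : F = P := by
      rw [hl, h0]
      simp
    have h2 := hF.2.2
    rw [hFP, vectorSpan_eq_top hP, finrank_top, finrank_euclideanSpace_fin] at h2
    omega
  have hpos := sub_pos.2 hlt
  have hw (x) : ⟪(l x₀ - l c)⁻¹ • (InnerProductSpace.toDual ℝ (EuclideanSpace ℝ (Fin n))).symm l,
      x - c⟫_ℝ = (l x - l c) / (l x₀ - l c) := by
    rw [real_inner_smul_left, InnerProductSpace.toDual_symm_apply, map_sub]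
    ring
  refine ⟨(l x₀ - l c)⁻¹ • (InnerProductSpace.toDual ℝ (EuclideanSpace ℝ (Fin n))).symm l,
    fun x hx => ?_, ?_⟩
  rotate_left
  · ext x
    rw [hl]
    refine and_congr_right fun hx => ?_
    rw [hw, div_eq_one_iff_eq hpos.ne', sub_left_inj]
    exact ⟨fun h => le_antisymm (hx₀.2 x hx) (h x₀ hx₀.1), fun h y hy => h ▸ hx₀.2 y hy⟩
  · rw [hw, div_le_one hpos]
    exact sub_le_sub_right (hx₀.2 x hx) _

theorem inner_sub_le_one {V : Set (EuclideanSpace ℝ (Fin n))} {c w : EuclideanSpace ℝ (Fin n)} :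
    w ∈ polarBody (fun v : V => v.1 - c) ↔ ∀ x ∈ convexHull ℝ V, ⟪w, x - c⟫_ℝ ≤ 1 := by
  refine ⟨fun h x hx => ?_, fun h v => ?_⟩
  · have : convexHull ℝ V ⊆ {x | ⟪w, x⟫_ℝ ≤ 1 + ⟪w, c⟫_ℝ} :=
      convexHull_min (fun v hv => by
        have := h ⟨v, hv⟩
        rw [real_inner_comm, inner_sub_right] at this
        simpa using (by linarith : ⟪w, v⟫_ℝ ≤ 1 + ⟪w, c⟫_ℝ))
        (convex_halfSpace_le (innerSL ℝ w).isBoundedLinearMap.toIsLinearMap _)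
    have := this hx
    simp only [Set.mem_ofPred_eq] at this
    rw [inner_sub_right]
    linarith
  · rw [real_inner_comm]
    exact h v (subset_convexHull ℝ V v.2)

/-- The polar dual of a polytope with respect to an interior point is bounded. -/
theorem isCompact_polarBody_sub {V : Set (EuclideanSpace ℝ (Fin n))}
    {c : EuclideanSpace ℝ (Fin n)} (hc : c ∈ interior (convexHull ℝ V)) :
    IsCompact (polarBody fun v : V => v.1 - c) := by
  have hclosed : IsClosed (polarBody fun v : V => v.1 - c) := by
    simp only [polarBody, Set.ofPred_forall]
    exact isClosed_iInter fun v => isClosed_le (by fun_prop) continuous_const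
  obtain ⟨ε, hε, hball⟩ := Metric.isOpen_iff.1 isOpen_interior c hc
  refine Metric.isCompact_of_isClosed_isBounded hclosed
    (isBounded_iff_forall_norm_le.2 ⟨2 / ε, fun w hw => ?_⟩)
  rcases eq_or_ne w 0 with rfl | hw0
  · rw [norm_zero]
    positivity
  have hpos := norm_pos_iff.2 hw0
  have h1 := inner_sub_le_one.1 hw (c + (ε / 2 / ‖w‖) • w) (interior_subset (hball (by
    rw [Metric.mem_ball, dist_eq_norm, add_sub_cancel_left, norm_smul, Real.norm_of_nonneg
      (by positivity), div_mul_cancel₀ _ hpos.ne']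
    linarith)))
  rw [add_sub_cancel_left, inner_smul_right, real_inner_self_eq_norm_sq] at h1
  rw [le_div_iff₀ hε]
  have : ε / 2 / ‖w‖ * ‖w‖ ^ 2 = ‖w‖ * ε / 2 := by field_simp
  linarith

/-- A vertex of the polar dual is the normal vector of a facet, and it is determined by that facet. -/
theorem isFacet_of_extremePoint (hn : n ≠ 0) {V : Set (EuclideanSpace ℝ (Fin n))} (hV : V.Finite)
    {c w : EuclideanSpace ℝ (Fin n)}
    (hw : w ∈ (polarBody fun v : V => v.1 - c).extremePoints ℝ) :
    IsFacet (convexHull ℝ V) {x ∈ convexHull ℝ V | ⟪w, x - c⟫_ℝ = 1} ∧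
      ∀ w', (∀ x ∈ convexHull ℝ V, ⟪w, x - c⟫_ℝ = 1 → ⟪w', x - c⟫_ℝ = 1) → w' = w := by
  have : Fintype V := hV.fintype
  have hspan := span_tight_eq_top hw
  have hle := inner_sub_le_one.1 hw.1
  set T : Set (EuclideanSpace ℝ (Fin n)) := {x ∈ convexHull ℝ V | ⟪w, x - c⟫_ℝ = 1} with hT
  have hmem (v : {v : V | ⟪v.1 - c, w⟫_ℝ = 1}) : v.1.1 ∈ T :=
    ⟨subset_convexHull ℝ V v.1.2, by rw [real_inner_comm]; exact v.2⟩
  obtain ⟨⟨t, ht⟩⟩ : Nonempty {v : V | ⟪v.1 - c, w⟫_ℝ = 1} := by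
    by_contra h
    rw [not_nonempty_iff] at h
    rw [Set.range_eq_empty, Submodule.span_empty] at hspan
    have := congrArg (fun S : Submodule ℝ (EuclideanSpace ℝ (Fin n)) => Module.finrank ℝ S) hspan
    simp only [finrank_bot, finrank_top, finrank_euclideanSpace_fin] at this
    exact hn this.symm
  have htT : t.1 ∈ T := hmem ⟨t, ht⟩
  have hw0 : w ≠ 0 := by
    rintro rfl
    simpa using htT.2
  refine ⟨⟨fun _ => ⟨innerSL ℝ w, ?_⟩, ⟨t, htT⟩, ?_⟩, fun w' hw' => ?_⟩
  · ext x
    refine and_congr_right fun hx => ⟨fun h y hy => ?_, fun h => ?_⟩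
    · have := hle y hy
      rw [← h, inner_sub_right, inner_sub_right] at this
      simpa using this
    · have h1 := h t htT.1
      have h2 := htT.2
      have h3 := hle x hx
      rw [innerSL_apply_apply, innerSL_apply_apply] at h1
      rw [inner_sub_right] at h2 h3 ⊢
      linarith
  · have h1 : vectorSpan ℝ T ≠ ⊤ := by
      intro h
      have h2 : vectorSpan ℝ T ≤ LinearMap.ker (innerSL ℝ w).toLinearMap := by
        rw [vectorSpan, Submodule.span_le]
        rintro _ ⟨x, hx, y, hy, rfl⟩
        have hx := hx.2
        have hy := hy.2
        rw [inner_sub_right] at hx hy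
        change ⟪w, x - y⟫_ℝ = 0
        rw [inner_sub_right]
        linarith
      rw [h] at h2
      exact hw0 (inner_self_eq_zero.1 (h2 (Submodule.mem_top (x := w))))
    have h2 := Submodule.finrank_lt h1
    have h3 : (⊤ : Submodule ℝ (EuclideanSpace ℝ (Fin n))) ≤
        vectorSpan ℝ T ⊔ Submodule.span ℝ {t.1 - c} := by
      rw [← hspan, Submodule.span_le]
      rintro _ ⟨v, rfl⟩
      change v.1.1 - c ∈ _
      rw [← sub_add_sub_cancel v.1.1 t.1 c]
      exact Submodule.add_mem_sup (vsub_mem_vectorSpan ℝ (hmem v) htT)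
        (Submodule.mem_span_singleton_self _)
    have h4 := Submodule.finrank_mono h3
    have h5 := Submodule.finrank_add_le_finrank_add_finrank (vectorSpan ℝ T)
      (Submodule.span ℝ {t.1 - c})
    have h6 := finrank_span_le_card (R := ℝ) ({t.1 - c} : Set (EuclideanSpace ℝ (Fin n)))
    rw [Set.toFinset_singleton, Finset.card_singleton] at h6
    rw [finrank_top] at h4
    rw [finrank_euclideanSpace_fin] at h2 h4
    omega
  · have h1 : (Submodule.span ℝ (Set.range
        fun v : {v : V | ⟪v.1 - c, w⟫_ℝ = 1} => v.1.1 - c)) ≤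
        LinearMap.ker (innerSL ℝ (w' - w)).toLinearMap := by
      rw [Submodule.span_le]
      rintro _ ⟨v, rfl⟩
      change ⟪w' - w, v.1.1 - c⟫_ℝ = 0
      rw [inner_sub_left, (hmem v).2, hw' _ (hmem v).1 (hmem v).2, sub_self]
    rw [hspan] at h1
    exact sub_eq_zero.1 (inner_self_eq_zero.1 (h1 (Submodule.mem_top (x := w' - w))))

/-- A simple polytope is cut out by the normal vectors of its facets: the polar dual is the convex hull
of its vertices by the Krein–Milman theorem, and these are facet normals. -/
theorem IsSimplePolytope.exists_normals (hP : IsSimplePolytope P) (hn : n ≠ 0) :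
    ∃ u : Facet P → EuclideanSpace ℝ (Fin n), IsSimpleNormals u ∧
      dualComplex P = tightComplex u := by
  obtain ⟨c, hc⟩ := hP.interior_nonempty
  choose u hu hFu using fun F : Facet P => hP.exists_normal hc F.2
  have hmem (y : EuclideanSpace ℝ (Fin n)) : y ∈ polarBody u ↔ c + y ∈ P := by
    refine ⟨fun hy => ?_, fun hy F => by simpa using hu F _ hy⟩
    obtain ⟨V, hV, hPV⟩ := hP.exists_finite
    have hQ := isCompact_polarBody_sub (hPV ▸ hc)
    have hsub : (polarBody fun v : V => v.1 - c) ⊆ {w | ⟪w, y⟫_ℝ ≤ 1} := by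
      have hconv : Convex ℝ (polarBody fun v : V => v.1 - c) := by
        simp only [polarBody, Set.ofPred_forall]
        exact convex_iInter fun v =>
          convex_halfSpace_le (innerSL ℝ (v.1 - c)).isBoundedLinearMap.toIsLinearMap _
      rw [← closure_convexHull_extremePoints hQ hconv]
      refine closure_minimal (convexHull_min (fun w hw => ?_) ?_)
        (isClosed_le (by fun_prop) continuous_const)
      · obtain ⟨h1, h2⟩ := isFacet_of_extremePoint hn hV hw
        rw [← hPV] at h1 h2
        have h3 := hFu ⟨_, h1⟩
        have h4 : u ⟨_, h1⟩ = w := h2 _ fun x hx hx1 => (h3.subset ⟨hx, hx1⟩).2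
        have h5 := hy ⟨_, h1⟩
        rwa [h4] at h5
      · simp only [real_inner_comm y]
        exact convex_halfSpace_le (innerSL ℝ y).isBoundedLinearMap.toIsLinearMap _
    by_contra hyP
    obtain ⟨l, s, hl, hs⟩ := geometric_hahn_banach_closed_point hP.convex hP.isCompact.isClosed hyP
    have hpos := sub_pos.2 (hl c (interior_subset hc))
    have hw (x) : ⟪(s - l c)⁻¹ • (InnerProductSpace.toDual ℝ (EuclideanSpace ℝ (Fin n))).symm l,
        x⟫_ℝ = l x / (s - l c) := by
      rw [real_inner_smul_left, InnerProductSpace.toDual_symm_apply]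
      ring
    have h1 := hsub (inner_sub_le_one.2 fun x hx => by
      rw [hw, div_le_one hpos, map_sub]
      linarith [hl x (hPV ▸ hx)])
    rw [Set.mem_ofPred_eq, hw, div_le_one hpos] at h1
    rw [map_add] at hs
    linarith
  have hF (F : Facet P) (y : EuclideanSpace ℝ (Fin n)) (hy : y ∈ polarBody u) :
      c + y ∈ F.1 ↔ ⟪u F, y⟫_ℝ = 1 := by
    rw [hFu F, Set.mem_ofPred_eq, add_sub_cancel_left]
    exact and_iff_right ((hmem y).1 hy)
  refine ⟨u, ⟨?_, fun v hv => ?_⟩, ?_⟩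
  · have : polarBody u = (fun x => x - c) '' P := by
      ext y
      rw [hmem]
      refine ⟨fun h => ⟨_, h, add_sub_cancel_left c y⟩, ?_⟩
      rintro ⟨x, hx, rfl⟩
      simpa using hx
    rw [this]
    exact hP.isCompact.image (by fun_prop)
  · have hcv : c + v ∈ P.extremePoints ℝ := by
      refine ⟨(hmem v).1 hv.1, fun x₁ hx₁ x₂ hx₂ hx => ?_⟩
      rw [← sub_eq_iff_eq_add']
      refine hv.2 ((hmem _).2 (by simpa using hx₁)) ((hmem (x₂ - c)).2 (by simpa using hx₂)) ?_
      rw [← mem_openSegment_translate ℝ c]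
      simpa using hx
    rw [← Set.ncard_image_of_injective _ Subtype.val_injective]
    refine Eq.trans (congrArg Set.ncard ?_) (hP.simple _ hcv)
    ext F
    constructor
    · rintro ⟨F, h, rfl⟩
      exact ⟨F.2, (hF F v hv.1).2 h⟩
    · rintro ⟨h1, h2⟩
      exact ⟨⟨F, h1⟩, (hF ⟨F, h1⟩ v hv.1).1 h2, rfl⟩
  · ext σ
    constructor
    · rintro ⟨x, hx, h⟩
      have hx' : x - c ∈ polarBody u := (hmem _).2 (by simpa using hx)
      exact ⟨x - c, hx', fun F hFσ => (hF F _ hx').1 (by simpa using h F hFσ)⟩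
    · rintro ⟨y, hy, h⟩
      exact ⟨c + y, (hmem y).1 hy, fun F hFσ => (hF F y hy).2 (h F hFσ)⟩

end SimplePolytope

/-! ### The chart of a moment-angle manifold with nonzero coordinates -/

section TorusChart

open Topology

variable {n : ℕ} {J : Type} {K : Set (Set J)}

/-- The torus inside a polyhedral product. -/
def torusIncl (h0 : ∅ ∈ K) : C(J → Circle, polyDisc K) where
  toFun θ := ⟨fun F => θ F, fun F => (Circle.norm_coe _).le, by simpa [Circle.norm_coe] using h0⟩
  continuous_toFun := Continuous.subtype_mk
    (continuous_pi fun F => continuous_subtype_val.comp (continuous_apply F)) _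

/-- Each point is joined to the torus by the linear motion to `1` of the coordinates inside the
disc. -/
theorem pathConnectedSpace_polyDisc (hK : IsLowerSet K) (h0 : ∅ ∈ K) :
    PathConnectedSpace (polyDisc K) := by
  classical
  have htorus (z : polyDisc K) : ∃ θ : J → Circle, Joined z (torusIncl h0 θ) := by
    let f (t : ℝ) : J → ℂ := fun F => if ‖z.1 F‖ < 1 then (1 - t) * z.1 F + t else z.1 F
    have hlt (t : unitInterval) (F : J) (hF : ‖z.1 F‖ < 1) : ‖f t F‖ ≤ 1 := by
      simp only [f, if_pos hF]
      refine (norm_add_le _ _).trans ?_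
      rw [norm_mul, ← Complex.ofReal_one, ← Complex.ofReal_sub, Complex.norm_real,
        Complex.norm_real, Real.norm_of_nonneg (sub_nonneg.2 t.2.2), Real.norm_of_nonneg t.2.1]
      nlinarith [t.2.1, t.2.2, norm_nonneg (z.1 F)]
    have hf (t : unitInterval) : f t ∈ polyDisc K := by
      refine ⟨fun F => ?_, hK (fun F hF => ?_) z.2.2⟩
      · by_cases hF : ‖z.1 F‖ < 1
        · exact hlt t F hF
        · simp only [f, if_neg hF]
          exact z.2.1 F
      · by_contra hF'
        replace hF' : ¬‖z.1 F‖ < 1 := hF'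
        replace hF : ‖f t F‖ < 1 := hF
        simp only [f, if_neg hF'] at hF
        exact hF' hF
    have hc : Continuous fun t : unitInterval => f t := by
      refine continuous_pi fun F => ?_
      by_cases hF : ‖z.1 F‖ < 1
      · simp only [f, if_pos hF]
        fun_prop
      · simp only [f, if_neg hF]
        exact continuous_const
    have h1 (F) : ‖f 1 F‖ = 1 := by
      by_cases hF : ‖z.1 F‖ < 1
      · simp [f, if_pos hF]
      · simp only [f, if_neg hF]
        exact le_antisymm (z.2.1 F) (not_lt.1 hF)
    refine ⟨fun F => ⟨f 1 F, mem_sphere_zero_iff_norm.2 (h1 F)⟩,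
      ⟨⟨⟨fun t => ⟨f t, hf t⟩, hc.subtype_mk _⟩, Subtype.ext (funext fun F => ?_), rfl⟩⟩⟩
    change (if ‖z.1 F‖ < 1 then (1 - ((0 : ℝ) : ℂ)) * z.1 F + ((0 : ℝ) : ℂ) else z.1 F) = z.1 F
    simp
  refine ⟨⟨torusIncl h0 1⟩, fun x y => ?_⟩
  obtain ⟨θ, hθ⟩ := htorus x
  obtain ⟨η, hη⟩ := htorus y
  exact hθ.trans (((PathConnectedSpace.joined θ η).map (torusIncl h0).continuous).trans hη.symm)

/-- The points with nonzero coordinates are dense: replace vanishing coordinates by a small number. -/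
theorem exists_mem_forall_ne_zero (hK : IsLowerSet K) {U : Set (polyDisc K)} (hU : IsOpen U)
    {z : polyDisc K} (hz : z ∈ U) : ∃ z' ∈ U, ∀ F, z'.1 F ≠ 0 := by
  classical
  let f (t : ℝ) : J → ℂ := fun F => if z.1 F = 0 then t else z.1 F
  have hf (t : Set.Ico (0 : ℝ) 1) : f t ∈ polyDisc K := by
    refine ⟨fun F => ?_, hK (fun F hF => ?_) z.2.2⟩
    · by_cases h : z.1 F = 0
      · simp only [f, if_pos h]
        rw [Complex.norm_real, Real.norm_of_nonneg t.2.1]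
        exact t.2.2.le
      · simp only [f, if_neg h]
        exact z.2.1 F
    · change ‖z.1 F‖ < 1
      by_cases h : z.1 F = 0
      · rw [h, norm_zero]
        exact one_pos
      · replace hF : ‖f t F‖ < 1 := hF
        simp only [f, if_neg h] at hF
        exact hF
  have hc : Continuous fun t : Set.Ico (0 : ℝ) 1 => (⟨f t, hf t⟩ : polyDisc K) := by
    refine Continuous.subtype_mk (continuous_pi fun F => ?_) _
    by_cases h : z.1 F = 0
    · simp only [f, if_pos h]
      fun_prop
    · simp only [f, if_neg h]
      exact continuous_const
  have h0 : (⟨f 0, hf ⟨0, by simp⟩⟩ : polyDisc K) = z := by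
    apply Subtype.ext
    funext F
    change (if z.1 F = 0 then ((0 : ℝ) : ℂ) else z.1 F) = z.1 F
    split_ifs with h
    · rw [h, Complex.ofReal_zero]
    · rfl
  obtain ⟨V, hV, hVU⟩ := isOpen_induced_iff.1 (hU.preimage hc)
  have h0V : (0 : ℝ) ∈ V := by
    have : (⟨0, by simp⟩ : Set.Ico (0 : ℝ) 1) ∈ Subtype.val ⁻¹' V := by
      rw [hVU, Set.mem_preimage]
      exact h0.symm ▸ hz
    exact this
  obtain ⟨ε, hε, hball⟩ := Metric.isOpen_iff.1 hV 0 h0V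
  have ht : min (ε / 2) (1 / 2) ∈ Set.Ico (0 : ℝ) 1 :=
    ⟨by positivity, (min_le_right _ _).trans_lt (by norm_num)⟩
  have hpos : 0 < min (ε / 2) (1 / 2 : ℝ) := by positivity
  have htV : (⟨_, ht⟩ : Set.Ico (0 : ℝ) 1) ∈ Subtype.val ⁻¹' V := hball (by
    rw [mem_ball_zero_iff, Real.norm_of_nonneg hpos.le]
    exact (min_le_left _ _).trans_lt (by linarith))
  rw [hVU] at htV
  refine ⟨_, htV, fun F => ?_⟩
  change (if z.1 F = 0 then ((min (ε / 2) (1 / 2) : ℝ) : ℂ) else z.1 F) ≠ 0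
  split_ifs with h
  · exact Complex.ofReal_ne_zero.2 hpos.ne'
  · exact h

variable [Fintype J]

theorem isCompact_polyDisc (hK : IsLowerSet K) : IsCompact (polyDisc K) := by
  have h : polyDisc K = {z | ∀ F, ‖z F‖ ≤ 1} ∩ ⋃ σ : K, {z | ∀ F, F ∉ σ.1 → ‖z F‖ = 1} := by
    ext z
    simp only [polyDisc, Set.mem_inter_iff, Set.mem_iUnion, Set.mem_ofPred_eq]
    refine and_congr_right fun hz => ⟨fun h => ⟨⟨_, h⟩, fun F hF => ?_⟩, ?_⟩
    · exact le_antisymm (hz F) (not_lt.1 hF)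
    · rintro ⟨σ, hσ⟩
      exact hK (fun F hF => by_contra fun h => (ne_of_lt hF) (hσ F h)) σ.2
  refine (isCompact_univ_pi fun F : J => isCompact_closedBall (0 : ℂ) 1).of_isClosed_subset
    ?_ fun z hz F _ => mem_closedBall_zero_iff.2 (hz.1 F)
  rw [h]
  refine IsClosed.inter ?_ (isClosed_iUnion_of_finite fun σ => ?_)
  · simp only [Set.ofPred_forall]
    exact isClosed_iInter fun F => isClosed_le (continuous_apply F).norm continuous_const
  · simp only [Set.ofPred_forall]
    exact isClosed_iInter fun F => isClosed_iInter fun _ =>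
      isClosed_eq (continuous_apply F).norm continuous_const

variable {u : J → EuclideanSpace ℝ (Fin n)}

theorem norm_exp_mul_circle (r : ℝ) (θ : Circle) : ‖(Real.exp r * θ : ℂ)‖ = Real.exp r := by
  rw [norm_mul, Circle.norm_coe, mul_one, Complex.norm_real, Real.norm_of_nonneg (Real.exp_pos _).le]

/-- The points of the moment-angle complex with nonzero coordinates, in polar coordinates: minus the
logarithms of the radii form a point of the normal fan, which is homeomorphic to `ℝⁿ`. -/
noncomputable def IsSimpleNormals.polarHomeomorph (h : IsSimpleNormals u) :
    EuclideanSpace ℝ (Fin n) × (J → Circle) ≃ₜ {z : polyDisc (tightComplex u) // ∀ F, z.1 F ≠ 0} where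
  toFun p := ⟨⟨fun F => Real.exp (-(h.fanHomeomorph.symm p.1).1 F) * p.2 F, by
    refine ⟨fun F => ?_, isLowerSet_tightComplex (fun F (hF : ‖_‖ < 1) => ?_)
      (h.fanHomeomorph.symm p.1).2.2⟩
    · rw [norm_exp_mul_circle, Real.exp_le_one_iff]
      exact neg_nonpos.2 ((h.fanHomeomorph.symm p.1).2.1 F)
    · rw [norm_exp_mul_circle, Real.exp_lt_one_iff, neg_lt_zero] at hF
      exact hF.ne'⟩, fun F => mul_ne_zero (Complex.ofReal_ne_zero.2 (Real.exp_pos _).ne')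
        (Circle.coe_ne_zero _)⟩
  invFun z := (h.fanHomeomorph ⟨fun F => -Real.log ‖z.1.1 F‖,
      fun F => neg_nonneg.2 (Real.log_nonpos (norm_nonneg _) (z.1.2.1 F)),
      isLowerSet_tightComplex (fun F (hF : -Real.log ‖_‖ ≠ 0) => by
        refine lt_of_le_of_ne (z.1.2.1 F) fun h1 => hF ?_
        rw [h1, Real.log_one, neg_zero]) z.1.2.2⟩,
    fun F => ⟨z.1.1 F / ‖z.1.1 F‖, by
      change _ ∈ Metric.sphere (0 : ℂ) 1
      rw [mem_sphere_zero_iff_norm, norm_div, Complex.norm_real, norm_norm,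
        div_self (norm_ne_zero_iff.2 (z.2 F))]⟩)
  left_inv p := by
    refine Prod.ext (h.fanHomeomorph.symm_apply_eq.1 (Subtype.ext (funext fun F => ?_))).symm
      (funext fun F => Circle.ext ?_)
    · change _ = -Real.log ‖(Real.exp (-(h.fanHomeomorph.symm p.1).1 F) * p.2 F : ℂ)‖
      rw [norm_exp_mul_circle, Real.log_exp, neg_neg]
    · change (Real.exp (-(h.fanHomeomorph.symm p.1).1 F) * p.2 F : ℂ) /
        (‖(Real.exp (-(h.fanHomeomorph.symm p.1).1 F) * p.2 F : ℂ)‖ : ℂ) = p.2 F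
      rw [norm_exp_mul_circle, mul_div_cancel_left₀]
      exact Complex.ofReal_ne_zero.2 (Real.exp_pos _).ne'
  right_inv z := by
    refine Subtype.ext (Subtype.ext (funext fun F => ?_))
    have hpos : 0 < ‖z.1.1 F‖ := norm_pos_iff.2 (z.2 F)
    dsimp only
    rw [Homeomorph.symm_apply_apply]
    change ((Real.exp (-(-Real.log ‖z.1.1 F‖)) : ℝ) : ℂ) * (z.1.1 F / ‖z.1.1 F‖) = z.1.1 F
    rw [neg_neg, Real.exp_log hpos, mul_div_cancel₀]
    exact Complex.ofReal_ne_zero.2 hpos.ne'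
  continuous_toFun := by
    refine Continuous.subtype_mk (Continuous.subtype_mk (continuous_pi fun F => ?_) _) _
    have h1 : Continuous fun p : EuclideanSpace ℝ (Fin n) × (J → Circle) =>
        (h.fanHomeomorph.symm p.1).1 F :=
      (continuous_apply F).comp (continuous_subtype_val.comp
        (h.fanHomeomorph.symm.continuous.comp continuous_fst))
    exact (Complex.continuous_ofReal.comp (Real.continuous_exp.comp h1.neg)).mul
      (continuous_subtype_val.comp ((continuous_apply F).comp continuous_snd))
  continuous_invFun := by
    have h1 (F : J) : Continuous fun z : {z : polyDisc (tightComplex u) // ∀ F, z.1 F ≠ 0} =>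
        z.1.1 F :=
      (continuous_apply F).comp (continuous_subtype_val.comp continuous_subtype_val)
    refine Continuous.prodMk (h.fanHomeomorph.continuous.comp (Continuous.subtype_mk
      (continuous_pi fun F => ?_) _)) (continuous_pi fun F =>
        Topology.IsInducing.subtypeVal.continuous_iff.2 ?_)
    · exact ((h1 F).norm.log fun z => norm_ne_zero_iff.2 (z.2 F)).neg
    · exact (h1 F).div (Complex.continuous_ofReal.comp (h1 F).norm) fun z =>
        Complex.ofReal_ne_zero.2 (norm_ne_zero_iff.2 (z.2 F))

theorem IsSimpleNormals.polarHomeomorph_zero (h : IsSimpleNormals u) (θ : J → Circle) (F : J) :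
    ‖(h.polarHomeomorph (0, θ)).1.1 F‖ = 1 := by
  change ‖(Real.exp (-(h.fanHomeomorph.symm 0).1 F) * θ F : ℂ)‖ = 1
  rw [h.fanHomeomorph_symm_zero, norm_exp_mul_circle]
  simp

/-- The top cohomology of a moment-angle manifold vanishes off each point in the domain of a
Euclidean chart. By the homogeneity of charts the point may be moved, first to a point with nonzero
coordinates and then to a point of the torus. -/
theorem IsSimpleNormals.pull_complIncl_chart_eq_zero (h : IsSimpleNormals u) [Nonempty J]
    {E : Type} [NormedAddCommGroup E] [NormedSpace ℝ E] [FiniteDimensional ℝ E]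
    {φ : E → polyDisc (tightComplex u)} (hφ : IsOpenEmbedding φ)
    (α : H (polyDisc (tightComplex u)) (Fintype.card J + n)) :
    pull (complIncl (φ 0)) _ α = 0 := by
  have hK : IsLowerSet (tightComplex u) := isLowerSet_tightComplex
  have hopen : IsOpen {z : polyDisc (tightComplex u) | ∀ F, z.1 F ≠ 0} := by
    simp only [Set.ofPred_forall]
    exact isOpen_iInter_of_finite fun F =>
      isOpen_ne.preimage ((continuous_apply F).comp continuous_subtype_val)
  obtain ⟨_, ⟨v, rfl⟩, hv⟩ := exists_mem_forall_ne_zero hK hφ.isOpen_range ⟨0, rfl⟩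
  obtain ⟨⟨w, θ⟩, hw⟩ := h.polarHomeomorph.surjective ⟨φ v, hv⟩
  have hg : IsOpenEmbedding fun p => (h.polarHomeomorph p).1 :=
    hopen.isOpenEmbedding_subtypeVal.comp h.polarHomeomorph.isOpenEmbedding
  have h1 := pull_complIncl_eq_zero hg w θ α (pull_complIncl_torus_eq_zero hK
    (fun σ hσ => h.ncard_le hσ) ‹_› _ (h.polarHomeomorph_zero θ) α)
  have hg' : IsOpenEmbedding fun p : E × Unit => φ (v + p.1) :=
    hφ.comp ((Homeomorph.prodPUnit E).trans (Homeomorph.addLeft v)).isOpenEmbedding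
  have h2 := pull_complIncl_eq_zero hg' (-v) () α (by
    have : φ (v + 0) = (h.polarHomeomorph (w, θ)).1 := by rw [hw, add_zero]
    dsimp only
    rw [this]
    exact h1)
  dsimp only at h2
  rwa [add_neg_cancel] at h2

end TorusChart

/-! ### The case of a one-point manifold -/

section Point

open Topology Metric

/-- For a one-point manifold the disc is everything that is to be removed. -/
theorem isEmpty_thickeningBoundary {Z : Type} [TopologicalSpace Z] [Subsingleton Z] {d : ℕ}
    (φ : EuclideanSpace ℝ (Fin d) → Z) : IsEmpty (thickeningBoundary φ) := by
  have h : (φ '' ball 0 1)ᶜ = ∅ := Set.eq_empty_of_forall_notMem fun z hz =>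
    hz ⟨0, mem_ball_self one_pos, Subsingleton.elim _ _⟩
  rw [Set.isEmpty_coe_sort, thickeningBoundary, h, Set.empty_prod, frontier_empty]

theorem isEmpty_surgery {Z : Type} [Subsingleton Z] (φ : EuclideanSpace ℝ (Fin 0) → Z) :
    IsEmpty (Surgery (surgeryEmbedding φ)) := by
  refine ⟨fun q => ?_⟩
  induction q using Quot.ind with
  | mk x =>
    rcases x with ⟨p, hp⟩ | ⟨⟨x, hx⟩, -⟩
    · exact hp ⟨(0, p.2), ⟨mem_ball_self one_pos, trivial⟩,
        Prod.ext (Subsingleton.elim _ _) rfl⟩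
    · rw [Subsingleton.elim x 0, mem_sphere, dist_self] at hx
      exact zero_ne_one hx

/-- If `Z` is a point, its thickening has empty boundary, and `Z × ℂ` takes the part of the
thickened surgery trace. -/
theorem exists_isReduction_of_subsingleton {Z : Type} [TopologicalSpace Z] [Subsingleton Z]
    {φ : EuclideanSpace ℝ (Fin 0) → Z} (hφ : IsOpenEmbedding φ) {ζ : H Z 0}
    (hζ : IsFundamentalClass ζ) {e : H Circle 1} (he : IsFundamentalClass e) :
    ∃ i, IsReduction (X := thickeningBoundary φ) ζ e (traceFst φ) (incl slab_subset_tracePlus) i := by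
  have : Nonempty Z := ⟨φ 0⟩
  have := isEmpty_thickeningBoundary φ
  have hV : tracePlus φ = Prod.fst ⁻¹' openDisc φ := by
    have h (z : Z) : 0 < discHeight φ z :=
      (discHeight_pos_iff hφ.injective).2 ⟨0, by simp, Subsingleton.elim _ _⟩
    ext p
    exact iff_of_true (lt_max_of_lt_left (h p.1)) (h p.1)
  have htube (k : ℕ) (v : H (tracePlus φ) k) : ∃ c, v = pull (toUnit _) k c := by
    revert v
    rw [hV]
    exact exists_eq_tube hφ k
  refine ⟨⟨fun p => isEmptyElim p, continuous_of_const fun p => isEmptyElim p⟩, rfl,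
    pull_tracePlus_injective hφ, exists_res_tracePlus_eq hφ,
    eq_zero_of_res_tracePlus he hφ.injective, fun k a => ⟨0, (eq_zero_of_isEmpty _).trans
      (eq_zero_of_isEmpty _).symm⟩, eq_zero_of_isEmpty _, fun k v _ => ?_⟩
  obtain ⟨c, rfl⟩ := htube k v
  cases k with
  | zero =>
    obtain ⟨m, rfl⟩ := exists_eq_zsmul_one c
    obtain ⟨l, hl⟩ := hζ.2 (cohomologyOne _)
    refine ⟨m * l, ?_⟩
    dsimp only at hl
    rw [map_zsmul, pull_one, ← pull_one (traceFst φ), ← hl, map_zsmul, map_zsmul, map_zsmul,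
      smul_smul]
  | succ k =>
    refine ⟨0, ?_⟩
    rw [pull_toUnit_succ, map_zero, zero_smul]

end Point

/-! ### Moment-angle manifolds -/

section MomentAngle

variable {n : ℕ} {P : Set (EuclideanSpace ℝ (Fin n))}

theorem isLowerSet_dualComplex : IsLowerSet (dualComplex P) :=
  fun _ _ h ⟨x, hx, hσ⟩ => ⟨x, hx, fun F hF => hσ F (h hF)⟩

theorem IsSimplePolytope.empty_mem_dualComplex (hP : IsSimplePolytope P) : ∅ ∈ dualComplex P := by
  obtain ⟨x, hx⟩ := hP.interior_nonempty
  exact ⟨x, interior_subset hx, fun F hF => hF.elim⟩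

theorem momentAngle_eq_polyDisc : momentAngle P = polyDisc (dualComplex P) := by
  ext z
  simp only [momentAngle, polyDisc, Set.mem_iUnion, Set.mem_ofPred_eq, exists_prop]
  constructor
  · rintro ⟨σ, hσ, h1, h2⟩
    exact ⟨h1, isLowerSet_dualComplex (fun F hF => by_contra fun h => (ne_of_lt hF) (h2 F h)) hσ⟩
  · rintro ⟨h1, h2⟩
    exact ⟨_, h2, h1, fun F hF => le_antisymm (h1 F) (not_lt.1 hF)⟩

theorem IsSimplePolytope.compactSpace (hP : IsSimplePolytope P) : CompactSpace (momentAngle P) := by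
  have : Finite (Facet P) := hP.finite_facets
  have := Fintype.ofFinite (Facet P)
  rw [← isCompact_iff_compactSpace, momentAngle_eq_polyDisc]
  exact isCompact_polyDisc isLowerSet_dualComplex

theorem IsSimplePolytope.pathConnectedSpace (hP : IsSimplePolytope P) :
    PathConnectedSpace (momentAngle P) := by
  rw [momentAngle_eq_polyDisc]
  exact pathConnectedSpace_polyDisc isLowerSet_dualComplex hP.empty_mem_dualComplex

/-- The top cohomology of the moment-angle manifold vanishes off the center of a disc. -/
theorem IsSimplePolytope.pull_complIncl_eq_zero (hP : IsSimplePolytope P) (hn : n ≠ 0) {m : ℕ}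
    (hm : {F | IsFacet P F}.ncard = m) {φ : EuclideanSpace ℝ (Fin (m + n)) → momentAngle P}
    (hφ : Topology.IsOpenEmbedding φ) (α : H (momentAngle P) (m + n)) :
    pull (complIncl (φ 0)) (m + n) α = 0 := by
  have : Finite (Facet P) := hP.finite_facets
  have := Fintype.ofFinite (Facet P)
  have hm' : m = Fintype.card (Facet P) := by
    rw [← hm, ← Nat.card_eq_fintype_card]
    rfl
  clear hm
  subst hm'
  obtain ⟨u, hu, hK⟩ := hP.exists_normals hn
  have hne := hu.nonempty hn
  have h : momentAngle P = polyDisc (tightComplex u) := by rw [momentAngle_eq_polyDisc, hK]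
  revert φ α
  rw [h]
  exact fun hφ α => hu.pull_complIncl_chart_eq_zero hφ α

end MomentAngle

/-! ### The cohomology ring and the surgery description -/

section Assembly

open Topology

theorem res_offCenter_eq_zero {Z : Type} [TopologicalSpace Z] [T2Space Z] {d : ℕ}
    {φ : EuclideanSpace ℝ (Fin d) → Z} (hφ : IsOpenEmbedding φ)
    (h : ∀ α : H Z d, pull (complIncl (φ 0)) d α = 0) (α : H (Set.univ : Set Z) d) :
    res (isOpenUnion_disc hφ).left_subset d α = 0 := by
  obtain ⟨β, rfl⟩ := (pull_homeomorph_bijective (Homeomorph.Set.univ Z) d).2 α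
  let f : C(offCenter φ, ({φ 0}ᶜ : Set Z)) :=
    ⟨fun z => ⟨z.1, (discHeight_lt_two_iff hφ.injective).1 z.2⟩, by fun_prop⟩
  rw [res, ← pull_comp]
  change pull ((complIncl (φ 0)).comp f) d β = 0
  rw [pull_comp, h β, map_zero]

end Assembly

theorem proposition1p2 (n m : ℕ) (P : Set (EuclideanSpace ℝ (Fin n))) (hP : IsSimplePolytope P)
    (hm : {F | IsFacet P F}.ncard = m)
    (φ : EuclideanSpace ℝ (Fin (m + n)) → momentAngle P) (hφ : Topology.IsOpenEmbedding φ)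
    (ζ : SingularCohomology.H (momentAngle P) (m + n)) (hζ : IsFundamentalClass ζ)
    (e : SingularCohomology.H Circle 1) (he : IsFundamentalClass e) :
    (∃ (Φ : SingularCohomology.CohomologyRing (thickeningBoundary φ) ≃+* ReducedTensorRing ζ e)
        (Ψ : SingularCohomology.CohomologyRing (thickeningBoundary φ) ≃+ TensorModClasses ζ e),
      (∀ (y : SingularCohomology.CohomologyRing (thickeningBoundary φ)) (t : omitSubring _ e),
        Φ y = Ideal.Quotient.mk (classIdeal ζ e) t → Ψ y = QuotientAddGroup.mk (t : TensorRing _)) ∧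
      ∀ (k : ℕ) (y : SingularCohomology.CohomologyRing (thickeningBoundary φ)),
        y ∈ SingularCohomology.degreePart (thickeningBoundary φ) k ↔
          ∃ t ∈ tensorDegreePart (momentAngle P) k, Ψ y = QuotientAddGroup.mk t) ∧
    Nonempty (thickeningBoundary φ ≃ₜ
      Surgery fun p : EuclideanSpace ℝ (Fin (m + n)) × Circle => (φ p.1, p.2)) := by
  have := hP.compactSpace
  have := hP.pathConnectedSpace
  rcases eq_or_ne n 0 with rfl | hn
  · obtain rfl : m = 0 := by
      rw [← hm, Set.ncard_eq_zero hP.finite_facets]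
      exact Set.eq_empty_of_forall_notMem fun F hF => not_isFacet_zero hF
    have : Subsingleton (momentAngle P) :=
      ⟨fun z w => Subtype.ext (funext fun F => isEmptyElim F)⟩
    obtain ⟨i, hi⟩ := exists_isReduction_of_subsingleton hφ hζ he
    have := isEmpty_thickeningBoundary φ
    have := isEmpty_surgery φ
    exact ⟨hi.exists_ringEquiv he, ⟨(Homeomorph.empty : _ ≃ₜ Surgery (surgeryEmbedding φ))⟩⟩
  · have hd : m + n ≠ 0 := by omega
    obtain ⟨k, hk⟩ := Nat.exists_eq_succ_of_ne_zero hd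
    exact ⟨(isReduction_tracePlus hφ hk hζ he (res_offCenter_eq_zero hφ fun α =>
      hP.pull_complIncl_eq_zero hn hm hφ α)).exists_ringEquiv he,
      nonempty_homeomorph_surgery hφ hd⟩
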